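/- Let $\Omega=(a,b)^2$, $1<\alpha\le 2$, $m>1$, $T>0$. For $0<\varepsilon\le 1$ consider the periodic problem $$\partial_{tt}u+(-\Delta)^{\alpha/2}u+\tfrac1\varepsilon\sin(\varepsilon u)=0\ \text{ in }\Omega,\qquad u(\cdot,0)=u_0,\quad \partial_t u(\cdot,0)=u_1,$$ with $u$ real-valued, where $(-\Delta)^{\alpha/2}$ has the Fourier symbol $(\mu_k^2+\mu_l^2)^{\alpha/2}$, $\mu_j=2\pi j/(b-a)$, and let $\|w\|_s^2=\sum_{k,l\in\mathbb Z}(1+\mu_k^2+\mu_l^2)^s|\widehat w_{kl}|^2$ denote the norm of $H^s(\Omega)$ defined by the Fourier coefficients $\widehat w_{kl}$, $\|\cdot\|=\|\cdot\|_0$. Put $T_\varepsilon=T/\varepsilon^2$ and assume (A) the exact solution exists on $[0,T_\varepsilon]$ with $\|u\|_{L^\infty([0,T_\varepsilon];H^{m+\alpha/2})}\le M$ and $\|\partial_t u\|_{L^\infty([0,T_\varepsilon];H^m)}\le M$, where $M$ does not depend on $\varepsilon$. Let $N$ be an even positive integer, $h=(b-a)/N$, $x_p=a+ph$, $y_q=a+qh$,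 $T_N=\{-N/2,\dots,N/2-1\}$, $\delta_{kl}=\sqrt{1+(\mu_k^2+\mu_l^2)^{\alpha/2}}$, $f(s)=\frac1\varepsilon\sin(\varepsilon s)-s$. For a grid function $g=(g_{pq})$ let $\tilde g_{kl}=N^{-2}\sum_{p,q=0}^{N-1}g_{pq}e^{-i\mu_k(x_p-a)-i\mu_l(y_q-a)}$, let $I_Ng=\sum_{k,l\in T_N}\tilde g_{kl}e^{i\mu_k(x-a)+i\mu_l(y-a)}$ be its trigonometric interpolant, and for a symbol $\sigma_{kl}$ let $\sigma g$ be the grid function with values $\sum_{k,l\in T_N}\sigma_{kl}\tilde g_{kl}e^{i\mu_k(x_p-a)+i\mu_l(y_q-a)}$. With time step $\tau>0$ and $t_n=n\tau$, the time-splitting Fourier pseudo-spectral scheme is $\varphi^0=u_0-i\,\delta^{-1}u_1$ (on the grid) and $$\varphi^{(1)}=e^{i\tau\delta/2}\varphi^n,\qquad \varphi^{(2)}=\varphi^{(1)}+\tau\, i\,\delta^{-1} f\Big(\tfrac{\varphi^{(1)}+\overline{\varphi^{(1)}}}2\Big),\qquad \varphi^{n+1}=e^{i\tau\delta/2}\varphi^{(2)},$$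 $$u^{n+1}=\tfrac12\big(\varphi^{n+1}+\overline{\varphi^{n+1}}\big),\qquad v^{n+1}=\tfrac i2\,\delta\big(\varphi^{n+1}-\overline{\varphi^{n+1}}\big),\qquad u^0=u_0,\ v^0=u_1 .$$ (i) Let $\gamma\in(0,1)$. There are $h_0>0$, $\tau_*\in(0,1)$ and $C>0$, depending only on $a,b,\alpha,m,T,\gamma,M$ (not on $\varepsilon,h,\tau,\tau_0$), such that for all $\varepsilon\in(0,1]$, all solutions satisfying (A), all $0<h\le h_0$, all $0<\tau_0\le\tau_*$ and all $$0<\tau<\gamma\,\frac{\pi(b-a)^{\alpha/2}\tau_0^{\alpha/2}}{2\sqrt{\tau_0^\alpha(b-a)^\alpha+2^{3\alpha/2}\pi^\alpha(1+\tau_0)^\alpha}}$$ one has $$\|u(\cdot,t_n)-I_Nu^n\|_{\alpha/2}+\|\partial_tu(\cdot,t_n)-I_Nv^n\|\le C\big(h^m+\varepsilon^2\tau^2+\tau_0^{m+\alpha/2}\big),\qquad 0\le n\le T_\varepsilon/\tau .$$ (ii) Suppose that the exact solution is smooth: for every integer $j\ge 0$, (A) holds with $j$ in place of $m$ and with a bound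 $M_j$ independent of $\varepsilon$. Then the last term can be ignored for small $\tau$. Precisely, for every $p>0$ there are $h_0,\tau_*,C>0$, depending only on $a,b,\alpha,m,T,p,(M_j)_j$, such that for all $\varepsilon\in(0,1]$, $0<h\le h_0$ and $0<\tau<\tau_*$ the error on the left-hand side above is at most $C(h^m+\varepsilon^2\tau^2+\tau^p)$ for $0\le n\le T_\varepsilon/\tau$. Moreover, for every $\kappa>0$ there are $h_0,\tau_*,C>0$, depending only on $a,b,\alpha,m,T,\kappa,(M_j)_j$, such that for all $\varepsilon\in(0,1]$, $0<h\le h_0$ and $0<\tau<\tau_*$ with $\tau\le\varepsilon^\kappa$, $$\|u(\cdot,t_n)-I_Nu^n\|_{\alpha/2}+\|\partial_tu(\cdot,t_n)-I_Nv^n\|\le C\big(h^m+\varepsilon^2\tau^2\big),\qquad 0\le n\le T_\varepsilon/\tau .$$ -/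

import Mathlib

open Set MeasureTheory
open scoped ENNReal

namespace TSFP

noncomputable section

/-! Fourier analysis on the periodic square `(a,b)²`. -/

/-- The frequency `μ_j = 2πj/(b-a)`. -/
def freq (a b : ℝ) (j : ℤ) : ℝ := 2 * Real.pi * j / (b - a)

/-- The Fourier mode `e^{iμ_k(x-a)+iμ_l(y-a)}`. -/
def mode (a b : ℝ) (k l : ℤ) (z : ℝ × ℝ) : ℂ :=
  Complex.exp (Complex.I * ((freq a b k * (z.1 - a) + freq a b l * (z.2 - a) : ℝ) : ℂ))

/-- The Fourier coefficient
`ŵ_{kl} = (b-a)⁻² ∫_Ω w(x,y) e^{-iμ_k(x-a)-iμ_l(y-a)} dΩ`, `Ω = (a,b)²`. -/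
def coeff (a b : ℝ) (w : ℝ × ℝ → ℂ) (k l : ℤ) : ℂ :=
  (((b - a) ^ 2)⁻¹ : ℝ) * ∫ z in Ioo a b ×ˢ Ioo a b,
    w z * Complex.exp
      (-(Complex.I * ((freq a b k * (z.1 - a) + freq a b l * (z.2 - a) : ℝ) : ℂ)))

/-- The Sobolev norm `‖w‖_s = (∑_{k,l} (1+μ_k²+μ_l²)^s |ŵ_{kl}|²)^{1/2}`, with the value `∞`
when the series diverges, that is, when `w` does not belong to `H^s(Ω)`. -/
def sobolevNorm (a b s : ℝ) (w : ℝ × ℝ → ℂ) : ℝ≥0∞ :=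
  (∑' kl : ℤ × ℤ, ENNReal.ofReal
    ((1 + freq a b kl.1 ^ 2 + freq a b kl.2 ^ 2) ^ s * ‖coeff a b w kl.1 kl.2‖ ^ 2))
    ^ (1 / 2 : ℝ)

/-- The norm of `L^∞([0,S]; H^s(Ω))`. -/
def linftyNorm (a b s S : ℝ) (w : ℝ → ℝ × ℝ → ℂ) : ℝ≥0∞ :=
  essSup (fun t => sobolevNorm a b s (w t)) (volume.restrict (Icc 0 S))

/-- A real function on the plane regarded as a complex one. -/
def toC (w : ℝ × ℝ → ℝ) : ℝ × ℝ → ℂ := fun z => (w z : ℂ)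

/-- `C_per(Ω)`: continuous functions with period `b-a` in both variables. -/
def CPer (a b : ℝ) (w : ℝ × ℝ → ℝ) : Prop :=
  Continuous w ∧ ∀ x y, w (x + (b - a), y) = w (x, y) ∧ w (x, y + (b - a)) = w (x, y)

/-- The symbol `|μ|^α = (μ_k²+μ_l²)^{α/2}` of `(-Δ)^{α/2}`. -/
def lapSymbol (a b α : ℝ) (k l : ℤ) : ℝ :=
  (freq a b k ^ 2 + freq a b l ^ 2) ^ (α / 2)

/-- The symbol `δ_{kl} = √(1+(μ_k²+μ_l²)^{α/2})` of `⟨∇⟩_α = √(1+(-Δ)^{α/2})`. -/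
def delta (a b α : ℝ) (k l : ℤ) : ℝ := Real.sqrt (1 + lapSymbol a b α k l)

/-- `u` is a solution on `[0,S]`, with time derivative `v`, of the periodic problem
`∂_tt u + (-Δ)^{α/2} u + ε⁻¹ sin(εu) = 0`, `u(0) = u₀`, `∂_t u(0) = u₁`.
The fractional Laplacian being defined by Fourier series, the time derivative and the equation
are understood in the sense of (periodic) distributions in space, that is, Fourier mode by
Fourier mode: `d/dt û_{kl} = v̂_{kl}` and
`d/dt v̂_{kl} + |μ|^α û_{kl} + (ε⁻¹ sin(εu))^_{kl} = 0` for all `k`, `l`. -/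
structure IsSolution (a b α ε S : ℝ) (u₀ u₁ : ℝ × ℝ → ℝ) (u v : ℝ → ℝ × ℝ → ℝ) : Prop where
  cper_u : ∀ t ∈ Icc 0 S, CPer a b (u t)
  cper_v : ∀ t ∈ Icc 0 S, CPer a b (v t)
  init_u : u 0 = u₀
  init_v : v 0 = u₁
  deriv_u : ∀ k l : ℤ, ∀ t ∈ Icc 0 S,
    HasDerivWithinAt (fun s => coeff a b (toC (u s)) k l) (coeff a b (toC (v t)) k l) (Icc 0 S) t
  equation : ∀ k l : ℤ, ∀ t ∈ Icc 0 S,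
    HasDerivWithinAt (fun s => coeff a b (toC (v s)) k l)
      (-((lapSymbol a b α k l : ℝ) : ℂ) * coeff a b (toC (u t)) k l
        - coeff a b (toC fun z => 1 / ε * Real.sin (ε * u t z)) k l) (Icc 0 S) t

/-- The regularity assumption (A) with regularity index `m` and bound `M`:
`‖u‖_{L^∞([0,S];H^{m+α/2})} ≤ M` and `‖∂_t u‖_{L^∞([0,S];H^m)} ≤ M`. -/
def AssumptionA (a b α m S M : ℝ) (u v : ℝ → ℝ × ℝ → ℝ) : Prop :=
  linftyNorm a b (m + α / 2) S (fun t => toC (u t)) ≤ ENNReal.ofReal M ∧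
  linftyNorm a b m S (fun t => toC (v t)) ≤ ENNReal.ofReal M

/-! The time-splitting Fourier pseudo-spectral scheme. A grid function is given by its values
at the points `(x_p, y_q)`, `p, q = 0, …, N`; all formulas make sense for all `p, q`. -/

/-- The grid point `(x_p, y_q) = (a+ph, a+qh)`, `h = (b-a)/N`. -/
def gridPt (a b : ℝ) (N p q : ℕ) : ℝ × ℝ :=
  (a + p * ((b - a) / N), a + q * ((b - a) / N))

/-- The index set `T_N = {-N/2, …, N/2-1}` (`N` even). -/
def TN (N : ℕ) : Finset ℤ := Finset.Ico (-((N : ℤ) / 2)) ((N : ℤ) / 2)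

/-- The discrete Fourier coefficient
`g̃_{kl} = N⁻² ∑_{p,q=0}^{N-1} g_{pq} e^{-iμ_k(x_p-a)-iμ_l(y_q-a)}`. -/
def dft (a b : ℝ) (N : ℕ) (g : ℕ → ℕ → ℂ) (k l : ℤ) : ℂ :=
  1 / (N : ℂ) ^ 2 * ∑ p ∈ Finset.range N, ∑ q ∈ Finset.range N,
    g p q * Complex.exp (-(Complex.I *
      ((freq a b k * ((gridPt a b N p q).1 - a)
        + freq a b l * ((gridPt a b N p q).2 - a) : ℝ) : ℂ)))

/-- The trigonometric interpolant `I_N g = ∑_{k,l ∈ T_N} g̃_{kl} e^{iμ_k(x-a)+iμ_l(y-a)}`. -/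
def interp (a b : ℝ) (N : ℕ) (g : ℕ → ℕ → ℂ) (z : ℝ × ℝ) : ℂ :=
  ∑ k ∈ TN N, ∑ l ∈ TN N, dft a b N g k l * mode a b k l z

/-- The grid function `∑_{k,l ∈ T_N} σ_{kl} g̃_{kl} e^{iμ_k(x_p-a)+iμ_l(y_q-a)}`. -/
def multiplier (a b : ℝ) (N : ℕ) (σ : ℤ → ℤ → ℂ) (g : ℕ → ℕ → ℂ) (p q : ℕ) : ℂ :=
  ∑ k ∈ TN N, ∑ l ∈ TN N, σ k l * dft a b N g k l * mode a b k l (gridPt a b N p q)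

/-- The nonlinearity `f(s) = ε⁻¹ sin(εs) - s`. -/
def nonlin (ε s : ℝ) : ℝ := 1 / ε * Real.sin (ε * s) - s

/-- The half step `e^{iτ⟨∇⟩_α/2}` of the linear flow on the grid. -/
def linStep (a b α τ : ℝ) (N : ℕ) (φ : ℕ → ℕ → ℂ) : ℕ → ℕ → ℂ :=
  multiplier a b N (fun k l => Complex.exp (Complex.I * ((τ * delta a b α k l / 2 : ℝ) : ℂ))) φ

/-- The step `φ ↦ φ + τ i⟨∇⟩_α⁻¹ f((φ+φ̄)/2)` of the nonlinear flow on the grid;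
`(φ+φ̄)/2` is the real part of `φ`. -/
def nonlinStep (a b α ε τ : ℝ) (N : ℕ) (φ : ℕ → ℕ → ℂ) : ℕ → ℕ → ℂ := fun p q =>
  φ p q + (τ : ℂ) * multiplier a b N (fun k l => Complex.I / (delta a b α k l : ℂ))
    (fun p' q' => (nonlin ε (φ p' q').re : ℂ)) p q

/-- The numerical solution `φⁿ` of the scheme. -/
def phiN (a b α ε τ : ℝ) (N : ℕ) (u₀ u₁ : ℝ × ℝ → ℝ) : ℕ → ℕ → ℕ → ℂ
  | 0 => fun p q => (u₀ (gridPt a b N p q) : ℂ) - Complex.I *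
      multiplier a b N (fun k l => 1 / (delta a b α k l : ℂ))
        (fun p' q' => (u₁ (gridPt a b N p' q') : ℂ)) p q
  | n + 1 => linStep a b α τ N (nonlinStep a b α ε τ N
      (linStep a b α τ N (phiN a b α ε τ N u₀ u₁ n)))

/-- The numerical approximation `uⁿ` of `u(·,t_n)` on the grid. -/
def uN (a b α ε τ : ℝ) (N : ℕ) (u₀ u₁ : ℝ × ℝ → ℝ) : ℕ → ℕ → ℕ → ℂ
  | 0 => fun p q => (u₀ (gridPt a b N p q) : ℂ)
  | n + 1 => fun p q => 1 / 2 * (phiN a b α ε τ N u₀ u₁ (n + 1) p q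
      + (starRingEnd ℂ) (phiN a b α ε τ N u₀ u₁ (n + 1) p q))

/-- The numerical approximation `vⁿ` of `∂_t u(·,t_n)` on the grid. -/
def vN (a b α ε τ : ℝ) (N : ℕ) (u₀ u₁ : ℝ × ℝ → ℝ) : ℕ → ℕ → ℕ → ℂ
  | 0 => fun p q => (u₁ (gridPt a b N p q) : ℂ)
  | n + 1 => fun p q => Complex.I / 2 * ∑ k ∈ TN N, ∑ l ∈ TN N, (delta a b α k l : ℂ) *
      (dft a b N (phiN a b α ε τ N u₀ u₁ (n + 1)) k l
        - dft a b N (fun p' q' => (starRingEnd ℂ) (phiN a b α ε τ N u₀ u₁ (n + 1) p' q')) k l) *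
      mode a b k l (gridPt a b N p q)

/-- The error `‖u(·,t_n) - I_N uⁿ‖_{α/2} + ‖∂_t u(·,t_n) - I_N vⁿ‖`, `t_n = nτ`, where
`‖·‖ = ‖·‖_0` and `v = ∂_t u`. -/
def totalError (a b α ε τ : ℝ) (N : ℕ) (u₀ u₁ : ℝ × ℝ → ℝ) (u v : ℝ → ℝ × ℝ → ℝ) (n : ℕ) :
    ℝ≥0∞ :=
  sobolevNorm a b (α / 2)
      (fun z => (u (n * τ) z : ℂ) - interp a b N (uN a b α ε τ N u₀ u₁ n) z)
    + sobolevNorm a b 0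
      (fun z => (v (n * τ) z : ℂ) - interp a b N (vN a b α ε τ N u₀ u₁ n) z)

/-- The upper bound on the time step,
`γ π (b-a)^{α/2} τ₀^{α/2} / (2 √(τ₀^α (b-a)^α + 2^{3α/2} π^α (1+τ₀)^α))`. -/
def tauBound (a b α γ τ₀ : ℝ) : ℝ :=
  γ * (Real.pi * (b - a) ^ (α / 2) * τ₀ ^ (α / 2) /
    (2 * Real.sqrt (τ₀ ^ α * (b - a) ^ α
      + (2 : ℝ) ^ (3 * α / 2) * Real.pi ^ α * (1 + τ₀) ^ α)))

end

end TSFP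

/-! Put ψ(t) = e^{-itδ}(û - iδ⁻¹v̂). In this rotating frame the linear part disappears and δψ' = i
e^{-itδ} f(u)^ (`IsSolution.isProfile`). Since f(s) = ε⁻¹ sin(εs) - s starts with a cubic term
carrying ε², ψ moves at speed O(ε²), and u(t) is the real free wave with the profile ψ(t). In the
same frame the scheme is the midpoint rule for this evolution, with the profile frozen over the step
and the nonlinearity aliased on the grid (`numProfile_succ`). Three errors have to be summed over
T/(ε²τ) steps.

Freezing. Replacing ψ(t) by ψ(s) changes the wave at time t by O(ε²(t-s)²), because sin((t-r)δ)/δ is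
at most t-r, without loss of derivatives. The nonlinearity is Lipschitz with constant O(ε²), so one
step costs O(ε⁴τ³) (`IsProfile.step`) and all steps together O(ε²τ²).

Quadrature. The nonlinearity of a free wave is almost periodic in time. It is expanded over
space-time frequencies (l, ω) by convolution powers, in a norm that is ℓ¹ in ω and ℓ² in l with the
weight (1 + |μ_k| + |μ_l| + |ω|^{2/α})^σ, σ = m + α/2. The weight makes this norm an algebra norm up
to a constant and is comparable to β^σ on ω = ±δ_l. At one frequency the accumulated midpoint errors
form an oscillating sum with phase step τΔ, Δ = ω - δ_l. If τ|Δ| ≤ π, summation by parts gains a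
factor 1/(τ|Δ|) over the cubic local error; as the coefficients have total variation O(ε²) up to
time T/ε², the result is O(ε²τ²). If τ|Δ| > π, the weight is at least τ^{-2σ/α}, and the trivial
bound gives O(τ^{2σ/α}), independent of ε. This is `norm_sum_quadErr_le`; with τ ≲ τ₀^{α/2} the
second case becomes τ₀^{m+α/2}.

Space. Sampling on the grid sums Fourier coefficients over residue classes mod N. The norm `mixed
(cls N)`, which is ℓ¹ within a class and ℓ² across classes, is not increased by aliasing, is a
module norm over ℓ¹ under convolution, and dominates ℓ². Unresolved frequencies have size O(h^m) in
it (`mixed_high_le`). Hence the discrete nonlinearity is Lipschitz with constant O(ε²) in the energy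
estimate, provided that the numerical solution is bounded in ℓ¹.

That bound comes from a bootstrap (`IsProfile.tsum_enorm_scheme_le`): the same recursion, with all
classes merged into one so that the norm is ℓ¹, and with a crude quadrature bound, gives an error
O(τ + h^{(m-1)/2}), which is small. The discrete Gronwall lemma with rate O(τε²) per step then
closes the ℓ² estimate (`IsProfile.mixed_errSeq_le_rate`).

Returning to uⁿ and vⁿ requires the coefficients of the conjugate of φⁿ, that is, the index -l,
which may leave the asymmetric set T_N; the defect is again at unresolved frequencies
(`mixed_reflect_le`). For smooth solutions the estimate is applied with a regularity index so large
that τ^{2σ/α} is below any prescribed power of τ. -/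

namespace TSFP

/-! ### `ℓ²` norms with values in `[0, ∞]` -/

/-- The `ℓ²` norm of a family of extended nonnegative numbers. -/
noncomputable def l2 {ι : Type*} (P : ι → ℝ≥0∞) : ℝ≥0∞ := (∑' i, P i ^ 2) ^ (1 / 2 : ℝ)

lemma l2_sq {ι : Type*} (P : ι → ℝ≥0∞) : l2 P ^ 2 = ∑' i, P i ^ 2 := by
  rw [l2, ← ENNReal.rpow_natCast, ← ENNReal.rpow_mul]; norm_num

lemma le_of_sq_le_sq {x y : ℝ≥0∞} (h : x ^ 2 ≤ y ^ 2) : x ≤ y :=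
  (ENNReal.pow_le_pow_left_iff two_ne_zero).1 h

lemma l2_mono {ι : Type*} {P R : ι → ℝ≥0∞} (h : ∀ i, P i ≤ R i) : l2 P ≤ l2 R := by
  unfold l2
  gcongr with i
  exact h i

lemma le_l2 {ι : Type*} (P : ι → ℝ≥0∞) (i : ι) : P i ≤ l2 P := by
  apply le_of_sq_le_sq
  rw [l2_sq]
  exact ENNReal.le_tsum (f := fun i => P i ^ 2) i

lemma l2_zero {ι : Type*} : l2 (fun _ : ι => 0) = 0 := by simp [l2]

/-- Reduces infinite families to finite ones, where continuity in time and the mean value inequality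
are available. -/
lemma l2_le_of_forall_finset {ι : Type*} {P : ι → ℝ≥0∞} {K : ℝ≥0∞}
    (h : ∀ s : Finset ι, ∑ i ∈ s, P i ^ 2 ≤ K ^ 2) : l2 P ≤ K := by
  apply le_of_sq_le_sq
  rw [l2_sq, ENNReal.tsum_eq_iSup_sum]
  exact iSup_le h

lemma sum_sq_le_l2_sq {ι : Type*} (P : ι → ℝ≥0∞) (s : Finset ι) :
    ∑ i ∈ s, P i ^ 2 ≤ l2 P ^ 2 := by
  rw [l2_sq]
  exact ENNReal.sum_le_tsum s

lemma l2_const_mul {ι : Type*} (c : ℝ≥0∞) (P : ι → ℝ≥0∞) :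
    l2 (fun i => c * P i) = c * l2 P := by
  unfold l2
  simp_rw [mul_pow]
  rw [ENNReal.tsum_mul_left, ENNReal.mul_rpow_of_nonneg _ _ (by norm_num),
    ← ENNReal.rpow_natCast, ← ENNReal.rpow_mul]
  norm_num

lemma l2_comp_equiv {ι κ : Type*} (e : κ ≃ ι) (P : ι → ℝ≥0∞) :
    l2 (fun k => P (e k)) = l2 P := by
  unfold l2
  rw [e.tsum_eq (fun i => P i ^ 2)]

lemma tsum_mul_le_l2 {ι : Type*} (P R : ι → ℝ≥0∞) : ∑' i, P i * R i ≤ l2 P * l2 R := by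
  rw [ENNReal.tsum_eq_iSup_sum]
  refine iSup_le fun s => ?_
  refine (ENNReal.inner_le_Lp_mul_Lq s P R Real.HolderConjugate.two_two).trans ?_
  unfold l2
  gcongr
  · exact (Finset.sum_congr rfl fun i _ => by norm_cast).le.trans (ENNReal.sum_le_tsum s)
  · exact (Finset.sum_congr rfl fun i _ => by norm_cast).le.trans (ENNReal.sum_le_tsum s)

/-- Minkowski's inequality by duality: pairing the sum with itself and applying Cauchy–Schwarz gives
‖P‖² ≤ ‖P‖ S. Restriction to a finite set makes ‖P‖ finite, so that it can be cancelled. -/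
lemma l2_tsum_le {ι κ : Type*} (F : κ → ι → ℝ≥0∞) :
    l2 (fun i => ∑' k, F k i) ≤ ∑' k, l2 (F k) := by
  classical
  apply l2_le_of_forall_finset
  intro s
  set S := ∑' k, l2 (F k)
  by_cases htop : ∃ i ∈ s, ∑' k, F k i = ∞
  · obtain ⟨i, -, hi⟩ := htop
    have : ∑' k, F k i ≤ S := ENNReal.tsum_le_tsum fun k => le_l2 (F k) i
    have hS : S = ∞ := top_le_iff.1 (hi ▸ this)
    simp [hS]
  · push Not at htop
    set P : ι → ℝ≥0∞ := fun i => if i ∈ s then ∑' k, F k i else 0 with hP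
    have hsum : ∑ i ∈ s, (∑' k, F k i) ^ 2 = l2 P ^ 2 := by
      rw [l2_sq, tsum_eq_sum (s := s)]
      · exact Finset.sum_congr rfl fun i hi => by simp [hP, hi]
      · intro i hi; simp [hP, hi]
    have hfin : l2 P ≠ ∞ := by
      intro h
      have : ∑ i ∈ s, (∑' k, F k i) ^ 2 < ∞ :=
        ENNReal.sum_lt_top.2 fun i hi => ENNReal.pow_lt_top (lt_top_iff_ne_top.2 (htop i hi))
      rw [hsum, h] at this
      simp at this
    have key : l2 P ^ 2 ≤ l2 P * S := by
      rw [l2_sq]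
      calc ∑' i, P i ^ 2 ≤ ∑' i, ∑' k, P i * F k i := by
            refine ENNReal.tsum_le_tsum fun i => ?_
            rw [ENNReal.tsum_mul_left, sq]
            gcongr
            simp only [hP]
            split_ifs <;> simp
        _ = ∑' k, ∑' i, P i * F k i := ENNReal.tsum_comm
        _ ≤ ∑' k, l2 P * l2 (F k) := ENNReal.tsum_le_tsum fun k => tsum_mul_le_l2 _ _
        _ = l2 P * S := ENNReal.tsum_mul_left
    rw [hsum]
    by_cases h0 : l2 P = 0
    · simp [h0]
    · rw [sq] at key
      gcongr
      exact (ENNReal.mul_le_mul_iff_right h0 hfin).1 key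

lemma l2_add_le {ι : Type*} (P R : ι → ℝ≥0∞) : l2 (fun i => P i + R i) ≤ l2 P + l2 R := by
  have := l2_tsum_le (fun b : Bool => fun i => cond b (P i) (R i))
  simpa [tsum_bool, add_comm] using this

/-! ### Convolution and mixed norms on an abelian group -/

section convolution
variable {G Q : Type*} [AddCommGroup G] [AddCommGroup Q]

/-- Convolution of extended nonnegative functions. -/
noncomputable def conv (p r : G → ℝ≥0∞) (g : G) : ℝ≥0∞ := ∑' h, p h * r (g - h)

lemma conv_comm (p r : G → ℝ≥0∞) : conv p r = conv r p := by
  funext g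
  unfold conv
  rw [← (Equiv.subLeft g).tsum_eq]
  exact tsum_congr fun h => by simp [mul_comm]

open Classical in
/-- The sum of `p` over the fibre of `κ` above `q`. -/
noncomputable def fiber {G Q : Type*} (κ : G → Q) (p : G → ℝ≥0∞) (q : Q) : ℝ≥0∞ :=
  ∑' g, if κ g = q then p g else 0

/-- The norm that is `ℓ¹` on the fibres of `κ` and `ℓ²` on the base. -/
noncomputable def mixed {G Q : Type*} (κ : G → Q) (p : G → ℝ≥0∞) : ℝ≥0∞ := l2 (fiber κ p)

lemma fiber_mono {G Q : Type*} {κ : G → Q} {p r : G → ℝ≥0∞} (h : ∀ g, p g ≤ r g) (q : Q) :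
    fiber κ p q ≤ fiber κ r q := by
  unfold fiber
  gcongr with g
  split_ifs
  · exact h g
  · exact le_rfl

lemma mixed_mono {G Q : Type*} {κ : G → Q} {p r : G → ℝ≥0∞} (h : ∀ g, p g ≤ r g) :
    mixed κ p ≤ mixed κ r := l2_mono (fiber_mono h)

lemma fiber_tsum {G Q ι : Type*} (κ : G → Q) (F : ι → G → ℝ≥0∞) (q : Q) :
    fiber κ (fun g => ∑' i, F i g) q = ∑' i, fiber κ (F i) q := by
  unfold fiber
  rw [ENNReal.tsum_comm]
  exact tsum_congr fun g => by split_ifs <;> simp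

lemma mixed_tsum_le {G Q ι : Type*} (κ : G → Q) (F : ι → G → ℝ≥0∞) :
    mixed κ (fun g => ∑' i, F i g) ≤ ∑' i, mixed κ (F i) := by
  unfold mixed
  rw [funext (fiber_tsum κ F)]
  exact l2_tsum_le _

lemma mixed_const_mul {G Q : Type*} (κ : G → Q) (c : ℝ≥0∞) (p : G → ℝ≥0∞) :
    mixed κ (fun g => c * p g) = c * mixed κ p := by
  unfold mixed
  rw [← l2_const_mul]
  congr 1
  funext q
  unfold fiber
  rw [← ENNReal.tsum_mul_left]
  exact tsum_congr fun g => by split_ifs <;> simp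

lemma mixed_add_le {G Q : Type*} (κ : G → Q) (p r : G → ℝ≥0∞) :
    mixed κ (fun g => p g + r g) ≤ mixed κ p + mixed κ r := by
  have := mixed_tsum_le κ (fun b : Bool => fun i => cond b (p i) (r i))
  simpa [tsum_bool, add_comm] using this

lemma mixed_sum_le {G Q ι : Type*} (κ : G → Q) (s : Finset ι) (F : ι → G → ℝ≥0∞) :
    mixed κ (fun g => ∑ i ∈ s, F i g) ≤ ∑ i ∈ s, mixed κ (F i) := by
  classical
  induction s using Finset.induction_on with
  | empty =>
    have : fiber κ (fun _ => 0) = fun _ => 0 := by funext q; simp [fiber]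
    simp [mixed, this, l2_zero]
  | insert a s ha ih =>
    simp only [Finset.sum_insert ha]
    exact (mixed_add_le _ _ _).trans (by gcongr)

/-- Additivity of κ makes a translation of G permute the fibres; this is what lets Young's
inequality survive in the mixed norm. -/
lemma fiber_translate (κ : G →+ Q) (r : G → ℝ≥0∞) (h : G) (q : Q) :
    fiber κ (fun g => r (g - h)) q = fiber κ r (q - κ h) := by
  classical
  unfold fiber
  rw [← (Equiv.addRight h).tsum_eq]
  refine tsum_congr fun g => ?_
  have : κ (g + h) = q ↔ κ g = q - κ h := by rw [map_add, eq_sub_iff_add_eq]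
  have e : r (g + h - h) = r g := by rw [add_sub_cancel_right]
  by_cases hq : κ (g + h) = q
  · exact (if_pos hq).trans (e.trans (if_pos (this.1 hq)).symm)
  · exact (if_neg hq).trans (if_neg (fun h' => hq (this.2 h'))).symm

/-- Young's inequality for the mixed norm. -/
lemma mixed_conv_le (κ : G →+ Q) (p r : G → ℝ≥0∞) :
    mixed κ (conv p r) ≤ (∑' g, p g) * mixed κ r := by
  unfold conv
  refine (mixed_tsum_le κ (fun h g => p h * r (g - h))).trans ?_
  rw [← ENNReal.tsum_mul_right]
  refine ENNReal.tsum_le_tsum fun h => ?_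
  rw [mixed_const_mul]
  gcongr
  unfold mixed
  rw [funext (fiber_translate κ r h)]
  exact (l2_comp_equiv (Equiv.subRight (κ h)) (fiber κ r)).le

lemma tsum_conv (p r : G → ℝ≥0∞) : ∑' g, conv p r g = (∑' g, p g) * ∑' g, r g := by
  unfold conv
  rw [ENNReal.tsum_comm, ← ENNReal.tsum_mul_right]
  refine tsum_congr fun h => ?_
  rw [ENNReal.tsum_mul_left]
  congr 1
  exact (Equiv.subRight h).tsum_eq r

/-- A norm functional `N` which is a module norm for convolution over the algebra norm `N'`. -/
structure ConvNorm (N N' : (G → ℝ≥0∞) → ℝ≥0∞) : Prop where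
  mono : ∀ {p r : G → ℝ≥0∞}, (∀ g, p g ≤ r g) → N p ≤ N r
  tsum_le : ∀ F : ℕ → G → ℝ≥0∞, N (fun g => ∑' i, F i g) ≤ ∑' i, N (F i)
  const_mul : ∀ (c : ℝ≥0∞) (p : G → ℝ≥0∞), N (fun g => c * p g) ≤ c * N p
  conv_le : ∀ p r : G → ℝ≥0∞, N (conv p r) ≤ N' p * N r
  conv_alg : ∀ p r : G → ℝ≥0∞, N' (conv p r) ≤ N' p * N' r

lemma ConvNorm.conv_le' {N N' : (G → ℝ≥0∞) → ℝ≥0∞} (h : ConvNorm N N') (p r : G → ℝ≥0∞) :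
    N (conv p r) ≤ N p * N' r := by
  rw [conv_comm, mul_comm]
  exact h.conv_le r p

lemma ConvNorm.add_le {N N' : (G → ℝ≥0∞) → ℝ≥0∞} (h : ConvNorm N N') (p r : G → ℝ≥0∞) :
    N (fun g => p g + r g) ≤ N p + N r := by
  -- A pair is a sequence with two nonzero terms; `const_mul` with the constant 0 shows that the
  -- zero function has norm 0.
  have := h.tsum_le (fun i g => if i = 0 then p g else if i = 1 then r g else 0)
  have h0 : N (fun _ => 0) = 0 := by
    simpa using h.const_mul 0 (fun _ => 0)
  have e1 : ∀ g, ∑' i : ℕ, (if i = 0 then p g else if i = 1 then r g else 0) = p g + r g := by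
    intro g
    rw [tsum_eq_sum (s := {0, 1})]
    · simp
    · intro i hi
      simp only [Finset.mem_insert, Finset.mem_singleton, not_or] at hi
      simp [hi.1, hi.2]
  have e2 : ∑' i : ℕ, N (fun g => if i = 0 then p g else if i = 1 then r g else 0)
      = N p + N r := by
    rw [tsum_eq_sum (s := {0, 1})]
    · simp
    · intro i hi
      simp only [Finset.mem_insert, Finset.mem_singleton, not_or] at hi
      simp [hi.1, hi.2, h0]
  simp only [e1] at this
  rwa [e2] at this

lemma convNorm_tsum : ConvNorm (fun p : G → ℝ≥0∞ => ∑' g, p g) (fun p => ∑' g, p g) where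
  mono h := ENNReal.tsum_le_tsum h
  tsum_le _ := ENNReal.tsum_comm.le
  const_mul _ _ := ENNReal.tsum_mul_left.le
  conv_le p r := (tsum_conv p r).le
  conv_alg p r := (tsum_conv p r).le

/-- The stability of the discrete nonlinearity rests on this instance: differences are measured in
the mixed norm, while the other factors of a product need only be bounded in ℓ¹. -/
lemma convNorm_mixed (κ : G →+ Q) : ConvNorm (mixed κ) (fun p : G → ℝ≥0∞ => ∑' g, p g) where
  mono := mixed_mono
  tsum_le := mixed_tsum_le κ
  const_mul c p := (mixed_const_mul κ c p).le
  conv_le := mixed_conv_le κ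
  conv_alg p r := (tsum_conv p r).le

/-- A quasi-subadditive weight which controls the sum makes the weighted mixed norm a
(quasi-)algebra norm. -/
lemma convNorm_weighted (κ : G →+ Q) (W : G → ℝ≥0∞) (A B K : ℝ≥0∞)
    (hW : ∀ g h, W (g + h) ≤ A * (W g + W h))
    (hB : ∀ p : G → ℝ≥0∞, ∑' g, p g ≤ B * mixed κ (fun g => W g * p g))
    (hK : 2 * A * B ≤ K) :
    ConvNorm (fun p => K * mixed κ (fun g => W g * p g))
      (fun p => K * mixed κ (fun g => W g * p g)) := by
  have hconv : ∀ p r : G → ℝ≥0∞, mixed κ (fun g => W g * conv p r g) ≤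
      K * mixed κ (fun g => W g * p g) * mixed κ (fun g => W g * r g) := by
    intro p r
    -- The weight is moved onto one of the two factors and the other is summed in ℓ¹ at the price B.
    -- Two such terms account for the constant 2AB.
    have h1 : ∀ g, W g * conv p r g ≤ A * (conv (fun g => W g * p g) r g
        + conv p (fun g => W g * r g) g) := by
      intro g
      unfold conv
      rw [← ENNReal.tsum_mul_left, ← ENNReal.tsum_add, ← ENNReal.tsum_mul_left]
      refine ENNReal.tsum_le_tsum fun h => ?_
      have := hW h (g - h)
      rw [add_sub_cancel] at this
      calc W g * (p h * r (g - h)) ≤ A * (W h + W (g - h)) * (p h * r (g - h)) := by gcongr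
        _ = _ := by ring
    calc mixed κ (fun g => W g * conv p r g)
        ≤ A * (mixed κ (conv (fun g => W g * p g) r) + mixed κ (conv p (fun g => W g * r g))) := by
          refine (mixed_mono h1).trans ?_
          rw [mixed_const_mul]
          gcongr
          exact mixed_add_le _ _ _
      _ ≤ A * ((B * mixed κ (fun g => W g * r g)) * mixed κ (fun g => W g * p g)
            + (B * mixed κ (fun g => W g * p g)) * mixed κ (fun g => W g * r g)) := by
          gcongr
          · rw [conv_comm]
            exact (mixed_conv_le κ _ _).trans (by gcongr; exact hB r)
          · exact (mixed_conv_le κ _ _).trans (by gcongr; exact hB p)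
      _ = (2 * A * B) * mixed κ (fun g => W g * p g) * mixed κ (fun g => W g * r g) := by ring
      _ ≤ _ := by gcongr
  have halg : ∀ p r : G → ℝ≥0∞, K * mixed κ (fun g => W g * conv p r g) ≤
      (K * mixed κ (fun g => W g * p g)) * (K * mixed κ (fun g => W g * r g)) := by
    intro p r
    calc _ ≤ K * (K * mixed κ (fun g => W g * p g) * mixed κ (fun g => W g * r g)) := by
          gcongr; exact hconv p r
      _ = _ := by ring
  refine ⟨fun h => ?_, fun F => ?_, fun c p => ?_, halg, halg⟩
  · gcongr
    exact mixed_mono fun g => by gcongr; exact h g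
  · dsimp only
    rw [ENNReal.tsum_mul_left]
    gcongr
    refine le_trans (le_of_eq ?_) (mixed_tsum_le κ _)
    congr 1
    funext g
    rw [ENNReal.tsum_mul_left]
  · have : (fun g => W g * (c * p g)) = fun g => c * (W g * p g) := by funext g; ring
    rw [this, mixed_const_mul]
    exact (by ring : K * (c * mixed κ fun g => W g * p g)
      = c * (K * mixed κ fun g => W g * p g)).le

end convolution


/-! ### The convolution algebra and the power series of the nonlinearity -/

section convolution
variable {G : Type*} [AddCommGroup G]

/-- Convolution of complex functions on an abelian group. -/
noncomputable def cconv (x y : G → ℂ) (g : G) : ℂ := ∑' h, x h * y (g - h)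

lemma enorm_cconv_le (x y : G → ℂ) (g : G) :
    ‖cconv x y g‖ₑ ≤ conv (fun h => ‖x h‖ₑ) (fun h => ‖y h‖ₑ) g := by
  refine (enorm_tsum_le_tsum_enorm).trans (le_of_eq ?_)
  exact tsum_congr fun h => enorm_mul _ _

lemma summable_norm_cconv {x y : G → ℂ} (hx : Summable fun g => ‖x g‖)
    (hy : Summable fun g => ‖y g‖) : Summable fun g => ‖cconv x y g‖ := by
  rw [← tsum_enorm_ne_top_iff_summable_norm] at *
  refine ne_top_of_le_ne_top ?_ (ENNReal.tsum_le_tsum (enorm_cconv_le x y))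
  rw [tsum_conv]
  exact ENNReal.mul_ne_top hx hy

lemma summable_cconv_term {x y : G → ℂ} (hx : Summable fun g => ‖x g‖)
    (hy : Summable fun g => ‖y g‖) (g : G) : Summable fun h => x h * y (g - h) := by
  refine Summable.of_norm_bounded (g := fun h => ‖x h‖ * ∑' k, ‖y k‖) (hx.mul_right _) fun h => ?_
  rw [norm_mul]
  gcongr
  exact hy.le_tsum (g - h) fun _ _ => norm_nonneg _

lemma cconv_sub_cconv {x y x' y' : G → ℂ} (hx : Summable fun g => ‖x g‖)
    (hy : Summable fun g => ‖y g‖) (hx' : Summable fun g => ‖x' g‖)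
    (hy' : Summable fun g => ‖y' g‖) (g : G) :
    cconv x y g - cconv x' y' g
      = cconv (fun h => x h - x' h) y g + cconv x' (fun h => y h - y' h) g := by
  unfold cconv
  simp only [sub_mul, mul_sub]
  rw [(summable_cconv_term hx hy g).tsum_sub (summable_cconv_term hx' hy g),
    (summable_cconv_term hx' hy g).tsum_sub (summable_cconv_term hx' hy' g)]
  ring

/-- `cpow x n` is the convolution power of `x` with exponent `n + 1`. -/
noncomputable def cpow (x : G → ℂ) : ℕ → G → ℂ
  | 0 => x
  | n + 1 => cconv x (cpow x n)

lemma summable_norm_cpow {x : G → ℂ} (hx : Summable fun g => ‖x g‖) (n : ℕ) :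
    Summable fun g => ‖cpow x n g‖ := by
  induction n with
  | zero => exact hx
  | succ n ih => exact summable_norm_cconv hx ih

lemma ConvNorm.cpow_le {N N' : (G → ℝ≥0∞) → ℝ≥0∞} (h : ConvNorm N N')
    (hm : ∀ {p r : G → ℝ≥0∞}, (∀ g, p g ≤ r g) → N' p ≤ N' r) {x : G → ℂ} {R : ℝ≥0∞}
    (hR : N' (fun g => ‖x g‖ₑ) ≤ R) (n : ℕ) : N' (fun g => ‖cpow x n g‖ₑ) ≤ R ^ (n + 1) := by
  induction n with
  | zero => simpa [cpow] using hR
  | succ n ih =>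
    calc N' (fun g => ‖cpow x (n + 1) g‖ₑ)
        ≤ N' (conv (fun h => ‖x h‖ₑ) (fun h => ‖cpow x n h‖ₑ)) := hm (enorm_cconv_le _ _)
      _ ≤ R * R ^ (n + 1) := (h.conv_alg _ _).trans (by gcongr)
      _ = _ := by ring

/-- Telescoping the difference of powers leaves n + 1 terms, each with one factor x - y measured in
N and n factors measured in N'. -/
lemma ConvNorm.cpow_sub_le {N N' : (G → ℝ≥0∞) → ℝ≥0∞} (h : ConvNorm N N')
    (hm : ∀ {p r : G → ℝ≥0∞}, (∀ g, p g ≤ r g) → N' p ≤ N' r) {x y : G → ℂ} {R : ℝ≥0∞}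
    (hx : Summable fun g => ‖x g‖) (hy : Summable fun g => ‖y g‖)
    (hxR : N' (fun g => ‖x g‖ₑ) ≤ R) (hyR : N' (fun g => ‖y g‖ₑ) ≤ R) (n : ℕ) :
    N (fun g => ‖cpow x n g - cpow y n g‖ₑ) ≤ (n + 1) * R ^ n * N (fun g => ‖x g - y g‖ₑ) := by
  induction n with
  | zero => simp [cpow]
  | succ n ih =>
    have h1 : ∀ g, ‖cpow x (n + 1) g - cpow y (n + 1) g‖ₑ ≤
        conv (fun h => ‖x h - y h‖ₑ) (fun h => ‖cpow x n h‖ₑ) g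
          + conv (fun h => ‖y h‖ₑ) (fun h => ‖cpow x n h - cpow y n h‖ₑ) g := by
      intro g
      simp only [cpow]
      rw [cconv_sub_cconv hx (summable_norm_cpow hx n) hy (summable_norm_cpow hy n)]
      refine (enorm_add_le _ _).trans ?_
      gcongr
      · exact enorm_cconv_le _ _ g
      · exact enorm_cconv_le _ _ g
    calc N (fun g => ‖cpow x (n + 1) g - cpow y (n + 1) g‖ₑ)
        ≤ N (conv (fun h => ‖x h - y h‖ₑ) (fun h => ‖cpow x n h‖ₑ))
          + N (conv (fun h => ‖y h‖ₑ) (fun h => ‖cpow x n h - cpow y n h‖ₑ)) :=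
          (h.mono h1).trans (h.add_le _ _)
      _ ≤ N (fun g => ‖x g - y g‖ₑ) * R ^ (n + 1)
          + R * ((n + 1) * R ^ n * N (fun g => ‖x g - y g‖ₑ)) := by
          gcongr
          · exact (h.conv_le' _ _).trans (by gcongr; exact h.cpow_le hm hxR n)
          · exact (h.conv_le _ _).trans (by gcongr)
      _ = _ := by push_cast; ring

/-- The coefficients of `f(s) = ε⁻¹ sin(εs) - s = ∑ⱼ sinCoeff ε j * s^(2j+3)`. -/
noncomputable def sinCoeff (ε : ℝ) (j : ℕ) : ℝ :=
  (-1) ^ (j + 1) * ε ^ (2 * j + 2) / (2 * j + 3).factorial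

/-- The nonlinearity `f(s) = ε⁻¹ sin(εs) - s` in the convolution algebra. -/
noncomputable def fser (ε : ℝ) (x : G → ℂ) (g : G) : ℂ :=
  ∑' j, (sinCoeff ε j : ℂ) * cpow x (2 * j + 2) g

/-- The sine series without its linear term, which is exactly what f subtracts. -/
lemma hasSum_nonlin {ε : ℝ} (hε : ε ≠ 0) (r : ℝ) :
    HasSum (fun j => sinCoeff ε j * r ^ (2 * j + 3)) (nonlin ε r) := by
  have h := (Real.hasSum_sin (ε * r)).mul_left (1 / ε)
  rw [← hasSum_nat_add_iff' 1] at h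
  simp only [Finset.range_one, Finset.sum_singleton] at h
  convert! h using 1
  · funext j
    unfold sinCoeff
    rw [show 2 * (j + 1) + 1 = 2 * j + 3 by ring, mul_pow]
    field_simp
    ring
  · unfold nonlin
    simp
    field_simp

/-- Joint absolute summability in the power and the frequency, which justifies every later
interchange of the two sums. -/
lemma summable_norm_cpow_apply {x : G → ℂ} (hx : Summable fun g => ‖x g‖) (ε : ℝ) :
    Summable fun jg : ℕ × G => ‖(sinCoeff ε jg.1 : ℂ) * cpow x (2 * jg.1 + 2) jg.2‖ := by
  set r := ∑' g, ‖x g‖ with hr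
  have hr0 : 0 ≤ r := tsum_nonneg fun _ => norm_nonneg _
  have hN : ∑' g, ‖x g‖ₑ ≤ ENNReal.ofReal r := by
    simp only [← ofReal_norm]
    rw [← ENNReal.ofReal_tsum_of_nonneg (fun _ => norm_nonneg _) hx]
  have hb : ∀ n, ∑' g, ‖cpow x n g‖ ≤ r ^ (n + 1) := by
    intro n
    have := (convNorm_tsum (G := G)).cpow_le (fun h => ENNReal.tsum_le_tsum h) hN n
    simp only [← ofReal_norm] at this
    rw [← ENNReal.ofReal_tsum_of_nonneg (fun _ => norm_nonneg _) (summable_norm_cpow hx n),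
      ← ENNReal.ofReal_pow hr0] at this
    exact (ENNReal.ofReal_le_ofReal_iff (by positivity)).1 this
  have h0 : 0 ≤ fun jg : ℕ × G => ‖(sinCoeff ε jg.1 : ℂ) * cpow x (2 * jg.1 + 2) jg.2‖ :=
    fun _ => norm_nonneg _
  rw [summable_prod_of_nonneg h0]
  refine ⟨fun j => ?_, ?_⟩
  · simp only [norm_mul]
    exact (summable_norm_cpow hx _).mul_left _
  · simp only [norm_mul, tsum_mul_left]
    have hb' : ∀ j : ℕ, ‖(sinCoeff ε j : ℂ)‖ * ∑' g, ‖cpow x (2 * j + 2) g‖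
        ≤ (|ε| ^ (2 * j + 2) * r ^ (2 * j + 3)) / (2 * j + 3).factorial := by
      intro j
      have : ‖(sinCoeff ε j : ℂ)‖ = |ε| ^ (2 * j + 2) / (2 * j + 3).factorial := by
        simp [sinCoeff]
      rw [this, div_mul_eq_mul_div]
      gcongr
      exact hb _
    refine Summable.of_nonneg_of_le (fun j => by positivity) hb' ?_
    -- For ε ≠ 0 the terms are |ε|⁻¹(|ε|r)^{2j+3}/(2j+3)!, a subseries of an exponential series; for
    -- ε = 0 they all vanish.
    rcases eq_or_ne ε 0 with rfl | hε
    · simp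
    · have he : 0 < |ε| := abs_pos.2 hε
      have hs2 := ((Real.summable_pow_div_factorial (|ε| * r)).comp_injective
        (i := fun j : ℕ => 2 * j + 3) (fun a b h => by simpa using h)).mul_left (1 / |ε|)
      refine hs2.congr fun j => ?_
      simp only [Function.comp]
      rw [mul_pow]
      field_simp
      ring

lemma summable_fser_term {x : G → ℂ} (hx : Summable fun g => ‖x g‖) (ε : ℝ) (g : G) :
    Summable fun j => (sinCoeff ε j : ℂ) * cpow x (2 * j + 2) g :=
  ((summable_norm_cpow_apply hx ε).comp_injective
    (i := fun j : ℕ => (j, g)) (fun a b h => by simpa using h)).of_norm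

lemma summable_norm_fser {x : G → ℂ} (hx : Summable fun g => ‖x g‖) (ε : ℝ) :
    Summable fun g => ‖fser ε x g‖ := by
  rw [← tsum_enorm_ne_top_iff_summable_norm]
  have h := tsum_enorm_ne_top_iff_summable_norm.2 (summable_norm_cpow_apply hx ε)
  refine ne_top_of_le_ne_top h ?_
  rw [ENNReal.tsum_prod', ENNReal.tsum_comm]
  exact ENNReal.tsum_le_tsum fun g => enorm_tsum_le_tsum_enorm

/-- The nonlinearity is Lipschitz, with a constant of size `ε²`, in every convolution norm. -/
lemma ConvNorm.fser_sub_le {N N' : (G → ℝ≥0∞) → ℝ≥0∞} (h : ConvNorm N N')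
    (hm : ∀ {p r : G → ℝ≥0∞}, (∀ g, p g ≤ r g) → N' p ≤ N' r) {x y : G → ℂ} {R ε : ℝ}
    (hε : 0 ≤ ε) (hε1 : ε ≤ 1) (hR : 0 ≤ R)
    (hx : Summable fun g => ‖x g‖) (hy : Summable fun g => ‖y g‖)
    (hxR : N' (fun g => ‖x g‖ₑ) ≤ ENNReal.ofReal R)
    (hyR : N' (fun g => ‖y g‖ₑ) ≤ ENNReal.ofReal R) :
    N (fun g => ‖fser ε x g - fser ε y g‖ₑ)
      ≤ ENNReal.ofReal (ε ^ 2 * Real.exp R) * N (fun g => ‖x g - y g‖ₑ) := by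
  have h1 : ∀ g, ‖fser ε x g - fser ε y g‖ₑ ≤
      ∑' j, ‖(sinCoeff ε j : ℂ)‖ₑ * ‖cpow x (2 * j + 2) g - cpow y (2 * j + 2) g‖ₑ := by
    intro g
    unfold fser
    rw [← (summable_fser_term hx ε g).tsum_sub (summable_fser_term hy ε g)]
    refine (enorm_tsum_le_tsum_enorm).trans (le_of_eq (tsum_congr fun j => ?_))
    rw [← mul_sub, enorm_mul]
  have hterm : ∀ j : ℕ, ‖(sinCoeff ε j : ℂ)‖ₑ * (((2 * j + 2 : ℕ) + 1) * ENNReal.ofReal R ^ (2 * j + 2))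
      ≤ ENNReal.ofReal (ε ^ 2) * ENNReal.ofReal (R ^ (2 * j + 2) / (2 * j + 2).factorial) := by
    intro j
    rw [← ofReal_norm, ← ENNReal.ofReal_pow hR, ← ENNReal.ofReal_natCast,
      ← ENNReal.ofReal_one, ← ENNReal.ofReal_add (by positivity) (by positivity),
      ← ENNReal.ofReal_mul (by positivity), ← ENNReal.ofReal_mul (by positivity),
      ← ENNReal.ofReal_mul (by positivity)]
    apply ENNReal.ofReal_le_ofReal
    have : ‖(sinCoeff ε j : ℂ)‖ = ε ^ (2 * j + 2) / (2 * j + 3).factorial := by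
      simp [sinCoeff, abs_of_nonneg hε]
    rw [this, show 2 * j + 3 = (2 * j + 2) + 1 by ring, Nat.factorial_succ]
    -- The source of the factor ε²: every term of the series contains at least two powers of ε ≤ 1.
    -- The factor 2j + 3 from differentiating the power cancels against the factorial.
    have he : ε ^ (2 * j + 2) ≤ ε ^ 2 := pow_le_pow_of_le_one hε hε1 (by lia)
    push_cast
    rw [show ε ^ (2 * j + 2) / ((2 * (j : ℝ) + 2 + 1) * ((2 * j + 2).factorial : ℝ)) *
      ((2 * (j : ℝ) + 2 + 1) * R ^ (2 * j + 2))
      = ε ^ (2 * j + 2) * (R ^ (2 * j + 2) / ((2 * j + 2).factorial : ℝ)) by field_simp]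
    gcongr
  have hexp : ∑' j : ℕ, ENNReal.ofReal (R ^ (2 * j + 2) / (2 * j + 2).factorial)
      ≤ ENNReal.ofReal (Real.exp R) := by
    have he : Real.exp R = ∑' n : ℕ, R ^ n / n.factorial := by
      rw [Real.exp_eq_exp_ℝ, NormedSpace.exp_eq_tsum_div]
    rw [he, ENNReal.ofReal_tsum_of_nonneg (fun n => by positivity)
      (Real.summable_pow_div_factorial R)]
    exact ENNReal.tsum_comp_le_tsum_of_injective (f := fun j : ℕ => 2 * j + 2)
      (fun a b h => by simpa using h) (fun n => ENNReal.ofReal (R ^ n / n.factorial))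
  calc N (fun g => ‖fser ε x g - fser ε y g‖ₑ)
      ≤ ∑' j, N (fun g => ‖(sinCoeff ε j : ℂ)‖ₑ
          * ‖cpow x (2 * j + 2) g - cpow y (2 * j + 2) g‖ₑ) := (h.mono h1).trans (h.tsum_le _)
    _ ≤ ∑' j : ℕ, ‖(sinCoeff ε j : ℂ)‖ₑ * (((2 * j + 2 : ℕ) + 1)
          * ENNReal.ofReal R ^ (2 * j + 2) * N (fun g => ‖x g - y g‖ₑ)) := by
        refine ENNReal.tsum_le_tsum fun j => (h.const_mul _ _).trans ?_
        gcongr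
        exact h.cpow_sub_le hm hx hy hxR hyR _
    _ ≤ ∑' j : ℕ, ENNReal.ofReal (ε ^ 2) * ENNReal.ofReal (R ^ (2 * j + 2) / (2 * j + 2).factorial)
          * N (fun g => ‖x g - y g‖ₑ) := by
        refine ENNReal.tsum_le_tsum fun j => ?_
        rw [← mul_assoc]
        exact mul_le_mul_left (hterm j) _
    _ ≤ _ := by
        rw [ENNReal.tsum_mul_right, ENNReal.tsum_mul_left, ENNReal.ofReal_mul (by positivity)]
        gcongr

lemma fser_zero (ε : ℝ) : fser ε (0 : G → ℂ) = 0 := by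
  have : ∀ n, cpow (0 : G → ℂ) n = 0 := by
    intro n
    cases n with
    | zero => rfl
    | succ n => funext g; simp [cpow, cconv]
  funext g
  simp [fser, this]

/-! ### Characters of the convolution algebra. -/

/-- The evaluation of an element of the convolution algebra at a character. -/
noncomputable def ev (χ : G → ℂ) (x : G → ℂ) : ℂ := ∑' g, x g * χ g

lemma summable_ev {G : Type*} {χ : G → ℂ} (hχ : ∀ g, ‖χ g‖ = 1) {x : G → ℂ}
    (hx : Summable fun g => ‖x g‖) : Summable fun g => x g * χ g :=
  Summable.of_norm (by simpa [hχ] using hx)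

lemma ev_cconv {χ : G → ℂ} (hχ : ∀ g, ‖χ g‖ = 1) (hm : ∀ g h, χ (g + h) = χ g * χ h)
    {x y : G → ℂ} (hx : Summable fun g => ‖x g‖) (hy : Summable fun g => ‖y g‖) :
    ev χ (cconv x y) = ev χ x * ev χ y := by
  have hx' : Summable fun g => ‖x g * χ g‖ := by simpa [hχ] using hx
  have hy' : Summable fun g => ‖y g * χ g‖ := by simpa [hχ] using hy
  unfold ev
  rw [tsum_mul_tsum_of_summable_norm hx' hy']
  have hs := summable_mul_of_summable_norm hx' hy'
  -- The shear (h, g) ↦ (h, g - h) turns the product of two sums into a sum over g of convolution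
  -- terms.
  let e : G × G ≃ G × G :=
    { toFun := fun p => (p.1, p.2 - p.1)
      invFun := fun p => (p.1, p.1 + p.2)
      left_inv := fun p => by simp
      right_inv := fun p => by simp }
  have hs' := (e.summable_iff (f := fun z : G × G => x z.1 * χ z.1 * (y z.2 * χ z.2))).2 hs
  rw [← e.tsum_eq, ← (Equiv.prodComm G G).tsum_eq]
  have hs'' := ((Equiv.prodComm G G).summable_iff).2 hs'
  have := hs''.tsum_prod
  refine Eq.trans ?_ this.symm
  refine tsum_congr fun g => ?_
  unfold cconv
  rw [← tsum_mul_right]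
  refine tsum_congr fun h => ?_
  have : χ g = χ h * χ (g - h) := by rw [← hm, add_sub_cancel]
  simp only [Equiv.prodComm_apply, Prod.swap, e, Equiv.coe_fn_mk, this, Function.comp]
  ring

lemma ev_cpow {χ : G → ℂ} (hχ : ∀ g, ‖χ g‖ = 1) (hm : ∀ g h, χ (g + h) = χ g * χ h)
    {x : G → ℂ} (hx : Summable fun g => ‖x g‖) (n : ℕ) : ev χ (cpow x n) = ev χ x ^ (n + 1) := by
  induction n with
  | zero => simp [cpow]
  | succ n ih => rw [cpow, ev_cconv hχ hm hx (summable_norm_cpow hx n), ih]; ring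

/-- Evaluation at a character is an algebra homomorphism, so it carries the power series to the
power series at the number r. This identifies the formal series with the pointwise nonlinearity. -/
lemma ev_fser {χ : G → ℂ} (hχ : ∀ g, ‖χ g‖ = 1) (hm : ∀ g h, χ (g + h) = χ g * χ h)
    {x : G → ℂ} (hx : Summable fun g => ‖x g‖) {ε : ℝ} (hε : ε ≠ 0) {r : ℝ}
    (hr : ev χ x = r) : ev χ (fser ε x) = nonlin ε r := by
  have hs : Summable fun p : ℕ × G => (sinCoeff ε p.1 : ℂ) * cpow x (2 * p.1 + 2) p.2 * χ p.2 :=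
    Summable.of_norm (by
      simpa only [norm_mul, hχ, mul_one] using summable_norm_cpow_apply hx ε)
  have h1 : ∑' p : ℕ × G, (sinCoeff ε p.1 : ℂ) * cpow x (2 * p.1 + 2) p.2 * χ p.2 = nonlin ε r := by
    rw [hs.tsum_prod]
    have h2 : ∀ j : ℕ, ∑' g, (sinCoeff ε j : ℂ) * cpow x (2 * j + 2) g * χ g
        = ((sinCoeff ε j * r ^ (2 * j + 3) : ℝ) : ℂ) := by
      intro j
      have := ev_cpow hχ hm hx (2 * j + 2)
      unfold ev at this hr
      simp only [mul_assoc]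
      rw [tsum_mul_left, this, hr]
      push_cast; ring
    rw [tsum_congr h2, ← Complex.ofReal_tsum, (hasSum_nonlin hε r).tsum_eq]
  rw [← h1, ← (Equiv.prodComm G ℕ).tsum_eq]
  have hs2 := ((Equiv.prodComm G ℕ).summable_iff).2 hs
  refine Eq.trans ?_ hs2.tsum_prod.symm
  unfold ev
  refine tsum_congr fun g => ?_
  unfold fser
  rw [← tsum_mul_right]
  rfl

end convolution


/-! ### Fourier analysis on the square -/

/-- The one-dimensional Fourier mode. -/
noncomputable def mode1 (a b : ℝ) (k : ℤ) (x : ℝ) : ℂ :=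
  Complex.exp (Complex.I * ((freq a b k * (x - a) : ℝ) : ℂ))

lemma freq_add (a b : ℝ) (k l : ℤ) : freq a b (k + l) = freq a b k + freq a b l := by
  unfold freq; push_cast; ring

lemma freq_neg (a b : ℝ) (k : ℤ) : freq a b (-k) = -freq a b k := by
  unfold freq; push_cast; ring

lemma freq_zero (a b : ℝ) : freq a b 0 = 0 := by simp [freq]

lemma mode1_add (a b : ℝ) (k l : ℤ) (x : ℝ) :
    mode1 a b (k + l) x = mode1 a b k x * mode1 a b l x := by
  unfold mode1
  rw [← Complex.exp_add, freq_add]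
  push_cast
  ring_nf

lemma mode1_zero (a b x : ℝ) : mode1 a b 0 x = 1 := by simp [mode1, freq_zero]

lemma norm_exp_I_mul (r : ℝ) : ‖Complex.exp (Complex.I * (r : ℂ))‖ = 1 := by
  rw [mul_comm]; exact Complex.norm_exp_ofReal_mul_I r

lemma conj_exp_I_mul (r : ℝ) : (starRingEnd ℂ) (Complex.exp (Complex.I * (r : ℂ)))
    = Complex.exp (Complex.I * ((-r : ℝ) : ℂ)) := by
  rw [← Complex.exp_conj]
  simp

lemma conj_mode1 (a b : ℝ) (k : ℤ) (x : ℝ) :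
    (starRingEnd ℂ) (mode1 a b k x) = mode1 a b (-k) x := by
  unfold mode1
  rw [conj_exp_I_mul, freq_neg]
  ring_nf

lemma continuous_mode1 (a b : ℝ) (k : ℤ) : Continuous (mode1 a b k) := by
  unfold mode1; fun_prop

lemma mode_eq (a b : ℝ) (k l : ℤ) (z : ℝ × ℝ) :
    mode a b k l z = mode1 a b k z.1 * mode1 a b l z.2 := by
  unfold mode mode1
  rw [← Complex.exp_add]
  push_cast
  ring_nf

lemma norm_mode (a b : ℝ) (k l : ℤ) (z : ℝ × ℝ) : ‖mode a b k l z‖ = 1 := norm_exp_I_mul _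

lemma mode_add (a b : ℝ) (k l k' l' : ℤ) (z : ℝ × ℝ) :
    mode a b (k + k') (l + l') z = mode a b k l z * mode a b k' l' z := by
  simp only [mode_eq, mode1_add]; ring

lemma conj_mode (a b : ℝ) (k l : ℤ) (z : ℝ × ℝ) :
    (starRingEnd ℂ) (mode a b k l z) = mode a b (-k) (-l) z := by
  simp only [mode_eq, map_mul, conj_mode1]

lemma continuous_mode (a b : ℝ) (k l : ℤ) : Continuous (mode a b k l) := by
  unfold mode; fun_prop

lemma mode_neg_eq (a b : ℝ) (k l : ℤ) (z : ℝ × ℝ) :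
    Complex.exp (-(Complex.I * ((freq a b k * (z.1 - a) + freq a b l * (z.2 - a) : ℝ) : ℂ)))
      = mode a b (-k) (-l) z := by
  unfold mode
  rw [freq_neg, freq_neg]
  push_cast
  ring_nf

lemma coeff_eq (a b : ℝ) (w : ℝ × ℝ → ℂ) (k l : ℤ) :
    coeff a b w k l = (((b - a) ^ 2)⁻¹ : ℝ) *
      ∫ z in Ioo a b ×ˢ Ioo a b, w z * mode a b (-k) (-l) z := by
  unfold coeff
  simp only [mode_neg_eq]

lemma integral_mode1 {a b : ℝ} (hab : a < b) (k : ℤ) :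
    ∫ x in Ioo a b, mode1 a b k x = if k = 0 then ((b - a : ℝ) : ℂ) else 0 := by
  rw [← integral_Ioc_eq_integral_Ioo, ← intervalIntegral.integral_of_le hab.le]
  split_ifs with hk
  · simp only [hk, mode1_zero]
    simp
  · have hba : (b - a) ≠ 0 := by linarith
    have hf : freq a b k ≠ 0 := by
      unfold freq
      have : (k : ℝ) ≠ 0 := by exact_mod_cast hk
      have := Real.pi_ne_zero
      positivity
    have h1 : ∀ x : ℝ, mode1 a b k x
        = Complex.exp ((Complex.I * freq a b k) * ((x - a : ℝ) : ℂ)) := by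
      intro x; unfold mode1; push_cast; ring_nf
    simp only [h1]
    rw [intervalIntegral.integral_comp_sub_right
      (fun x : ℝ => Complex.exp ((Complex.I * freq a b k) * (x : ℂ))) a,
      integral_exp_mul_complex (by simp [hf])]
    have : Complex.I * (freq a b k : ℂ) * ((b - a : ℝ) : ℂ) = k * (2 * Real.pi * Complex.I) := by
      unfold freq
      have : ((b - a : ℝ) : ℂ) ≠ 0 := by exact_mod_cast hba
      push_cast at this ⊢
      field_simp
    rw [this, Complex.exp_int_mul_two_pi_mul_I]
    simp

lemma integral_mode {a b : ℝ} (hab : a < b) (k l : ℤ) :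
    ∫ z in Ioo a b ×ˢ Ioo a b, mode a b k l z
      = if k = 0 ∧ l = 0 then (((b - a) ^ 2 : ℝ) : ℂ) else 0 := by
  simp only [mode_eq]
  rw [Measure.volume_eq_prod, setIntegral_prod_mul (mode1 a b k) (mode1 a b l),
    integral_mode1 hab, integral_mode1 hab]
  by_cases hk : k = 0 <;> by_cases hl : l = 0 <;> simp [hk, hl, sq]

lemma integrableOn_of_continuous {w : ℝ × ℝ → ℂ} (hw : Continuous w) (a b : ℝ) :
    IntegrableOn w (Ioo a b ×ˢ Ioo a b) :=
  (hw.continuousOn.integrableOn_compact (isCompact_Icc.prod isCompact_Icc)).mono_set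
    (prod_mono Ioo_subset_Icc_self Ioo_subset_Icc_self)

lemma coeff_congr {a b : ℝ} {w w' : ℝ × ℝ → ℂ}
    (h : ∀ z ∈ Ioo a b ×ˢ Ioo a b, w z = w' z) (k l : ℤ) : coeff a b w k l = coeff a b w' k l := by
  unfold coeff
  congr 1
  refine setIntegral_congr_fun (measurableSet_Ioo.prod measurableSet_Ioo) fun z hz => ?_
  simp only [h z hz]

lemma coeff_sub {w w' : ℝ × ℝ → ℂ} (hw : Continuous w) (hw' : Continuous w') (a b : ℝ)
    (k l : ℤ) : coeff a b (fun z => w z - w' z) k l = coeff a b w k l - coeff a b w' k l := by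
  simp only [coeff_eq, ← mul_sub, sub_mul]
  rw [integral_sub]
  · exact integrableOn_of_continuous (hw.mul (continuous_mode _ _ _ _)) a b
  · exact integrableOn_of_continuous (hw'.mul (continuous_mode _ _ _ _)) a b

lemma coeff_toC_neg (a b : ℝ) (w : ℝ × ℝ → ℝ) (k l : ℤ) :
    coeff a b (toC w) (-k) (-l) = (starRingEnd ℂ) (coeff a b (toC w) k l) := by
  simp only [coeff_eq, map_mul, Complex.conj_ofReal, ← integral_conj, conj_mode]
  simp [toC]

/-- The function with Fourier coefficients `y`. -/
noncomputable def synth (a b : ℝ) (y : ℤ × ℤ → ℂ) (z : ℝ × ℝ) : ℂ :=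
  ∑' j : ℤ × ℤ, y j * mode a b j.1 j.2 z

lemma continuous_synth (a b : ℝ) {y : ℤ × ℤ → ℂ} (hy : Summable fun j => ‖y j‖) :
    Continuous (synth a b y) := by
  refine continuous_tsum (fun j => continuous_const.mul (continuous_mode a b j.1 j.2)) hy
    fun j z => ?_
  rw [norm_mul, norm_mode, mul_one]

lemma coeff_synth {a b : ℝ} (hab : a < b) {y : ℤ × ℤ → ℂ} (hy : Summable fun j => ‖y j‖)
    (k l : ℤ) : coeff a b (synth a b y) k l = y (k, l) := by
  rw [coeff_eq]
  have hba : b - a ≠ 0 := by linarith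
  have hterm : ∀ j : ℤ × ℤ, ∀ z, y j * mode a b j.1 j.2 z * mode a b (-k) (-l) z
      = y j * mode a b (j.1 - k) (j.2 - l) z := by
    intro j z
    rw [sub_eq_add_neg, sub_eq_add_neg, mode_add]
    ring
  have h1 : ∀ z, synth a b y z * mode a b (-k) (-l) z
      = ∑' j : ℤ × ℤ, y j * mode a b (j.1 - k) (j.2 - l) z := by
    intro z
    unfold synth
    rw [← tsum_mul_right]
    exact tsum_congr fun j => hterm j z
  simp only [h1]
  have hvol : ∫ _ in Ioo a b ×ˢ Ioo a b, (1 : ℝ) = (b - a) ^ 2 := by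
    have := setIntegral_prod_mul (μ := volume) (ν := volume) (fun _ : ℝ => (1 : ℝ))
      (fun _ : ℝ => (1 : ℝ)) (Ioo a b) (Ioo a b)
    rw [← Measure.volume_eq_prod] at this
    simp only [mul_one] at this
    rw [this]
    simp [hab.le, sq]
  have hs := hasSum_integral_of_summable_integral_norm
    (μ := volume.restrict (Ioo a b ×ˢ Ioo a b))
    (F := fun (j : ℤ × ℤ) z => y j * mode a b (j.1 - k) (j.2 - l) z)
    (fun j => integrableOn_of_continuous
      (continuous_const.mul (continuous_mode _ _ _ _)) a b)
    (by
      simp only [norm_mul, norm_mode]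
      have : ∀ j : ℤ × ℤ, ∫ _ in Ioo a b ×ˢ Ioo a b, ‖y j‖ * (1 : ℝ) = ‖y j‖ * (b - a) ^ 2 := by
        intro j
        rw [integral_const_mul, hvol]
      simp only [this]
      exact hy.mul_right _)
  rw [← hs.tsum_eq]
  simp only [integral_const_mul, integral_mode hab]
  rw [tsum_eq_single (k, l)]
  · simp only [sub_self, and_self, if_true]
    have : (((b - a) ^ 2 : ℝ) : ℂ) ≠ 0 := by exact_mod_cast pow_ne_zero 2 hba
    rw [Complex.ofReal_inv]
    field_simp
  · rintro ⟨k', l'⟩ h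
    rw [if_neg, mul_zero]
    rintro ⟨h1, h2⟩
    exact h (Prod.ext (by simpa [sub_eq_zero] using h1) (by simpa [sub_eq_zero] using h2))

/-- Parseval's identity makes the integral of |f|² vanish, and continuity upgrades this to pointwise
vanishing. -/
lemma eq_zero_of_fourier_eq_zero {a b : ℝ} (hab : a < b) {f : ℝ → ℂ} (hf : Continuous f)
    (h : ∀ k : ℤ, ∫ x in Ioo a b, f x * mode1 a b (-k) x = 0) : ∀ x ∈ Ioo a b, f x = 0 := by
  have hL2 : MemLp f 2 (volume.restrict (Ioc a b)) := by
    obtain ⟨C, hC⟩ := isCompact_Icc.exists_bound_of_continuousOn (hf.continuousOn (s := Icc a b))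
    refine MemLp.of_bound hf.aestronglyMeasurable C ?_
    filter_upwards [ae_restrict_mem measurableSet_Ioc] with x hx
    exact hC x (Ioc_subset_Icc_self hx)
  have hp := tsum_sq_fourierCoeffOn hab hL2
  have hz : ∀ k, fourierCoeffOn hab f k = 0 := by
    intro k
    rw [fourierCoeffOn_eq_integral]
    -- The characters of `AddCircle` have phase zero at the origin, the modes here at a; the
    -- constant e^{-iμ_k a} is the value of `mode1 a b (-k)` at 2a.
    have : ∀ x : ℝ, fourier (-k) (x : AddCircle (b - a)) • f x
        = mode1 a b (-k) (2 * a) * (f x * mode1 a b (-k) x) := by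
      intro x
      rw [fourier_coe_apply, smul_eq_mul]
      rw [show ∀ p q r : ℂ, p * (q * r) = p * r * q by intros; ring]
      congr 1
      unfold mode1
      rw [← Complex.exp_add]
      congr 1
      unfold freq
      have : ((b - a : ℝ) : ℂ) ≠ 0 := by exact_mod_cast (by linarith : b - a ≠ 0)
      push_cast at this ⊢
      field_simp
      ring
    simp only [this]
    rw [intervalIntegral.integral_const_mul, intervalIntegral.integral_of_le hab.le,
      integral_Ioc_eq_integral_Ioo, h k]
    simp
  simp only [hz, norm_zero, ne_eq, OfNat.ofNat_ne_zero, not_false_eq_true, zero_pow,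
    tsum_zero] at hp
  have hint : ∫ x in a..b, ‖f x‖ ^ 2 = 0 := by
    have : (b - a)⁻¹ ≠ 0 := inv_ne_zero (by linarith)
    simpa [this] using hp.symm
  intro x hx
  by_contra hne
  have : 0 < ∫ x in a..b, ‖f x‖ ^ 2 :=
    intervalIntegral.integral_pos hab (by fun_prop) (fun _ _ => by positivity)
      ⟨x, Ioo_subset_Icc_self hx, by positivity⟩
  linarith

/-- The one-dimensional statement is used twice: first for the partial Fourier coefficients in y as
functions of x, then for w(x, ·). Continuity extends the result to the closed square, which contains
the grid points. -/
lemma eq_zero_of_coeff_eq_zero {a b : ℝ} (hab : a < b) {w : ℝ × ℝ → ℂ} (hw : Continuous w)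
    (h : ∀ k l : ℤ, coeff a b w k l = 0) : ∀ z ∈ Icc a b ×ˢ Icc a b, w z = 0 := by
  have hIoo : ∀ z ∈ Ioo a b ×ˢ Ioo a b, w z = 0 := by
    rintro ⟨x, y⟩ ⟨hx, hy⟩
    have hl : ∀ l : ℤ, ∀ x ∈ Ioo a b, ∫ y in Ioo a b, w (x, y) * mode1 a b (-l) y = 0 := by
      intro l
      apply eq_zero_of_fourier_eq_zero hab
      · simp only [← integral_Ioc_eq_integral_Ioo, ← intervalIntegral.integral_of_le hab.le]
        refine intervalIntegral.continuous_parametric_intervalIntegral_of_continuous' ?_ a b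
        have := continuous_mode1 a b (-l)
        fun_prop
      · intro k
        have hk := h k l
        rw [coeff_eq] at hk
        have hba : ((((b - a) ^ 2)⁻¹ : ℝ) : ℂ) ≠ 0 := by
          have : b - a ≠ 0 := by linarith
          exact_mod_cast inv_ne_zero (pow_ne_zero 2 this)
        have hk' := (mul_eq_zero.1 hk).resolve_left hba
        rw [Measure.volume_eq_prod, setIntegral_prod] at hk'
        · rw [← hk']
          refine setIntegral_congr_fun measurableSet_Ioo fun x _ => ?_
          rw [← integral_mul_const]
          refine setIntegral_congr_fun measurableSet_Ioo fun y _ => ?_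
          simp only [mode_eq]
          ring
        · rw [← Measure.volume_eq_prod]
          exact integrableOn_of_continuous (hw.mul (continuous_mode _ _ _ _)) a b
    exact eq_zero_of_fourier_eq_zero hab (f := fun y => w (x, y)) (by fun_prop)
      (fun k => hl k x hx) y hy
  have hcl : Icc a b ×ˢ Icc a b = closure (Ioo a b ×ˢ Ioo a b) := by
    rw [closure_prod_eq, closure_Ioo hab.ne]
  rw [hcl]
  exact fun z hz => (isClosed_eq hw continuous_const).closure_subset_iff.2 hIoo hz

lemma eq_synth_coeff {a b : ℝ} (hab : a < b) {w : ℝ × ℝ → ℂ} (hw : Continuous w)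
    (hs : Summable fun j : ℤ × ℤ => ‖coeff a b w j.1 j.2‖) :
    ∀ z ∈ Icc a b ×ˢ Icc a b, w z = synth a b (fun j => coeff a b w j.1 j.2) z := by
  intro z hz
  have hc := continuous_synth a b hs
  have := eq_zero_of_coeff_eq_zero hab (w := fun z => w z - synth a b _ z) (hw.sub hc) (fun k l => by
    have := coeff_sub hw hc a b k l
    rw [coeff_synth hab hs] at this
    simpa using this) z hz
  simpa [sub_eq_zero] using this

/-! ### Space-time Fourier series. -/

/-- The group of space-time frequencies. -/
abbrev Frq := (ℤ × ℤ) × ℝ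

/-- The space-time character at time `s` and position `z`. -/
noncomputable def chr (a b s : ℝ) (z : ℝ × ℝ) (g : Frq) : ℂ :=
  Complex.exp (Complex.I * ((g.2 * s : ℝ) : ℂ)) * mode a b g.1.1 g.1.2 z

lemma norm_chr (a b s : ℝ) (z : ℝ × ℝ) (g : Frq) : ‖chr a b s z g‖ = 1 := by
  rw [chr, norm_mul, norm_exp_I_mul, norm_mode, one_mul]

lemma chr_add (a b s : ℝ) (z : ℝ × ℝ) (g h : Frq) :
    chr a b s z (g + h) = chr a b s z g * chr a b s z h := by
  simp only [chr, Prod.fst_add, Prod.snd_add, mode_add]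
  rw [add_mul, Complex.ofReal_add, mul_add, Complex.exp_add]
  ring

/-- The spatial Fourier coefficients at time `s` of a space-time series. -/
noncomputable def proj (s : ℝ) (Y : Frq → ℂ) (l : ℤ × ℤ) : ℂ :=
  ∑' ω : ℝ, Y (l, ω) * Complex.exp (Complex.I * ((ω * s : ℝ) : ℂ))

lemma enorm_proj_le (s : ℝ) (Y : Frq → ℂ) (l : ℤ × ℤ) :
    ‖proj s Y l‖ₑ ≤ ∑' ω : ℝ, ‖Y (l, ω)‖ₑ := by
  refine enorm_tsum_le_tsum_enorm.trans (le_of_eq (tsum_congr fun ω => ?_))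
  rw [enorm_mul, ← ofReal_norm (Complex.exp _), norm_exp_I_mul]
  simp

lemma summable_norm_proj (s : ℝ) {Y : Frq → ℂ} (hY : Summable fun g => ‖Y g‖) :
    Summable fun l => ‖proj s Y l‖ := by
  rw [← tsum_enorm_ne_top_iff_summable_norm] at *
  refine ne_top_of_le_ne_top hY ?_
  rw [ENNReal.tsum_prod' (f := fun g : Frq => ‖Y g‖ₑ)]
  exact ENNReal.tsum_le_tsum fun l => enorm_proj_le s Y l

lemma summable_proj_term (s : ℝ) {Y : Frq → ℂ} (hY : Summable fun g => ‖Y g‖) (l : ℤ × ℤ) :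
    Summable fun ω : ℝ => Y (l, ω) * Complex.exp (Complex.I * ((ω * s : ℝ) : ℂ)) := by
  refine Summable.of_norm ?_
  simp only [norm_mul, norm_exp_I_mul, mul_one]
  exact hY.comp_injective (i := fun ω : ℝ => (l, ω)) fun a b h => by simpa using h

lemma proj_sub (s : ℝ) {Y Y' : Frq → ℂ} (hY : Summable fun g => ‖Y g‖)
    (hY' : Summable fun g => ‖Y' g‖) (l : ℤ × ℤ) :
    proj s (fun g => Y g - Y' g) l = proj s Y l - proj s Y' l := by
  unfold proj
  simp only [sub_mul]
  exact (summable_proj_term s hY l).tsum_sub (summable_proj_term s hY' l)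

lemma ev_chr (a b s : ℝ) (z : ℝ × ℝ) {Y : Frq → ℂ} (hY : Summable fun g => ‖Y g‖) :
    ev (chr a b s z) Y = synth a b (proj s Y) z := by
  unfold ev
  rw [(summable_ev (norm_chr a b s z) hY).tsum_prod]
  refine tsum_congr fun l => ?_
  unfold proj
  rw [← tsum_mul_right]
  exact tsum_congr fun ω => by simp only [chr]; ring


/-! ### Weights -/

/-- The weight `1 + |μ_k| + |μ_l|`. -/
noncomputable def beta (a b : ℝ) (l : ℤ × ℤ) : ℝ := 1 + |freq a b l.1| + |freq a b l.2|

lemma one_le_beta (a b : ℝ) (l : ℤ × ℤ) : 1 ≤ beta a b l := by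
  unfold beta; have := abs_nonneg (freq a b l.1); have := abs_nonneg (freq a b l.2); linarith

lemma beta_pos (a b : ℝ) (l : ℤ × ℤ) : 0 < beta a b l := zero_lt_one.trans_le (one_le_beta a b l)

lemma beta_sq_le (a b : ℝ) (l : ℤ × ℤ) :
    beta a b l ^ 2 ≤ 3 * (1 + freq a b l.1 ^ 2 + freq a b l.2 ^ 2) := by
  unfold beta
  rw [← sq_abs (freq a b l.1), ← sq_abs (freq a b l.2)]
  nlinarith [sq_nonneg (|freq a b l.1| - |freq a b l.2|), sq_nonneg (|freq a b l.1| - 1),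
    sq_nonneg (|freq a b l.2| - 1)]

lemma le_beta_sq (a b : ℝ) (l : ℤ × ℤ) :
    1 + freq a b l.1 ^ 2 + freq a b l.2 ^ 2 ≤ beta a b l ^ 2 := by
  unfold beta
  rw [← sq_abs (freq a b l.1), ← sq_abs (freq a b l.2)]
  have := abs_nonneg (freq a b l.1); have := abs_nonneg (freq a b l.2)
  nlinarith [mul_nonneg (abs_nonneg (freq a b l.1)) (abs_nonneg (freq a b l.2))]

lemma beta_rpow_le (a b : ℝ) {s : ℝ} (hs : 0 ≤ s) (l : ℤ × ℤ) :
    beta a b l ^ s ≤ 3 ^ (s / 2) * (1 + freq a b l.1 ^ 2 + freq a b l.2 ^ 2) ^ (s / 2) := by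
  rw [← Real.mul_rpow (by norm_num) (by positivity)]
  calc beta a b l ^ s = (beta a b l ^ 2) ^ (s / 2) := by
        rw [← Real.rpow_natCast, ← Real.rpow_mul (beta_pos a b l).le]; push_cast; ring_nf
    _ ≤ _ := Real.rpow_le_rpow (by positivity) (beta_sq_le a b l) (by linarith)

lemma le_beta_rpow (a b : ℝ) {s : ℝ} (hs : 0 ≤ s) (l : ℤ × ℤ) :
    (1 + freq a b l.1 ^ 2 + freq a b l.2 ^ 2) ^ (s / 2) ≤ beta a b l ^ s := by
  calc _ ≤ (beta a b l ^ 2) ^ (s / 2) :=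
        Real.rpow_le_rpow (by positivity) (le_beta_sq a b l) (by linarith)
    _ = beta a b l ^ s := by
        rw [← Real.rpow_natCast, ← Real.rpow_mul (beta_pos a b l).le]; push_cast; ring_nf

lemma beta_neg (a b : ℝ) (l : ℤ × ℤ) : beta a b (-l) = beta a b l := by
  simp [beta, freq_neg]

/-- The symbol `δ` as a function on `ℤ²`. -/
noncomputable def dl (a b α : ℝ) (l : ℤ × ℤ) : ℝ := delta a b α l.1 l.2

lemma lapSymbol_nonneg (a b α : ℝ) (k l : ℤ) : 0 ≤ lapSymbol a b α k l := by
  unfold lapSymbol; positivity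

lemma one_le_dl (a b α : ℝ) (l : ℤ × ℤ) : 1 ≤ dl a b α l := by
  unfold dl delta
  rw [Real.one_le_sqrt]
  linarith [lapSymbol_nonneg a b α l.1 l.2]

lemma dl_pos (a b α : ℝ) (l : ℤ × ℤ) : 0 < dl a b α l := zero_lt_one.trans_le (one_le_dl a b α l)

lemma dl_sq (a b α : ℝ) (l : ℤ × ℤ) : dl a b α l ^ 2 = 1 + lapSymbol a b α l.1 l.2 := by
  unfold dl delta
  exact Real.sq_sqrt (by linarith [lapSymbol_nonneg a b α l.1 l.2])

lemma dl_neg (a b α : ℝ) (l : ℤ × ℤ) : dl a b α (-l) = dl a b α l := by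
  simp [dl, delta, lapSymbol, freq_neg]

lemma dl_le_of_abs_le {a b α : ℝ} (hab : a < b) (hα : 0 ≤ α) {l j : ℤ × ℤ} (h1 : |l.1| ≤ |j.1|)
    (h2 : |l.2| ≤ |j.2|) : dl a b α l ≤ dl a b α j := by
  have key : ∀ k k' : ℤ, |k| ≤ |k'| → freq a b k ^ 2 ≤ freq a b k' ^ 2 := by
    intro k k' h
    unfold freq
    rw [div_pow, div_pow, mul_pow, mul_pow _ (k' : ℝ), mul_pow]
    have : (k : ℝ) ^ 2 ≤ (k' : ℝ) ^ 2 := by exact_mod_cast sq_le_sq.2 h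
    gcongr
  unfold dl delta lapSymbol
  have e1 := key _ _ h1
  have e2 := key _ _ h2
  refine Real.sqrt_le_sqrt (add_le_add le_rfl ?_)
  exact Real.rpow_le_rpow (by positivity) (add_le_add e1 e2) (by linarith)

/-- `(1+|μ|²)^{α/2} ≤ δ²` for `α ≤ 2`. -/
lemma rpow_le_dl_sq (a b : ℝ) {α : ℝ} (h0 : 0 ≤ α) (h2 : α ≤ 2) (l : ℤ × ℤ) :
    (1 + freq a b l.1 ^ 2 + freq a b l.2 ^ 2) ^ (α / 2) ≤ dl a b α l ^ 2 := by
  rw [dl_sq, lapSymbol, add_assoc]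
  have := Real.rpow_add_le_add_rpow (p := α / 2) (a := 1)
    (b := freq a b l.1 ^ 2 + freq a b l.2 ^ 2) (by norm_num) (by positivity) (by linarith)
    (by linarith)
  simpa using this

/-- Together with `dl_le_beta` this makes δ comparable to β^{α/2}, so that multiplying by δ costs
exactly α/2 derivatives and dividing by it gains them. -/
lemma beta_le_dl (a b : ℝ) {α : ℝ} (h0 : 0 ≤ α) (h2 : α ≤ 2) (l : ℤ × ℤ) :
    beta a b l ^ (α / 2) ≤ 2 * dl a b α l := by
  have h1 := beta_rpow_le a b h0 l
  have h3 := rpow_le_dl_sq a b h0 h2 l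
  have h4 : (3 : ℝ) ^ (α / 2) ≤ 3 := by
    calc (3 : ℝ) ^ (α / 2) ≤ 3 ^ (1 : ℝ) :=
          Real.rpow_le_rpow_of_exponent_le (by norm_num) (by linarith)
      _ = 3 := Real.rpow_one _
  have h5 : (beta a b l ^ (α / 2)) ^ 2 = beta a b l ^ α := by
    rw [← Real.rpow_natCast, ← Real.rpow_mul (beta_pos a b l).le]; norm_num
  have hd := dl_pos a b α l
  have hb : 0 < beta a b l ^ (α / 2) := Real.rpow_pos_of_pos (beta_pos a b l) _
  apply le_of_sq_le_sq' (by positivity)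
  rw [h5]
  calc beta a b l ^ α ≤ 3 * dl a b α l ^ 2 := h1.trans (by gcongr)
    _ ≤ _ := by nlinarith [sq_nonneg (dl a b α l)]
where le_of_sq_le_sq' {x y : ℝ} (hy : 0 ≤ y) (h : x ^ 2 ≤ y ^ 2) : x ≤ y :=
  (le_abs_self x).trans (by rw [← abs_of_nonneg hy]; exact sq_le_sq.1 h)

lemma dl_le_beta (a b : ℝ) {α : ℝ} (h0 : 0 ≤ α) (l : ℤ × ℤ) :
    dl a b α l ≤ 2 * beta a b l ^ (α / 2) := by
  have hb : 1 ≤ beta a b l ^ (α / 2) := Real.one_le_rpow (one_le_beta a b l) (by linarith)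
  have h5 : (beta a b l ^ (α / 2)) ^ 2 = beta a b l ^ α := by
    rw [← Real.rpow_natCast, ← Real.rpow_mul (beta_pos a b l).le]; norm_num
  apply abs_le_of_sq_le_sq' _ (by positivity) |>.2
  rw [dl_sq, lapSymbol]
  have : (freq a b l.1 ^ 2 + freq a b l.2 ^ 2) ^ (α / 2) ≤ beta a b l ^ α := by
    refine le_trans (Real.rpow_le_rpow (by positivity) ?_ (by linarith)) (le_beta_rpow a b h0 l)
    linarith
  nlinarith

/-- `β^s` with values in `[0, ∞]`. -/
noncomputable def bw (a b s : ℝ) (l : ℤ × ℤ) : ℝ≥0∞ := ENNReal.ofReal (beta a b l ^ s)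

lemma bw_mul_bw (a b s t : ℝ) (l : ℤ × ℤ) : bw a b s l * bw a b t l = bw a b (s + t) l := by
  unfold bw
  rw [← ENNReal.ofReal_mul (Real.rpow_pos_of_pos (beta_pos a b l) _).le,
    Real.rpow_add (beta_pos a b l)]

lemma bw_zero (a b : ℝ) (l : ℤ × ℤ) : bw a b 0 l = 1 := by simp [bw]

lemma bw_mono (a b : ℝ) {s t : ℝ} (h : s ≤ t) (l : ℤ × ℤ) : bw a b s l ≤ bw a b t l :=
  ENNReal.ofReal_le_ofReal (Real.rpow_le_rpow_of_exponent_le (one_le_beta a b l) h)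

lemma one_le_bw (a b : ℝ) {s : ℝ} (h : 0 ≤ s) (l : ℤ × ℤ) : 1 ≤ bw a b s l := by
  rw [← bw_zero a b l]; exact bw_mono a b h l

lemma bw_neg (a b s : ℝ) (l : ℤ × ℤ) : bw a b s (-l) = bw a b s l := by simp [bw, beta_neg]

lemma summable_int_rpow {c s : ℝ} (hc : 0 < c) (hs : 1 < s) :
    Summable fun k : ℤ => (1 + c * |(k : ℝ)|) ^ (-s) := by
  have h : Summable fun k : ℕ => (1 + c * |(k : ℝ)|) ^ (-s) := by
    rw [← summable_nat_add_iff 1]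
    have h0 : Summable fun k : ℕ => 1 / ((k : ℝ) + 1) ^ s := by
      have := (summable_nat_add_iff 1).2 (Real.summable_one_div_nat_rpow.2 hs)
      simpa using this
    refine Summable.of_nonneg_of_le (fun k => by positivity) (fun k => ?_) (h0.mul_left (c ^ (-s)))
    rw [one_div, ← Real.rpow_neg (by positivity), ← Real.mul_rpow hc.le (by positivity)]
    refine Real.rpow_le_rpow_of_nonpos (by positivity) ?_ (by linarith)
    rw [abs_of_nonneg (by positivity)]
    push_cast
    linarith
  refine Summable.of_nat_of_neg (by simpa using h) (by simpa using h)

/-- The constant of the embedding of weighted `ℓ²` into `ℓ¹`. -/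
noncomputable def zl (a b s : ℝ) : ℝ≥0∞ := l2 (bw a b (-s))

/-- The double series factors: (1+x+y)^{-2s} ≤ (1+x)^{-s}(1+y)^{-s}, and each one-dimensional sum
converges for s > 1. This is the embedding of H^s into the Wiener algebra in two dimensions. -/
lemma zl_ne_top {a b s : ℝ} (hab : a < b) (hs : 1 < s) : zl a b s ≠ ∞ := by
  have hc : 0 < 2 * Real.pi / (b - a) := by
    have : 0 < b - a := by linarith
    positivity
  have hS := summable_int_rpow hc hs
  have hP := hS.mul_of_nonneg hS (fun k => by positivity) (fun k => by positivity)
  intro h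
  have h2 : l2 (bw a b (-s)) ^ 2 = ∞ := by rw [show l2 (bw a b (-s)) = ∞ from h]; simp
  rw [l2_sq] at h2
  have hle : ∑' l, bw a b (-s) l ^ 2 ≤ ∑' l : ℤ × ℤ, ENNReal.ofReal
      ((1 + 2 * Real.pi / (b - a) * |(l.1 : ℝ)|) ^ (-s)
        * (1 + 2 * Real.pi / (b - a) * |(l.2 : ℝ)|) ^ (-s)) := by
    refine ENNReal.tsum_le_tsum fun l => ?_
    unfold bw
    rw [← ENNReal.ofReal_pow (Real.rpow_pos_of_pos (beta_pos a b l) _).le]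
    apply ENNReal.ofReal_le_ofReal
    have hf : ∀ k : ℤ, |freq a b k| = 2 * Real.pi / (b - a) * |(k : ℝ)| := by
      intro k
      unfold freq
      rw [mul_div_right_comm, abs_mul, abs_of_pos hc]
    rw [← hf, ← hf, sq]
    unfold beta
    gcongr ?_ * ?_
    · exact Real.rpow_le_rpow_of_nonpos (by positivity)
        (by have := abs_nonneg (freq a b l.2); linarith) (by linarith)
    · exact Real.rpow_le_rpow_of_nonpos (by positivity)
        (by have := abs_nonneg (freq a b l.1); linarith) (by linarith)
  rw [h2, ← ENNReal.ofReal_tsum_of_nonneg (fun l => by positivity) hP] at hle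
  simp at hle

lemma tsum_le_zl (a b s : ℝ) (x : ℤ × ℤ → ℝ≥0∞) :
    ∑' l, x l ≤ zl a b s * l2 (fun l => bw a b s l * x l) := by
  refine le_trans (le_of_eq ?_) (tsum_mul_le_l2 _ _)
  refine tsum_congr fun l => ?_
  rw [← mul_assoc, bw_mul_bw, neg_add_cancel, bw_zero, one_mul]

/-- The space-time weight `(1 + |μ_k| + |μ_l| + |ω|^{2/α})^σ`. -/
noncomputable def wt (a b α σ : ℝ) (g : Frq) : ℝ := (beta a b g.1 + |g.2| ^ (2 / α)) ^ σ

lemma wt_pos (a b α σ : ℝ) (g : Frq) : 0 < wt a b α σ g :=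
  Real.rpow_pos_of_pos (by have := beta_pos a b g.1; positivity) _

lemma bw_le_wt (a b α : ℝ) {σ : ℝ} (hσ : 0 ≤ σ) (g : Frq) :
    bw a b σ g.1 ≤ ENNReal.ofReal (wt a b α σ g) := by
  apply ENNReal.ofReal_le_ofReal
  refine Real.rpow_le_rpow (beta_pos a b g.1).le ?_ hσ
  have : 0 ≤ |g.2| ^ (2 / α) := by positivity
  linarith

/-- β is subadditive, and the power 2/α in [1, 2) is subadditive up to the factor 2 by convexity.
The base of the weight at g + h is thus at most 4 times the larger of the two bases. -/
lemma wt_add_le (a b : ℝ) {α σ : ℝ} (h1 : 1 < α) (h2 : α ≤ 2) (hσ : 0 ≤ σ) (g h : Frq) :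
    wt a b α σ (g + h) ≤ 4 ^ σ * (wt a b α σ g + wt a b α σ h) := by
  have hp1 : 1 ≤ 2 / α := by rw [le_div_iff₀ (by linarith)]; linarith
  have hp2 : 2 / α ≤ 2 := by rw [div_le_iff₀ (by linarith)]; linarith
  have hpow : (|g.2| + |h.2|) ^ (2 / α) ≤ 2 ^ (2 / α - 1) * (|g.2| ^ (2 / α) + |h.2| ^ (2 / α)) := by
    have := NNReal.rpow_add_le_mul_rpow_add_rpow ⟨|g.2|, abs_nonneg _⟩ ⟨|h.2|, abs_nonneg _⟩ hp1
    rw [← NNReal.coe_le_coe] at this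
    push_cast at this
    exact this
  have hω : |g.2 + h.2| ^ (2 / α) ≤ 2 * (|g.2| ^ (2 / α) + |h.2| ^ (2 / α)) := by
    calc |g.2 + h.2| ^ (2 / α) ≤ (|g.2| + |h.2|) ^ (2 / α) :=
          Real.rpow_le_rpow (abs_nonneg _) (abs_add_le _ _) (by linarith)
      _ ≤ 2 ^ (2 / α - 1) * (|g.2| ^ (2 / α) + |h.2| ^ (2 / α)) :=
          hpow
      _ ≤ _ := by
          gcongr
          calc (2 : ℝ) ^ (2 / α - 1) ≤ 2 ^ (1 : ℝ) :=
                Real.rpow_le_rpow_of_exponent_le (by norm_num) (by linarith)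
            _ = 2 := Real.rpow_one _
  set X := beta a b g.1 + |g.2| ^ (2 / α) with hX
  set Y := beta a b h.1 + |h.2| ^ (2 / α) with hY
  have hX0 : 0 < X := by have := beta_pos a b g.1; positivity
  have hY0 : 0 < Y := by have := beta_pos a b h.1; positivity
  have hβ : beta a b (g + h).1 ≤ beta a b g.1 + beta a b h.1 := by
    unfold beta
    simp only [Prod.fst_add, Prod.snd_add, freq_add]
    linarith [abs_add_le (freq a b g.1.1) (freq a b h.1.1),
      abs_add_le (freq a b g.1.2) (freq a b h.1.2)]
  have hsum : beta a b (g + h).1 + |(g + h).2| ^ (2 / α) ≤ 4 * max X Y := by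
    have e : |(g + h).2| = |g.2 + h.2| := rfl
    rw [e]
    have := le_max_left X Y
    have := le_max_right X Y
    have := beta_pos a b g.1
    have := beta_pos a b h.1
    linarith
  unfold wt
  rw [← hX, ← hY]
  calc (beta a b (g + h).1 + |(g + h).2| ^ (2 / α)) ^ σ ≤ (4 * max X Y) ^ σ := by
        refine Real.rpow_le_rpow ?_ hsum hσ
        have := beta_pos a b (g + h).1
        positivity
    _ = 4 ^ σ * (max X Y) ^ σ := Real.mul_rpow (by norm_num) (le_max_of_le_left hX0.le)
    _ ≤ _ := by
        gcongr
        rcases max_cases X Y with ⟨h, -⟩ | ⟨h, -⟩ <;> rw [h]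
        · have := Real.rpow_pos_of_pos hY0 σ; linarith
        · have := Real.rpow_pos_of_pos hX0 σ; linarith

/-- The exponent 2/α is chosen for this: on the dispersion relation |ω| = δ_l one has |ω|^{2/α} ≲ β,
so a free wave has no larger space-time weight than its profile, up to a constant. -/
lemma wt_dl_le (a b : ℝ) {α σ : ℝ} (h1 : 1 < α) (hσ : 0 ≤ σ) (l : ℤ × ℤ) {ω : ℝ}
    (hω : |ω| = dl a b α l) : wt a b α σ (l, ω) ≤ 5 ^ σ * beta a b l ^ σ := by
  have hb := beta_pos a b l
  rw [← Real.mul_rpow (by norm_num) hb.le]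
  unfold wt
  refine Real.rpow_le_rpow (by positivity) ?_ hσ
  have hp2 : 2 / α ≤ 2 := by rw [div_le_iff₀ (by linarith)]; linarith
  have : |ω| ^ (2 / α) ≤ 4 * beta a b l := by
    rw [hω]
    calc dl a b α l ^ (2 / α) ≤ (2 * beta a b l ^ (α / 2)) ^ (2 / α) :=
          Real.rpow_le_rpow (dl_pos a b α l).le (dl_le_beta a b (by linarith) l) (by positivity)
      _ = 2 ^ (2 / α) * beta a b l := by
          rw [Real.mul_rpow (by norm_num) (by positivity), ← Real.rpow_mul hb.le]
          have : α / 2 * (2 / α) = 1 := by field_simp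
          rw [this, Real.rpow_one]
      _ ≤ 4 * beta a b l := by
          gcongr
          calc (2 : ℝ) ^ (2 / α) ≤ 2 ^ (2 : ℝ) :=
                Real.rpow_le_rpow_of_exponent_le (by norm_num) hp2
            _ = 4 := by norm_num
  simp only
  linarith

/-- The phase `ω - δ_l` is controlled by the weight. -/
lemma abs_phase_le (a b : ℝ) {α : ℝ} (h1 : 1 < α) (g : Frq) :
    |g.2 - dl a b α g.1| ≤ 3 * (beta a b g.1 + |g.2| ^ (2 / α)) ^ (α / 2) := by
  have hb := beta_pos a b g.1
  have h3 : |g.2| ≤ (beta a b g.1 + |g.2| ^ (2 / α)) ^ (α / 2) := by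
    calc |g.2| = (|g.2| ^ (2 / α)) ^ (α / 2) := by
          rw [← Real.rpow_mul (abs_nonneg _)]
          have : 2 / α * (α / 2) = 1 := by field_simp
          rw [this, Real.rpow_one]
      _ ≤ _ := Real.rpow_le_rpow (by positivity) (by linarith) (by linarith)
  have h4 : dl a b α g.1 ≤ 2 * (beta a b g.1 + |g.2| ^ (2 / α)) ^ (α / 2) := by
    refine (dl_le_beta a b (by linarith) g.1).trans ?_
    gcongr
    have : 0 ≤ |g.2| ^ (2 / α) := by positivity
    linarith
  calc |g.2 - dl a b α g.1| ≤ |g.2| + |dl a b α g.1| := abs_sub _ _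
    _ ≤ _ := by rw [abs_of_pos (dl_pos a b α g.1)]; linarith

/-! ### The weighted norm on space-time series -/

lemma fiber_fst (p : Frq → ℝ≥0∞) (l : ℤ × ℤ) :
    fiber Prod.fst p l = ∑' ω : ℝ, p (l, ω) := by
  unfold fiber
  rw [ENNReal.tsum_prod', tsum_eq_single l]
  · simp
  · intro l' hl'
    simp [hl']

/-- The weighted norm of a space-time series. -/
noncomputable def nw (a b α σ : ℝ) (p : Frq → ℝ≥0∞) : ℝ≥0∞ :=
  mixed Prod.fst (fun g => ENNReal.ofReal (wt a b α σ g) * p g)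

lemma nw_eq (a b α σ : ℝ) (p : Frq → ℝ≥0∞) :
    nw a b α σ p = l2 (fun l => ∑' ω : ℝ, ENNReal.ofReal (wt a b α σ (l, ω)) * p (l, ω)) := by
  unfold nw mixed
  rw [funext (fiber_fst _)]

lemma l2_bw_proj_le (a b α : ℝ) {σ : ℝ} (hσ : 0 ≤ σ) (p : Frq → ℝ≥0∞) :
    l2 (fun l => bw a b σ l * ∑' ω : ℝ, p (l, ω)) ≤ nw a b α σ p := by
  rw [nw_eq]
  refine l2_mono fun l => ?_
  rw [← ENNReal.tsum_mul_left]
  refine ENNReal.tsum_le_tsum fun ω => ?_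
  gcongr
  exact bw_le_wt a b α hσ (l, ω)

lemma tsum_le_nw (a b α : ℝ) {σ : ℝ} (hσ : 0 ≤ σ) (p : Frq → ℝ≥0∞) :
    ∑' g, p g ≤ zl a b σ * nw a b α σ p := by
  rw [ENNReal.tsum_prod' (f := p)]
  refine (tsum_le_zl a b σ _).trans ?_
  gcongr
  exact l2_bw_proj_le a b α hσ p

/-- The constant which makes the weighted norm submultiplicative. -/
noncomputable def kw (a b σ : ℝ) : ℝ := 2 * 4 ^ σ * (zl a b σ).toReal + 1

lemma kw_pos (a b σ : ℝ) : 0 < kw a b σ := by unfold kw; positivity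

/-- An instance of `convNorm_weighted` with A = 4^σ and B the embedding constant `zl`. The condition
σ > 1 keeps B finite. -/
lemma convNorm_nw {a b α σ : ℝ} (hab : a < b) (h1 : 1 < α) (h2 : α ≤ 2) (hσ : 1 < σ) :
    ConvNorm (fun p => ENNReal.ofReal (kw a b σ) * nw a b α σ p)
      (fun p => ENNReal.ofReal (kw a b σ) * nw a b α σ p) := by
  refine convNorm_weighted (AddMonoidHom.fst (ℤ × ℤ) ℝ) (fun g => ENNReal.ofReal (wt a b α σ g))
    (ENNReal.ofReal (4 ^ σ)) (zl a b σ) _ ?_ (tsum_le_nw a b α (by linarith)) ?_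
  · intro g h
    rw [← ENNReal.ofReal_add (wt_pos _ _ _ _ _).le (wt_pos _ _ _ _ _).le,
      ← ENNReal.ofReal_mul (by positivity)]
    exact ENNReal.ofReal_le_ofReal (wt_add_le a b h1 h2 (by linarith) g h)
  · nth_rw 1 [← ENNReal.ofReal_toReal (zl_ne_top hab hσ)]
    rw [← ENNReal.ofReal_ofNat,
      ← ENNReal.ofReal_mul (by positivity), ← ENNReal.ofReal_mul (by positivity)]
    apply ENNReal.ofReal_le_ofReal
    unfold kw
    linarith

lemma nw_mono (a b α σ : ℝ) {p r : Frq → ℝ≥0∞} (h : ∀ g, p g ≤ r g) :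
    nw a b α σ p ≤ nw a b α σ r := mixed_mono fun g => by gcongr; exact h g

/-- The nonlinearity in the weighted norm. -/
lemma nw_fser_sub_le {a b α σ : ℝ} (hab : a < b) (h1 : 1 < α) (h2 : α ≤ 2) (hσ : 1 < σ)
    {ε R : ℝ} (hε : 0 ≤ ε) (hε1 : ε ≤ 1) (hR : 0 ≤ R) {x y : Frq → ℂ}
    (hx : Summable fun g => ‖x g‖) (hy : Summable fun g => ‖y g‖)
    (hxR : nw a b α σ (fun g => ‖x g‖ₑ) ≤ ENNReal.ofReal R)
    (hyR : nw a b α σ (fun g => ‖y g‖ₑ) ≤ ENNReal.ofReal R) :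
    nw a b α σ (fun g => ‖fser ε x g - fser ε y g‖ₑ)
      ≤ ENNReal.ofReal (ε ^ 2 * Real.exp (kw a b σ * R)) * nw a b α σ (fun g => ‖x g - y g‖ₑ) := by
  have hk := kw_pos a b σ
  have h := (convNorm_nw (a := a) (b := b) hab h1 h2 hσ)
  have key := h.fser_sub_le h.mono hε hε1 (R := kw a b σ * R) (by positivity) hx hy
    (by rw [ENNReal.ofReal_mul hk.le]; gcongr) (by rw [ENNReal.ofReal_mul hk.le]; gcongr)
  -- The submultiplicative norm is `kw` times `nw`. The outer factor cancels; the one in the radius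
  -- stays in the exponential.
  rw [mul_left_comm] at key
  refine (ENNReal.mul_le_mul_iff_right ?_ ENNReal.ofReal_ne_top).1 key
  simpa using hk

lemma nw_fser_le {a b α σ : ℝ} (hab : a < b) (h1 : 1 < α) (h2 : α ≤ 2) (hσ : 1 < σ)
    {ε R : ℝ} (hε : 0 ≤ ε) (hε1 : ε ≤ 1) (hR : 0 ≤ R) {x : Frq → ℂ}
    (hx : Summable fun g => ‖x g‖)
    (hxR : nw a b α σ (fun g => ‖x g‖ₑ) ≤ ENNReal.ofReal R) :
    nw a b α σ (fun g => ‖fser ε x g‖ₑ)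
      ≤ ENNReal.ofReal (ε ^ 2 * Real.exp (kw a b σ * R)) * nw a b α σ (fun g => ‖x g‖ₑ) := by
  have h0 : nw a b α σ (fun g => ‖(0 : Frq → ℂ) g‖ₑ) ≤ ENNReal.ofReal R :=
    (nw_mono a b α σ fun g => by simp).trans hxR
  have := nw_fser_sub_le hab h1 h2 hσ hε hε1 hR hx (y := 0) (by simp) hxR h0
  simpa [fser_zero] using this

lemma summable_of_bw {a b σ : ℝ} (hab : a < b) (hσ : 1 < σ) {x : ℤ × ℤ → ℂ} {K : ℝ}
    (hx : l2 (fun l => bw a b σ l * ‖x l‖ₑ) ≤ ENNReal.ofReal K) : Summable fun l => ‖x l‖ := by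
  rw [← tsum_enorm_ne_top_iff_summable_norm]
  refine ne_top_of_le_ne_top ?_ (tsum_le_zl a b σ _)
  exact ENNReal.mul_ne_top (zl_ne_top hab hσ) (ne_top_of_le_ne_top ENNReal.ofReal_ne_top hx)

/-! ### Stationary series and free waves. -/

/-- A spatial series as a space-time series. -/
noncomputable def emb (x : ℤ × ℤ → ℂ) (g : Frq) : ℂ := if g.2 = 0 then x g.1 else 0

lemma tsum_emb (x : ℤ × ℤ → ℂ) (l : ℤ × ℤ) (c : ℝ → ℝ≥0∞) :
    ∑' ω : ℝ, c ω * ‖emb x (l, ω)‖ₑ = c 0 * ‖x l‖ₑ := by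
  rw [tsum_eq_single 0]
  · simp [emb]
  · intro ω hω; simp [emb, hω]

/-- At ω = 0 the weight reduces to β^σ. The space-time Lipschitz estimate therefore also applies to
functions frozen at one instant. -/
lemma nw_emb (a b : ℝ) {α : ℝ} (h1 : 1 < α) (σ : ℝ) (x : ℤ × ℤ → ℂ) :
    nw a b α σ (fun g => ‖emb x g‖ₑ) = l2 (fun l => bw a b σ l * ‖x l‖ₑ) := by
  rw [nw_eq]
  congr 1
  funext l
  rw [tsum_emb x l (fun ω => ENNReal.ofReal (wt a b α σ (l, ω)))]
  have : (2 / α) ≠ 0 := by positivity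
  simp [wt, bw, Real.zero_rpow this]

lemma proj_emb (s : ℝ) (x : ℤ × ℤ → ℂ) (l : ℤ × ℤ) : proj s (emb x) l = x l := by
  unfold proj
  rw [tsum_eq_single 0]
  · simp [emb]
  · intro ω hω; simp [emb, hω]

/-- The space-time series of the free real wave `Re ∑ e^{isδ} ψ_l mode_l`. -/
noncomputable def wave (a b α : ℝ) (ψ : ℤ × ℤ → ℂ) (g : Frq) : ℂ :=
  (if g.2 = dl a b α g.1 then ψ g.1 / 2 else 0)
    + (if g.2 = -dl a b α g.1 then (starRingEnd ℂ) (ψ (-g.1)) / 2 else 0)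

lemma wave_sub (a b α : ℝ) (ψ ψ' : ℤ × ℤ → ℂ) (g : Frq) :
    wave a b α ψ g - wave a b α ψ' g = wave a b α (fun l => ψ l - ψ' l) g := by
  unfold wave
  split_ifs <;> simp <;> ring

lemma tsum_wave_le (a b α : ℝ) (ψ : ℤ × ℤ → ℂ) (l : ℤ × ℤ) (c : ℝ → ℝ≥0∞) :
    ∑' ω : ℝ, c ω * ‖wave a b α ψ (l, ω)‖ₑ
      ≤ c (dl a b α l) * (‖ψ l‖ₑ / 2) + c (-dl a b α l) * (‖ψ (-l)‖ₑ / 2) := by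
  have h2 : ‖(2 : ℂ)‖ₑ = 2 := by
    rw [← ofReal_norm]; simp
  have hle : ∀ ω : ℝ, c ω * ‖wave a b α ψ (l, ω)‖ₑ
      ≤ (if ω = dl a b α l then c ω * (‖ψ l‖ₑ / 2) else 0)
        + (if ω = -dl a b α l then c ω * (‖ψ (-l)‖ₑ / 2) else 0) := by
    intro ω
    calc _ ≤ c ω * (‖if ω = dl a b α l then ψ l / 2 else 0‖ₑ
          + ‖if ω = -dl a b α l then (starRingEnd ℂ) (ψ (-l)) / 2 else 0‖ₑ) := by
          gcongr; exact enorm_add_le _ _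
      _ ≤ _ := by
          rw [mul_add]
          gcongr
          · split_ifs
            · rw [div_eq_mul_inv, enorm_mul, enorm_inv (by norm_num), h2, div_eq_mul_inv]
            · simp
          · split_ifs
            · rw [div_eq_mul_inv, enorm_mul, enorm_inv (by norm_num), h2, RCLike.enorm_conj,
                div_eq_mul_inv]
            · simp
  refine (ENNReal.tsum_le_tsum hle).trans ?_
  rw [ENNReal.tsum_add, tsum_eq_single (dl a b α l) (by intro ω h; simp [h]),
    tsum_eq_single (-dl a b α l) (by intro ω h; simp [h])]
  simp

lemma tsum_enorm_wave_le (a b α : ℝ) (ψ : ℤ × ℤ → ℂ) :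
    ∑' g, ‖wave a b α ψ g‖ₑ ≤ ∑' l, ‖ψ l‖ₑ := by
  rw [ENNReal.tsum_prod' (f := fun g => ‖wave a b α ψ g‖ₑ)]
  have h1 : ∀ l, ∑' ω : ℝ, ‖wave a b α ψ (l, ω)‖ₑ ≤ ‖ψ l‖ₑ / 2 + ‖ψ (-l)‖ₑ / 2 := by
    intro l
    simpa using tsum_wave_le a b α ψ l (fun _ => 1)
  refine (ENNReal.tsum_le_tsum h1).trans ?_
  have e := (Equiv.neg (ℤ × ℤ)).tsum_eq (fun l => ‖ψ l‖ₑ / 2)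
  simp only [Equiv.neg_apply] at e
  rw [ENNReal.tsum_add, e]
  simp only [div_eq_mul_inv]
  rw [ENNReal.tsum_mul_right, ← mul_add, ENNReal.inv_two_add_inv_two, mul_one]

lemma nw_wave_le (a b : ℝ) {α σ : ℝ} (h1 : 1 < α) (hσ : 0 ≤ σ) (ψ : ℤ × ℤ → ℂ) :
    nw a b α σ (fun g => ‖wave a b α ψ g‖ₑ)
      ≤ ENNReal.ofReal (5 ^ σ) * l2 (fun l => bw a b σ l * ‖ψ l‖ₑ) := by
  have hd : ∀ l, |dl a b α l| = dl a b α l := fun l => abs_of_pos (dl_pos a b α l)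
  have hw : ∀ l (ω : ℝ), |ω| = dl a b α l →
      ENNReal.ofReal (wt a b α σ (l, ω)) ≤ ENNReal.ofReal (5 ^ σ) * bw a b σ l := by
    intro l ω h
    rw [bw, ← ENNReal.ofReal_mul (by positivity)]
    exact ENNReal.ofReal_le_ofReal (wt_dl_le a b h1 hσ l h)
  rw [nw_eq]
  have h3 : ∀ l, ∑' ω : ℝ, ENNReal.ofReal (wt a b α σ (l, ω)) * ‖wave a b α ψ (l, ω)‖ₑ
      ≤ (ENNReal.ofReal (5 ^ σ) * 2⁻¹) * (bw a b σ l * ‖ψ l‖ₑ)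
        + (ENNReal.ofReal (5 ^ σ) * 2⁻¹) * (bw a b σ (-l) * ‖ψ (-l)‖ₑ) := by
    intro l
    refine (tsum_wave_le a b α ψ l (fun ω => ENNReal.ofReal (wt a b α σ (l, ω)))).trans ?_
    calc _ ≤ ENNReal.ofReal (5 ^ σ) * bw a b σ l * (‖ψ l‖ₑ / 2)
          + ENNReal.ofReal (5 ^ σ) * bw a b σ l * (‖ψ (-l)‖ₑ / 2) := by
          gcongr
          · exact hw l _ (hd l)
          · exact hw l _ (by rw [abs_neg, hd])
      _ = _ := by rw [bw_neg]; simp only [div_eq_mul_inv]; ring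
  refine (l2_mono h3).trans ((l2_add_le _ _).trans ?_)
  have e := l2_comp_equiv (Equiv.neg (ℤ × ℤ)) (fun l => bw a b σ l * ‖ψ l‖ₑ)
  simp only [Equiv.neg_apply] at e
  rw [l2_const_mul, l2_const_mul, e, ← add_mul, ← mul_add, ENNReal.inv_two_add_inv_two, mul_one]

lemma proj_wave (a b α s : ℝ) (ψ : ℤ × ℤ → ℂ) (l : ℤ × ℤ) :
    proj s (wave a b α ψ) l = (Complex.exp (Complex.I * ((s * dl a b α l : ℝ) : ℂ)) * ψ l
      + (starRingEnd ℂ) (Complex.exp (Complex.I * ((s * dl a b α l : ℝ) : ℂ)) * ψ (-l))) / 2 := by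
  have hd := dl_pos a b α l
  unfold proj
  rw [tsum_eq_sum (s := {dl a b α l, -dl a b α l})]
  · rw [Finset.sum_pair (by linarith)]
    have e1 : dl a b α l ≠ -dl a b α l := by linarith
    have e2 : -dl a b α l ≠ dl a b α l := by linarith
    simp only [wave, e1, e2, if_true, if_false, map_mul, conj_exp_I_mul]
    rw [mul_comm s, neg_mul]
    ring
  · intro ω hω
    simp only [Finset.mem_insert, Finset.mem_singleton, not_or] at hω
    simp [wave, hω.1, hω.2]

/-- The two branches ω = ±δ_l are complex conjugates of each other after l ↦ -l, so the series
represents a real function. -/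
lemma ev_wave (a b α s : ℝ) (z : ℝ × ℝ) {ψ : ℤ × ℤ → ℂ} (hψ : Summable fun l => ‖ψ l‖) :
    ev (chr a b s z) (wave a b α ψ) = ((synth a b
      (fun l => Complex.exp (Complex.I * ((s * dl a b α l : ℝ) : ℂ)) * ψ l) z).re : ℂ) := by
  have hw : Summable fun g => ‖wave a b α ψ g‖ := by
    rw [← tsum_enorm_ne_top_iff_summable_norm] at *
    exact ne_top_of_le_ne_top hψ (tsum_enorm_wave_le a b α ψ)
  rw [ev_chr a b s z hw, Complex.re_eq_add_conj]
  set A : ℤ × ℤ → ℂ := fun l => Complex.exp (Complex.I * ((s * dl a b α l : ℝ) : ℂ)) * ψ l with hA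
  have hs : Summable fun j : ℤ × ℤ => A j * mode a b j.1 j.2 z := by
    refine Summable.of_norm ?_
    simpa only [hA, norm_mul, norm_exp_I_mul, norm_mode, one_mul, mul_one] using hψ
  have hs2 : Summable fun j : ℤ × ℤ => (starRingEnd ℂ) (A (-j) * mode a b (-j).1 (-j).2 z) :=
    (((Equiv.neg (ℤ × ℤ)).summable_iff).2 hs).star
  unfold synth
  rw [Complex.conj_tsum, ← (Equiv.neg (ℤ × ℤ)).tsum_eq
    (fun j : ℤ × ℤ => (starRingEnd ℂ) (A j * mode a b j.1 j.2 z))]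
  simp only [Equiv.neg_apply]
  rw [← hs.tsum_add hs2, ← tsum_div_const]
  refine tsum_congr fun j => ?_
  rw [proj_wave, map_mul (starRingEnd ℂ) (A (-j)), conj_mode]
  simp only [hA, dl_neg, Prod.fst_neg, Prod.snd_neg, neg_neg]
  ring

/-- The spatial coefficients of the nonlinearity applied to a real function. -/
lemma coeff_nonlin {a b : ℝ} (hab : a < b) {ε : ℝ} (hε : ε ≠ 0) (s : ℝ) {x : Frq → ℂ}
    (hx : Summable fun g => ‖x g‖) {w : ℝ × ℝ → ℝ}
    (h : ∀ z ∈ Ioo a b ×ˢ Ioo a b, ev (chr a b s z) x = w z) (l : ℤ × ℤ) :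
    coeff a b (toC fun z => nonlin ε (w z)) l.1 l.2 = proj s (fser ε x) l := by
  have hf := summable_norm_fser hx ε
  rw [← coeff_synth hab (summable_norm_proj s hf) l.1 l.2]
  refine coeff_congr (fun z hz => ?_) _ _
  rw [← ev_chr a b s z hf, ev_fser (norm_chr a b s z) (chr_add a b s z) hx hε (h z hz)]
  rfl


/-! ### The exact solution in twisted variables -/

lemma sobolevNorm_eq (a b s : ℝ) (w : ℝ × ℝ → ℂ) :
    sobolevNorm a b s w = l2 (fun l : ℤ × ℤ => ENNReal.ofReal
      ((1 + freq a b l.1 ^ 2 + freq a b l.2 ^ 2) ^ (s / 2)) * ‖coeff a b w l.1 l.2‖ₑ) := by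
  unfold sobolevNorm l2
  congr 2
  funext l
  dsimp only
  rw [← ofReal_norm, ← ENNReal.ofReal_mul (by positivity), ← ENNReal.ofReal_pow (by positivity),
    mul_pow, ← Real.rpow_natCast (_ ^ (s / 2)), ← Real.rpow_mul (by positivity)]
  push_cast
  rw [div_mul_cancel₀ s two_ne_zero]

lemma l2_bw_le_sobolevNorm (a b : ℝ) {s : ℝ} (hs : 0 ≤ s) (w : ℝ × ℝ → ℂ) :
    l2 (fun l : ℤ × ℤ => bw a b s l * ‖coeff a b w l.1 l.2‖ₑ)
      ≤ ENNReal.ofReal (3 ^ (s / 2)) * sobolevNorm a b s w := by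
  rw [sobolevNorm_eq, ← l2_const_mul]
  refine l2_mono fun l => ?_
  rw [← mul_assoc, ← ENNReal.ofReal_mul (by positivity)]
  gcongr
  exact ENNReal.ofReal_le_ofReal (beta_rpow_le a b hs l)

/-- An almost everywhere bound on the Sobolev norm holds everywhere if the Fourier coefficients
are continuous in time. -/
lemma sobolevNorm_le_of_linftyNorm_le {a b s S M : ℝ} (hS : 0 < S) {w : ℝ → ℝ × ℝ → ℂ}
    (hc : ∀ k l : ℤ, ContinuousOn (fun t => coeff a b (w t) k l) (Icc 0 S))
    (h : linftyNorm a b s S w ≤ ENNReal.ofReal M) :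
    ∀ t ∈ Icc 0 S, sobolevNorm a b s (w t) ≤ ENNReal.ofReal M := by
  intro t ht
  set M' := max M 0 with hM'
  have hMM : ENNReal.ofReal M = ENNReal.ofReal M' := by
    rcases le_total 0 M with h0 | h0
    · rw [hM', max_eq_left h0]
    · rw [hM', max_eq_right h0, ENNReal.ofReal_of_nonpos h0, ENNReal.ofReal_zero]
  have hM0 : 0 ≤ M' := le_max_right _ _
  rw [hMM] at h ⊢
  have hae : ∀ᵐ t ∂(volume.restrict (Icc 0 S)), sobolevNorm a b s (w t) ≤ ENNReal.ofReal M' := by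
    filter_upwards [ENNReal.ae_le_essSup (μ := volume.restrict (Icc 0 S))
      (fun t => sobolevNorm a b s (w t))] with t ht
    exact ht.trans h
  have hterm : ∀ (t : ℝ) (l : ℤ × ℤ), (ENNReal.ofReal
      ((1 + freq a b l.1 ^ 2 + freq a b l.2 ^ 2) ^ (s / 2)) * ‖coeff a b (w t) l.1 l.2‖ₑ) ^ 2
      = ENNReal.ofReal (((1 + freq a b l.1 ^ 2 + freq a b l.2 ^ 2) ^ (s / 2)
        * ‖coeff a b (w t) l.1 l.2‖) ^ 2) := by
    intro t l
    rw [← ofReal_norm, ← ENNReal.ofReal_mul (by positivity), ← ENNReal.ofReal_pow (by positivity)]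
  rw [sobolevNorm_eq]
  apply l2_le_of_forall_finset
  intro F
  set f : ℝ → ℝ := fun t => ∑ l ∈ F, ((1 + freq a b l.1 ^ 2 + freq a b l.2 ^ 2) ^ (s / 2)
        * ‖coeff a b (w t) l.1 l.2‖) ^ 2 with hf
  have hsum : ∀ t, ∑ l ∈ F, (ENNReal.ofReal ((1 + freq a b l.1 ^ 2 + freq a b l.2 ^ 2) ^ (s / 2))
      * ‖coeff a b (w t) l.1 l.2‖ₑ) ^ 2 = ENNReal.ofReal (f t) := by
    intro t
    simp only [hterm]
    rw [ENNReal.ofReal_sum_of_nonneg (fun _ _ => by positivity)]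
  have hfc : ContinuousOn f (Icc 0 S) := by
    refine continuousOn_finsetSum _ fun l _ => ContinuousOn.pow ?_ 2
    exact continuousOn_const.mul (hc l.1 l.2).norm
  -- Taking the maximum with the bound turns an almost everywhere inequality into an almost
  -- everywhere equality of continuous functions, which then holds everywhere.
  have hfae : (fun t => max (f t) (M' ^ 2)) =ᵐ[volume.restrict (Icc 0 S)] fun _ => M' ^ 2 := by
    filter_upwards [hae] with t ht
    rw [sobolevNorm_eq] at ht
    have h1 := (sum_sq_le_l2_sq _ F).trans (pow_le_pow_left' ht 2)
    rw [hsum, ← ENNReal.ofReal_pow hM0, ENNReal.ofReal_le_ofReal_iff (by positivity)] at h1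
    exact max_eq_right h1
  have heq := Measure.eqOn_Icc_of_ae_eq volume hS.ne hfae
    (hfc.sup continuousOn_const) continuousOn_const ht
  rw [hsum, ← ENNReal.ofReal_pow hM0]
  exact ENNReal.ofReal_le_ofReal (max_eq_right_iff.1 heq)

/-- A solution of the semilinear wave equation in twisted variables
`ψ(t) = e^{-itδ} (û - iδ⁻¹v̂)`, bounded in a weighted norm. -/
structure IsProfile (a b α σ ε S R : ℝ) (ψ : ℝ → ℤ × ℤ → ℂ) : Prop where
  bound : ∀ t ∈ Icc 0 S, l2 (fun l => bw a b σ l * ‖ψ t l‖ₑ) ≤ ENNReal.ofReal R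
  deriv : ∀ l, ∀ t ∈ Icc 0 S, HasDerivWithinAt (fun s => ψ s l)
    (Complex.I / dl a b α l * Complex.exp (Complex.I * ((-(t * dl a b α l) : ℝ) : ℂ))
      * proj t (fser ε (wave a b α (ψ t))) l) (Icc 0 S) t

/-- The twisted variable of the pair `(u, v)`. -/
noncomputable def twist (a b α : ℝ) (u v : ℝ → ℝ × ℝ → ℝ) (t : ℝ) (l : ℤ × ℤ) : ℂ :=
  Complex.exp (Complex.I * ((-(t * dl a b α l) : ℝ) : ℂ)) * (coeff a b (toC (u t)) l.1 l.2
    - Complex.I / dl a b α l * coeff a b (toC (v t)) l.1 l.2)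

lemma exp_mul_exp_neg (r : ℝ) :
    Complex.exp (Complex.I * (r : ℂ)) * Complex.exp (Complex.I * ((-r : ℝ) : ℂ)) = 1 := by
  rw [← Complex.exp_add]
  simp

lemma exp_mul_twist (a b α : ℝ) (u v : ℝ → ℝ × ℝ → ℝ) (t : ℝ) (l : ℤ × ℤ) :
    Complex.exp (Complex.I * ((t * dl a b α l : ℝ) : ℂ)) * twist a b α u v t l
      = coeff a b (toC (u t)) l.1 l.2 - Complex.I / dl a b α l * coeff a b (toC (v t)) l.1 l.2 := by
  rw [twist, ← mul_assoc, exp_mul_exp_neg, one_mul]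

/-- Since u and v are real, the conjugate variable at -l carries û + iδ⁻¹v̂; half the sum and the
difference of the two recover û and v̂. -/
lemma conj_exp_mul_twist (a b α : ℝ) (u v : ℝ → ℝ × ℝ → ℝ) (t : ℝ) (l : ℤ × ℤ) :
    (starRingEnd ℂ) (Complex.exp (Complex.I * ((t * dl a b α l : ℝ) : ℂ))
      * twist a b α u v t (-l))
      = coeff a b (toC (u t)) l.1 l.2 + Complex.I / dl a b α l * coeff a b (toC (v t)) l.1 l.2 := by
  have := exp_mul_twist a b α u v t (-l)
  rw [dl_neg] at this
  rw [this, Prod.fst_neg, Prod.snd_neg, coeff_toC_neg, coeff_toC_neg]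
  simp
  ring

lemma coeff_u_eq (a b α : ℝ) (u v : ℝ → ℝ × ℝ → ℝ) (t : ℝ) (l : ℤ × ℤ) :
    coeff a b (toC (u t)) l.1 l.2 = proj t (wave a b α (twist a b α u v t)) l := by
  rw [proj_wave, exp_mul_twist, conj_exp_mul_twist]
  ring

lemma dl_ne_zero (a b α : ℝ) (l : ℤ × ℤ) : (dl a b α l : ℂ) ≠ 0 := by
  exact_mod_cast (dl_pos a b α l).ne'

lemma coeff_v_eq (a b α : ℝ) (u v : ℝ → ℝ × ℝ → ℝ) (t : ℝ) (l : ℤ × ℤ) :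
    coeff a b (toC (v t)) l.1 l.2 = Complex.I / 2 * dl a b α l *
      (Complex.exp (Complex.I * ((t * dl a b α l : ℝ) : ℂ)) * twist a b α u v t l
        - (starRingEnd ℂ) (Complex.exp (Complex.I * ((t * dl a b α l : ℝ) : ℂ))
          * twist a b α u v t (-l))) := by
  rw [exp_mul_twist, conj_exp_mul_twist]
  have := dl_ne_zero a b α l
  field_simp
  ring_nf
  simp

lemma enorm_exp_I_mul (r : ℝ) : ‖Complex.exp (Complex.I * (r : ℂ))‖ₑ = 1 := by
  rw [← ofReal_norm, norm_exp_I_mul]; simp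

lemma enorm_I_div_dl (a b α : ℝ) (l : ℤ × ℤ) :
    ‖Complex.I / dl a b α l‖ₑ = ENNReal.ofReal (dl a b α l)⁻¹ := by
  rw [← ofReal_norm]
  simp [abs_of_pos (dl_pos a b α l)]

/-- The inverse of `δ` gains `α/2` derivatives. -/
lemma bw_mul_inv_dl_le (a b : ℝ) {α : ℝ} (h0 : 0 ≤ α) (h2 : α ≤ 2) (s : ℝ) (l : ℤ × ℤ) :
    bw a b (s + α / 2) l * ENNReal.ofReal (dl a b α l)⁻¹ ≤ 2 * bw a b s l := by
  have hd := dl_pos a b α l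
  have hb := beta_pos a b l
  unfold bw
  rw [← ENNReal.ofReal_mul (by positivity), ← ENNReal.ofReal_ofNat,
    ← ENNReal.ofReal_mul (by positivity)]
  apply ENNReal.ofReal_le_ofReal
  rw [Real.rpow_add hb, ← div_eq_mul_inv, div_le_iff₀ hd]
  have := beta_le_dl a b h0 h2 l
  have hs : 0 < beta a b l ^ s := Real.rpow_pos_of_pos hb s
  nlinarith

lemma summable_wave {a b α : ℝ} {ψ : ℤ × ℤ → ℂ} (hψ : Summable fun l => ‖ψ l‖) :
    Summable fun g => ‖wave a b α ψ g‖ := by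
  rw [← tsum_enorm_ne_top_iff_summable_norm] at *
  exact ne_top_of_le_ne_top hψ (tsum_enorm_wave_le a b α ψ)

/-- The solution regularity constant. -/
noncomputable def profileBound (m α M : ℝ) : ℝ :=
  (3 ^ ((m + α / 2) / 2) + 2 * 3 ^ (m / 2)) * max M 0

lemma profileBound_nonneg (m α M : ℝ) : 0 ≤ profileBound m α M := by
  unfold profileBound; positivity

section
variable {a b α ε S m M : ℝ} {u₀ u₁ : ℝ × ℝ → ℝ} {u v : ℝ → ℝ × ℝ → ℝ}

lemma IsSolution.coeff_u_le (hs : IsSolution a b α ε S u₀ u₁ u v) (hm : 0 ≤ m + α / 2)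
    (hS : 0 < S) (hA : AssumptionA a b α m S M u v) {t : ℝ} (ht : t ∈ Icc 0 S) :
    l2 (fun l : ℤ × ℤ => bw a b (m + α / 2) l * ‖coeff a b (toC (u t)) l.1 l.2‖ₑ)
      ≤ ENNReal.ofReal (3 ^ ((m + α / 2) / 2) * max M 0) := by
  have := sobolevNorm_le_of_linftyNorm_le hS
    (fun k l t ht => (hs.deriv_u k l t ht).continuousWithinAt) hA.1 t ht
  refine (l2_bw_le_sobolevNorm a b hm _).trans ?_
  rw [ENNReal.ofReal_mul (by positivity)]
  gcongr
  exact this.trans (ENNReal.ofReal_le_ofReal (le_max_left _ _))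

lemma IsSolution.coeff_v_le (hs : IsSolution a b α ε S u₀ u₁ u v) (hm : 0 ≤ m)
    (hS : 0 < S) (hA : AssumptionA a b α m S M u v) {t : ℝ} (ht : t ∈ Icc 0 S) :
    l2 (fun l : ℤ × ℤ => bw a b m l * ‖coeff a b (toC (v t)) l.1 l.2‖ₑ)
      ≤ ENNReal.ofReal (3 ^ (m / 2) * max M 0) := by
  have := sobolevNorm_le_of_linftyNorm_le hS
    (fun k l t ht => (hs.equation k l t ht).continuousWithinAt) hA.2 t ht
  refine (l2_bw_le_sobolevNorm a b hm _).trans ?_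
  rw [ENNReal.ofReal_mul (by positivity)]
  gcongr
  exact this.trans (ENNReal.ofReal_le_ofReal (le_max_left _ _))

lemma continuous_toC {w : ℝ × ℝ → ℝ} (hw : Continuous w) : Continuous (toC w) :=
  Complex.continuous_ofReal.comp hw

lemma IsSolution.u_eq_synth (hab : a < b) (h0 : 0 ≤ α) (hm : 1 < m)
    (hs : IsSolution a b α ε S u₀ u₁ u v) (hS : 0 < S) (hA : AssumptionA a b α m S M u v)
    {t : ℝ} (ht : t ∈ Icc 0 S) {z : ℝ × ℝ} (hz : z ∈ Icc a b ×ˢ Icc a b) :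
    (u t z : ℂ) = synth a b (fun l => coeff a b (toC (u t)) l.1 l.2) z :=
  eq_synth_coeff hab (continuous_toC (hs.cper_u t ht).1)
    (summable_of_bw hab (by linarith) (hs.coeff_u_le (by linarith) hS hA ht)) z hz

lemma IsSolution.v_eq_synth (hab : a < b) (hm : 1 < m)
    (hs : IsSolution a b α ε S u₀ u₁ u v) (hS : 0 < S) (hA : AssumptionA a b α m S M u v)
    {t : ℝ} (ht : t ∈ Icc 0 S) {z : ℝ × ℝ} (hz : z ∈ Icc a b ×ˢ Icc a b) :
    (v t z : ℂ) = synth a b (fun l => coeff a b (toC (v t)) l.1 l.2) z :=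
  eq_synth_coeff hab (continuous_toC (hs.cper_v t ht).1)
    (summable_of_bw hab hm (hs.coeff_v_le (by linarith) hS hA ht)) z hz

/-- Variation of constants. With δ² = 1 + |μ|^α the linear terms in û and v̂ cancel, the 1 being
compensated by the -s in f, and only δ⁻¹ f(u)^ remains. For the bound, δ⁻¹ raises v̂ from m to m +
α/2 derivatives. -/
lemma IsSolution.isProfile (hab : a < b) (h1 : 1 < α) (h2 : α ≤ 2) (hm : 1 < m) (hε : ε ≠ 0)
    (hs : IsSolution a b α ε S u₀ u₁ u v) (hS : 0 < S) (hA : AssumptionA a b α m S M u v) :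
    IsProfile a b α (m + α / 2) ε S (profileBound m α M) (twist a b α u v) := by
  have hbound : ∀ t ∈ Icc 0 S, l2 (fun l => bw a b (m + α / 2) l * ‖twist a b α u v t l‖ₑ)
      ≤ ENNReal.ofReal (profileBound m α M) := by
    intro t ht
    have hle : ∀ l : ℤ × ℤ, bw a b (m + α / 2) l * ‖twist a b α u v t l‖ₑ
        ≤ bw a b (m + α / 2) l * ‖coeff a b (toC (u t)) l.1 l.2‖ₑ
          + 2 * (bw a b m l * ‖coeff a b (toC (v t)) l.1 l.2‖ₑ) := by
      intro l
      rw [twist, enorm_mul, enorm_exp_I_mul, one_mul]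
      calc _ ≤ bw a b (m + α / 2) l * (‖coeff a b (toC (u t)) l.1 l.2‖ₑ
            + ENNReal.ofReal (dl a b α l)⁻¹ * ‖coeff a b (toC (v t)) l.1 l.2‖ₑ) := by
            gcongr
            rw [← enorm_I_div_dl, ← enorm_mul]
            exact enorm_sub_le
        _ ≤ _ := by
            rw [mul_add, ← mul_assoc (bw a b (m + α / 2) l), ← mul_assoc 2]
            exact add_le_add le_rfl
              (mul_le_mul_left (bw_mul_inv_dl_le a b (by linarith) h2 m l) _)
    refine (l2_mono hle).trans ((l2_add_le _ _).trans ?_)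
    rw [l2_const_mul]
    have e : profileBound m α M
        = 3 ^ ((m + α / 2) / 2) * max M 0 + 2 * (3 ^ (m / 2) * max M 0) := by
      unfold profileBound; ring
    rw [e, ENNReal.ofReal_add (by positivity) (by positivity),
      ENNReal.ofReal_mul (p := 2) (by norm_num), ENNReal.ofReal_ofNat]
    gcongr
    · exact hs.coeff_u_le (by linarith) hS hA ht
    · exact hs.coeff_v_le (by linarith) hS hA ht
  refine ⟨hbound, fun l t ht => ?_⟩
  have hd := dl_ne_zero a b α l
  have hsum : Summable fun l => ‖twist a b α u v t l‖ :=
    summable_of_bw hab (by linarith) (hbound t ht)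
  have hF : proj t (fser ε (wave a b α (twist a b α u v t))) l
      = coeff a b (toC fun z => 1 / ε * Real.sin (ε * u t z)) l.1 l.2
        - coeff a b (toC (u t)) l.1 l.2 := by
    have hc := (hs.cper_u t ht).1
    rw [← coeff_nonlin hab hε t (summable_wave hsum) (w := u t), ← coeff_sub]
    · congr 1
      funext z
      simp [toC, nonlin]
    · exact continuous_toC (by fun_prop)
    · exact continuous_toC hc
    · intro z hz
      rw [ev_chr a b t z (summable_wave hsum)]
      simp only [funext (fun l => (coeff_u_eq a b α u v t l).symm)]
      exact (hs.u_eq_synth hab (by linarith) hm hS hA ht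
        (prod_mono Ioo_subset_Icc_self Ioo_subset_Icc_self hz)).symm
  have hexp : HasDerivWithinAt
      (fun s : ℝ => Complex.exp (Complex.I * ((-(s * dl a b α l) : ℝ) : ℂ)))
      (Complex.exp (Complex.I * ((-(t * dl a b α l) : ℝ) : ℂ)) * (Complex.I * (-(dl a b α l : ℂ))))
      (Icc 0 S) t := by
    apply HasDerivAt.hasDerivWithinAt
    have h0 : HasDerivAt (fun s : ℝ => Complex.I * ((-(s * dl a b α l) : ℝ) : ℂ))
        (Complex.I * (-(dl a b α l : ℂ))) t := by
      have := ((((hasDerivAt_id t).mul_const (dl a b α l)).neg).ofReal_comp).const_mul Complex.I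
      simpa using this
    exact h0.cexp
  have hder := hexp.mul ((hs.deriv_u l.1 l.2 t ht).sub
    ((hs.equation l.1 l.2 t ht).const_mul (Complex.I / dl a b α l)))
  refine hder.congr_deriv ?_
  rw [hF]
  have hl : ((lapSymbol a b α l.1 l.2 : ℝ) : ℂ) = (dl a b α l : ℂ) ^ 2 - 1 := by
    have := dl_sq a b α l
    have h' : lapSymbol a b α l.1 l.2 = dl a b α l ^ 2 - 1 := by linarith
    rw [h']; push_cast; ring
  rw [hl]
  simp only [Pi.sub_apply]
  generalize Complex.exp (Complex.I * ((-(t * dl a b α l) : ℝ) : ℂ)) = E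
  generalize coeff a b (toC (u t)) l.1 l.2 = U
  generalize coeff a b (toC (v t)) l.1 l.2 = V
  generalize coeff a b (toC fun z => 1 / ε * Real.sin (ε * u t z)) l.1 l.2 = Z
  generalize (dl a b α l : ℂ) = d at hd
  have hI := Complex.I_sq
  field_simp
  linear_combination (E * V * d) * hI

end


/-! ### Time regularity and local errors -/

lemma sum_sq_eq_ofReal {ι : Type*} (F : Finset ι) (x : ι → ℂ) :
    ∑ i ∈ F, ‖x i‖ₑ ^ 2 = ENNReal.ofReal (∑ i ∈ F, ‖x i‖ ^ 2) := by
  rw [ENNReal.ofReal_sum_of_nonneg (fun _ _ => by positivity)]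
  refine Finset.sum_congr rfl fun i _ => ?_
  rw [← ofReal_norm, ENNReal.ofReal_pow (norm_nonneg _)]

/-- The mean value inequality in `ℓ²`. -/
lemma l2_sub_le_of_deriv_le {ι : Type*} {g g' : ℝ → ι → ℂ} {s t K : ℝ} (hst : s ≤ t) (hK : 0 ≤ K)
    (hder : ∀ i, ∀ r ∈ Icc s t, HasDerivWithinAt (fun r => g r i) (g' r i) (Icc s t) r)
    (hb : ∀ r ∈ Icc s t, l2 (fun i => ‖g' r i‖ₑ) ≤ ENNReal.ofReal K) :
    l2 (fun i => ‖g t i - g s i‖ₑ) ≤ ENNReal.ofReal (K * (t - s)) := by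
  have hts : 0 ≤ t - s := by linarith
  apply l2_le_of_forall_finset
  intro F
  -- On finitely many coordinates the family is a curve in a Euclidean space, where the mean value
  -- inequality applies; its bound does not depend on the finite set.
  let e := (PiLp.continuousLinearEquiv 2 ℝ (fun _ : F => ℂ)).symm
  have hd : ∀ r ∈ Icc s t, HasDerivWithinAt (fun r => e (fun i : F => g r i))
      (e (fun i : F => g' r i)) (Icc s t) r := by
    intro r hr
    have h1 : HasDerivWithinAt (fun r => (fun i : F => g r i)) (fun i : F => g' r i) (Icc s t) r :=
      hasDerivWithinAt_pi.2 fun i => hder i r hr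
    exact e.toContinuousLinearMap.hasFDerivAt.comp_hasDerivWithinAt r h1
  have hnorm : ∀ x : ι → ℂ, ‖e (fun i : F => x i)‖ ^ 2 = ∑ i ∈ F, ‖x i‖ ^ 2 := by
    intro x
    rw [EuclideanSpace.norm_sq_eq]
    exact Finset.sum_coe_sort F (fun i => ‖x i‖ ^ 2)
  have hbound : ∀ r ∈ Icc s t, ‖e (fun i : F => g' r i)‖ ≤ K := by
    intro r hr
    have h1 := (sum_sq_le_l2_sq (fun i => ‖g' r i‖ₑ) F).trans (pow_le_pow_left' (hb r hr) 2)
    rw [sum_sq_eq_ofReal, ← ENNReal.ofReal_pow hK,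
      ENNReal.ofReal_le_ofReal_iff (by positivity), ← hnorm] at h1
    exact (pow_le_pow_iff_left₀ (norm_nonneg _) hK two_ne_zero).1 h1
  have key := (convex_Icc s t).norm_image_sub_le_of_norm_hasDerivWithin_le hd hbound
    (left_mem_Icc.2 hst) (right_mem_Icc.2 hst)
  have e1 : e (fun i : F => g t i) - e (fun i : F => g s i)
      = e (fun i : F => (fun i => g t i - g s i) i) := by
    rw [← map_sub]; rfl
  rw [e1, Real.norm_of_nonneg hts] at key
  rw [sum_sq_eq_ofReal, ← ENNReal.ofReal_pow (by positivity)]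
  apply ENNReal.ofReal_le_ofReal
  rw [← hnorm (fun i => g t i - g s i)]
  gcongr

/-- The mean value inequality in weighted `ℓ²`. -/
lemma l2_weighted_sub_le {ι : Type*} {g g' : ℝ → ι → ℂ} {s t K : ℝ} (hst : s ≤ t) (hK : 0 ≤ K)
    (w : ι → ℝ) (hw : ∀ i, 0 ≤ w i)
    (hder : ∀ i, ∀ r ∈ Icc s t, HasDerivWithinAt (fun r => g r i) (g' r i) (Icc s t) r)
    (hb : ∀ r ∈ Icc s t, l2 (fun i => ENNReal.ofReal (w i) * ‖g' r i‖ₑ) ≤ ENNReal.ofReal K) :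
    l2 (fun i => ENNReal.ofReal (w i) * ‖g t i - g s i‖ₑ) ≤ ENNReal.ofReal (K * (t - s)) := by
  have he : ∀ i (x : ℂ), ENNReal.ofReal (w i) * ‖x‖ₑ = ‖(w i : ℂ) * x‖ₑ := by
    intro i x
    rw [enorm_mul, ← ofReal_norm (w i : ℂ), Complex.norm_real, Real.norm_of_nonneg (hw i)]
  simp only [he] at hb
  have := l2_sub_le_of_deriv_le (g := fun r i => (w i : ℂ) * g r i) hst hK
    (fun i r hr => (hder i r hr).const_mul _) hb
  simpa only [he, mul_sub] using this

lemma l2_bw_enorm_proj_le (a b α : ℝ) {σ : ℝ} (hσ : 0 ≤ σ) (s : ℝ) (Y : Frq → ℂ) :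
    l2 (fun l => bw a b σ l * ‖proj s Y l‖ₑ) ≤ nw a b α σ (fun g => ‖Y g‖ₑ) := by
  refine le_trans (l2_mono fun l => ?_) (l2_bw_proj_le a b α hσ _)
  gcongr
  exact enorm_proj_le s Y l

lemma ev_wave_real (a b α s : ℝ) {ψ : ℤ × ℤ → ℂ} (hψ : Summable fun l => ‖ψ l‖) :
    ∃ w : ℝ × ℝ → ℝ, ∀ z, ev (chr a b s z) (wave a b α ψ) = w z :=
  ⟨_, fun z => ev_wave a b α s z hψ⟩

/-- The nonlinearity of a real wave is real. This symmetry is what combines the two half-waves into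
a sine in `IsProfile.proj_wave_sub_le`. -/
lemma proj_fser_wave_neg {a b : ℝ} (hab : a < b) (α s : ℝ) {ε : ℝ} (hε : ε ≠ 0) {ψ : ℤ × ℤ → ℂ}
    (hψ : Summable fun l => ‖ψ l‖) (l : ℤ × ℤ) :
    proj s (fser ε (wave a b α ψ)) (-l)
      = (starRingEnd ℂ) (proj s (fser ε (wave a b α ψ)) l) := by
  obtain ⟨w, hw⟩ := ev_wave_real a b α s hψ
  rw [← coeff_nonlin hab hε s (summable_wave hψ) (fun z _ => hw z),
    ← coeff_nonlin hab hε s (summable_wave hψ) (fun z _ => hw z)]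
  exact coeff_toC_neg a b _ l.1 l.2

lemma summable_emb {x : ℤ × ℤ → ℂ} (hx : Summable fun l => ‖x l‖) :
    Summable fun g => ‖emb x g‖ := by
  rw [← tsum_enorm_ne_top_iff_summable_norm] at *
  refine ne_top_of_le_ne_top hx ?_
  rw [ENNReal.tsum_prod' (f := fun g => ‖emb x g‖ₑ)]
  refine ENNReal.tsum_le_tsum fun l => ?_
  simpa using (tsum_emb x l (fun _ => 1)).le

/-- The spatial coefficients of the nonlinearity depend only on the function at that time. -/
lemma proj_fser_wave {a b : ℝ} (hab : a < b) (α s : ℝ) {ε : ℝ} (hε : ε ≠ 0) {ψ : ℤ × ℤ → ℂ}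
    (hψ : Summable fun l => ‖ψ l‖) (l : ℤ × ℤ) :
    proj s (fser ε (wave a b α ψ)) l = proj s (fser ε (emb (proj s (wave a b α ψ)))) l := by
  obtain ⟨w, hw⟩ := ev_wave_real a b α s hψ
  have hp := summable_norm_proj s (summable_wave (a := a) (b := b) (α := α) hψ)
  rw [← coeff_nonlin hab hε s (summable_wave hψ) (fun z _ => hw z),
    ← coeff_nonlin hab hε s (summable_emb hp) (fun z _ => ?_)]
  rw [← hw z, ev_chr a b s z (summable_emb hp), ev_chr a b s z (summable_wave hψ)]
  congr 1
  funext l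
  exact proj_emb s _ l

/-- The Lipschitz constant of the nonlinearity on the range of the solution. -/
noncomputable def lipC (a b σ R : ℝ) : ℝ := Real.exp (kw a b σ * (5 ^ σ * R))

lemma lipC_pos (a b σ R : ℝ) : 0 < lipC a b σ R := Real.exp_pos _

section
variable {a b α σ ε S R : ℝ} {ψ : ℝ → ℤ × ℤ → ℂ}

lemma IsProfile.summable (h : IsProfile a b α σ ε S R ψ) (hab : a < b) (hσ : 1 < σ) {t : ℝ}
    (ht : t ∈ Icc 0 S) : Summable fun l => ‖ψ t l‖ := summable_of_bw hab hσ (h.bound t ht)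

lemma IsProfile.nw_wave (h : IsProfile a b α σ ε S R ψ) (h1 : 1 < α) (hσ : 1 < σ) {t : ℝ}
    (ht : t ∈ Icc 0 S) :
    nw a b α σ (fun g => ‖wave a b α (ψ t) g‖ₑ) ≤ ENNReal.ofReal (5 ^ σ * R) := by
  refine (nw_wave_le a b h1 (by linarith) _).trans ?_
  rw [ENNReal.ofReal_mul (by positivity)]
  gcongr
  exact h.bound t ht

lemma IsProfile.nw_fser (h : IsProfile a b α σ ε S R ψ) (hab : a < b) (h1 : 1 < α) (h2 : α ≤ 2)
    (hσ : 1 < σ) (hε : 0 ≤ ε) (hε1 : ε ≤ 1) (hR : 0 ≤ R) {t : ℝ} (ht : t ∈ Icc 0 S) :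
    nw a b α σ (fun g => ‖fser ε (wave a b α (ψ t)) g‖ₑ)
      ≤ ENNReal.ofReal (ε ^ 2 * lipC a b σ R * (5 ^ σ * R)) := by
  have hb := h.nw_wave h1 hσ ht
  refine (nw_fser_le hab h1 h2 hσ hε hε1 (by positivity) (summable_wave (h.summable hab hσ ht))
    hb).trans ?_
  rw [ENNReal.ofReal_mul (p := ε ^ 2 * lipC a b σ R)
    (by have := lipC_pos a b σ R; positivity)]
  unfold lipC
  gcongr

lemma IsProfile.l2_proj_fser (h : IsProfile a b α σ ε S R ψ) (hab : a < b) (h1 : 1 < α)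
    (h2 : α ≤ 2) (hσ : 1 < σ) (hε : 0 ≤ ε) (hε1 : ε ≤ 1) (hR : 0 ≤ R) {t : ℝ}
    (ht : t ∈ Icc 0 S) :
    l2 (fun l => bw a b σ l * ‖proj t (fser ε (wave a b α (ψ t))) l‖ₑ)
      ≤ ENNReal.ofReal (ε ^ 2 * lipC a b σ R * (5 ^ σ * R)) :=
  (l2_bw_enorm_proj_le a b α (by linarith) t _).trans (h.nw_fser hab h1 h2 hσ hε hε1 hR ht)

/-- The twisted variable is slowly varying. -/
lemma IsProfile.sub_le (h : IsProfile a b α σ ε S R ψ) (hab : a < b) (h1 : 1 < α) (h2 : α ≤ 2)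
    (hσ : 1 < σ) (hε : 0 ≤ ε) (hε1 : ε ≤ 1) (hR : 0 ≤ R) {s t : ℝ} (hs : 0 ≤ s) (hst : s ≤ t)
    (ht : t ≤ S) :
    l2 (fun l => bw a b σ l * ‖ψ t l - ψ s l‖ₑ)
      ≤ ENNReal.ofReal (ε ^ 2 * lipC a b σ R * (5 ^ σ * R) * (t - s)) := by
  have hL := lipC_pos a b σ R
  have hsub : Icc s t ⊆ Icc 0 S := Icc_subset_Icc hs ht
  refine l2_weighted_sub_le hst (by positivity) (fun l => beta a b l ^ σ)
    (fun l => by have := beta_pos a b l; positivity)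
    (fun l r hr => (h.deriv l r (hsub hr)).mono hsub) fun r hr => ?_
  refine le_trans (l2_mono fun l => ?_) (h.l2_proj_fser hab h1 h2 hσ hε hε1 hR (hsub hr))
  rw [enorm_mul, enorm_mul, enorm_exp_I_mul, mul_one, enorm_I_div_dl]
  unfold bw
  gcongr
  refine mul_le_of_le_one_left zero_le ?_
  rw [← ENNReal.ofReal_one]
  exact ENNReal.ofReal_le_ofReal (inv_le_one_of_one_le₀ (one_le_dl a b α l))

/-- Over one time step the solution differs from the free wave by `O(ε²τ²)`. -/
lemma IsProfile.proj_wave_sub_le (h : IsProfile a b α σ ε S R ψ) (hab : a < b) (h1 : 1 < α)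
    (h2 : α ≤ 2) (hσ : 1 < σ) (hε : 0 < ε) (hε1 : ε ≤ 1) (hR : 0 ≤ R) {s t : ℝ} (hs : 0 ≤ s)
    (hst : s ≤ t) (ht : t ≤ S) :
    l2 (fun l => bw a b σ l * ‖proj t (wave a b α (ψ t)) l - proj t (wave a b α (ψ s)) l‖ₑ)
      ≤ ENNReal.ofReal (ε ^ 2 * lipC a b σ R * (5 ^ σ * R) * (t - s) ^ 2) := by
  have hL := lipC_pos a b σ R
  have hsub : Icc s t ⊆ Icc 0 S := Icc_subset_Icc hs ht
  set F : ℝ → ℤ × ℤ → ℂ := fun r l => proj r (fser ε (wave a b α (ψ r))) l with hF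
  have hts : 0 ≤ t - s := by linarith
  rw [sq (t - s), ← mul_assoc]
  -- The observation time t is fixed and only the profile time r moves. The contributions of the two
  -- branches differ in sign and add up to -sin((t-r)δ)/δ; its bound by t - s supplies the second
  -- power of t - s without loss of derivatives.
  refine l2_weighted_sub_le (g := fun r l => proj t (wave a b α (ψ r)) l)
    (g' := fun r l => -(Real.sin ((t - r) * dl a b α l) / dl a b α l : ℝ) * F r l)
    hst (by positivity) (fun l => beta a b l ^ σ)
    (fun l => by have := beta_pos a b l; positivity) (fun l r hr => ?_) fun r hr => ?_
  · simp only [proj_wave]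
    have d1 := ((h.deriv l r (hsub hr)).mono hsub).const_mul
      (Complex.exp (Complex.I * ((t * dl a b α l : ℝ) : ℂ)))
    have d2 := (((h.deriv (-l) r (hsub hr)).mono hsub).const_mul
      (Complex.exp (Complex.I * ((t * dl a b α l : ℝ) : ℂ)))).star
    have d3 := (d1.add d2).div_const 2
    refine d3.congr_deriv ?_
    have hneg := proj_fser_wave_neg hab α r hε.ne' (h.summable hab hσ (hsub hr)) l
    simp only [hF]
    rw [hneg, dl_neg]
    simp only [RCLike.star_def, map_mul, Complex.conj_conj, conj_exp_I_mul, map_div₀,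
      Complex.conj_I, Complex.conj_ofReal]
    generalize proj r (fser ε (wave a b α (ψ r))) l = f
    have hd := dl_ne_zero a b α l
    push_cast
    rw [Complex.sin]
    have e1 : Complex.exp (-(((t : ℂ) - r) * dl a b α l) * Complex.I)
        = Complex.exp (Complex.I * -((t : ℂ) * dl a b α l))
          * Complex.exp (Complex.I * - -((r : ℂ) * dl a b α l)) := by
      rw [← Complex.exp_add]; ring_nf
    have e2 : Complex.exp (((t : ℂ) - r) * dl a b α l * Complex.I)
        = Complex.exp (Complex.I * ((t : ℂ) * dl a b α l))
          * Complex.exp (Complex.I * -((r : ℂ) * dl a b α l)) := by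
      rw [← Complex.exp_add]; ring_nf
    rw [e1, e2]
    field_simp
    ring
  · have hrs : t - r ≤ t - s := by linarith [hr.1]
    have hr0 : 0 ≤ t - r := by linarith [hr.2]
    have hle : ∀ l, ENNReal.ofReal (beta a b l ^ σ)
        * ‖-(Real.sin ((t - r) * dl a b α l) / dl a b α l : ℝ) * F r l‖ₑ
        ≤ ENNReal.ofReal (t - s) * (bw a b σ l * ‖F r l‖ₑ) := by
      intro l
      have hd := dl_pos a b α l
      rw [enorm_mul, mul_left_comm (ENNReal.ofReal (t - s)), enorm_neg]
      unfold bw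
      gcongr
      rw [← ofReal_norm, Complex.norm_real]
      apply ENNReal.ofReal_le_ofReal
      rw [Real.norm_eq_abs, abs_div, abs_of_pos hd, div_le_iff₀ hd]
      calc |Real.sin ((t - r) * dl a b α l)| ≤ |(t - r) * dl a b α l| := Real.abs_sin_le_abs
        _ = (t - r) * dl a b α l := abs_of_nonneg (by positivity)
        _ ≤ _ := by gcongr
    refine (l2_mono hle).trans ?_
    rw [l2_const_mul, mul_comm (ε ^ 2 * lipC a b σ R * (5 ^ σ * R)), ENNReal.ofReal_mul hts]
    gcongr
    exact h.l2_proj_fser hab h1 h2 hσ hε.le hε1 hR (hsub hr)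

/-- The nonlinearity along the solution and along the free wave. -/
lemma IsProfile.proj_fser_sub_le (h : IsProfile a b α σ ε S R ψ) (hab : a < b) (h1 : 1 < α)
    (h2 : α ≤ 2) (hσ : 1 < σ) (hε : 0 < ε) (hε1 : ε ≤ 1) (hR : 0 ≤ R) {s t : ℝ} (hs : 0 ≤ s)
    (hst : s ≤ t) (ht : t ≤ S) :
    l2 (fun l => bw a b σ l * ‖proj t (fser ε (wave a b α (ψ t))) l
        - proj t (fser ε (wave a b α (ψ s))) l‖ₑ)
      ≤ ENNReal.ofReal (ε ^ 4 * lipC a b σ R ^ 2 * (5 ^ σ * R) * (t - s) ^ 2) := by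
  have hL := lipC_pos a b σ R
  have hsm : s ∈ Icc 0 S := ⟨hs, hst.trans ht⟩
  have htm : t ∈ Icc 0 S := ⟨hs.trans hst, ht⟩
  have hws := summable_wave (a := a) (b := b) (α := α) (h.summable hab hσ hsm)
  have hwt := summable_wave (a := a) (b := b) (α := α) (h.summable hab hσ htm)
  have hes := summable_emb (summable_norm_proj t hws)
  have het := summable_emb (summable_norm_proj t hwt)
  have hb : ∀ r ∈ Icc 0 S, nw a b α σ (fun g => ‖emb (proj t (wave a b α (ψ r))) g‖ₑ)
      ≤ ENNReal.ofReal (5 ^ σ * R) := by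
    intro r hr
    rw [nw_emb a b h1]
    exact (l2_bw_enorm_proj_le a b α (by linarith) t _).trans (h.nw_wave h1 hσ hr)
  -- The comparison takes place at the single time t, through embedded spatial series. Comparing the
  -- space-time series directly would see only ψ(t) - ψ(s) and lose one power of t - s.
  have key := nw_fser_sub_le hab h1 h2 hσ hε.le hε1 (R := 5 ^ σ * R) (by positivity) het hes
    (hb t htm) (hb s hsm)
  have hemb : ∀ g, emb (proj t (wave a b α (ψ t))) g - emb (proj t (wave a b α (ψ s))) g
      = emb (fun l => proj t (wave a b α (ψ t)) l - proj t (wave a b α (ψ s)) l) g := by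
    intro g; unfold emb; split_ifs <;> simp
  simp only [hemb] at key
  rw [nw_emb a b h1] at key
  have hdiff : ∀ l, proj t (fser ε (wave a b α (ψ t))) l - proj t (fser ε (wave a b α (ψ s))) l
      = proj t (fun g => fser ε (emb (proj t (wave a b α (ψ t)))) g
        - fser ε (emb (proj t (wave a b α (ψ s)))) g) l := by
    intro l
    rw [proj_sub t (summable_norm_fser het ε) (summable_norm_fser hes ε),
      proj_fser_wave hab α t hε.ne' (h.summable hab hσ htm),
      proj_fser_wave hab α t hε.ne' (h.summable hab hσ hsm)]
  simp only [hdiff]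
  refine (l2_bw_enorm_proj_le a b α (by linarith) t _).trans (key.trans ?_)
  have e : ε ^ 4 * lipC a b σ R ^ 2 * (5 ^ σ * R) * (t - s) ^ 2
      = (ε ^ 2 * lipC a b σ R) * (ε ^ 2 * lipC a b σ R * (5 ^ σ * R) * (t - s) ^ 2) := by ring
  rw [e, ENNReal.ofReal_mul (p := ε ^ 2 * lipC a b σ R) (by positivity)]
  unfold lipC at *
  gcongr
  exact h.proj_wave_sub_le hab h1 h2 hσ hε hε1 hR hs hst ht

end

/-! ### The quadrature error of an oscillation -/

/-- The error of the midpoint rule for `e^{irΔ}` on `[0, τ]`. -/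
noncomputable def quadErr (τ Δ : ℝ) : ℂ :=
  (∫ r in (0 : ℝ)..τ, Complex.exp (Complex.I * ((r * Δ : ℝ) : ℂ)))
    - τ * Complex.exp (Complex.I * ((τ / 2 * Δ : ℝ) : ℂ))

lemma norm_quadErr_le {τ : ℝ} (hτ : 0 ≤ τ) (Δ : ℝ) : ‖quadErr τ Δ‖ ≤ 2 * τ := by
  unfold quadErr
  refine (norm_sub_le _ _).trans ?_
  rw [norm_mul, norm_exp_I_mul, Complex.norm_real, Real.norm_of_nonneg hτ, mul_one, two_mul]
  gcongr
  have := intervalIntegral.norm_integral_le_of_norm_le_const (a := 0) (b := τ) (C := 1)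
    (f := fun r : ℝ => Complex.exp (Complex.I * ((r * Δ : ℝ) : ℂ)))
    (fun r _ => (norm_exp_I_mul _).le)
  simpa [abs_of_nonneg hτ] using this

/-- Taylor's formula for |x| ≤ 1 and the bound 2 + |x| otherwise; the constant 3 serves both. -/
lemma norm_exp_I_sub_le (x : ℝ) :
    ‖Complex.exp (Complex.I * (x : ℂ)) - 1 - Complex.I * x‖ ≤ 3 * x ^ 2 := by
  have hn : ‖Complex.I * (x : ℂ)‖ = |x| := by simp
  rcases le_total |x| 1 with h | h
  · have := Complex.norm_exp_sub_one_sub_id_le (x := Complex.I * x) (by rwa [hn])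
    rw [hn, sq_abs] at this
    nlinarith [sq_nonneg x]
  · calc _ ≤ ‖Complex.exp (Complex.I * (x : ℂ))‖ + ‖(1 : ℂ)‖ + ‖Complex.I * (x : ℂ)‖ :=
          (norm_sub_le _ _).trans (by gcongr; exact norm_sub_le _ _)
      _ = 2 + |x| := by rw [norm_exp_I_mul, hn, norm_one]; norm_num
      _ ≤ 3 * |x| ^ 2 := by nlinarith
      _ = _ := by rw [sq_abs]

/-- The linear Taylor term at the midpoint integrates to zero by symmetry, so the quadratic
remainder alone is left. -/
lemma norm_quadErr_le_cube {τ : ℝ} (hτ : 0 ≤ τ) (Δ : ℝ) : ‖quadErr τ Δ‖ ≤ τ ^ 3 * Δ ^ 2 := by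
  have hint : quadErr τ Δ = Complex.exp (Complex.I * ((τ / 2 * Δ : ℝ) : ℂ)) *
      ∫ r in (0 : ℝ)..τ, (Complex.exp (Complex.I * (((r - τ / 2) * Δ : ℝ) : ℂ)) - 1
        - Complex.I * (((r - τ / 2) * Δ : ℝ) : ℂ)) := by
    have i1 : ∫ r in (0 : ℝ)..τ, (r - τ / 2) * Δ = 0 := by
      rw [intervalIntegral.integral_mul_const, intervalIntegral.integral_sub (by simp) (by simp)]
      simp
      left; ring
    rw [intervalIntegral.integral_sub, intervalIntegral.integral_sub,
      intervalIntegral.integral_const_mul, intervalIntegral.integral_ofReal, i1]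
    · rw [Complex.ofReal_zero, mul_zero, sub_zero, mul_sub,
        ← intervalIntegral.integral_const_mul]
      unfold quadErr
      congr 1
      · congr 1
        funext r
        rw [← Complex.exp_add]
        congr 1
        push_cast
        ring
      · simp; ring
    · exact Continuous.intervalIntegrable (by fun_prop) _ _
    · exact Continuous.intervalIntegrable (by fun_prop) _ _
    · exact Continuous.intervalIntegrable (by fun_prop) _ _
    · exact Continuous.intervalIntegrable (by fun_prop) _ _
  rw [hint, norm_mul, norm_exp_I_mul, one_mul]
  have := intervalIntegral.norm_integral_le_of_norm_le_const (a := 0) (b := τ)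
    (C := τ ^ 2 * Δ ^ 2)
    (f := fun r : ℝ => Complex.exp (Complex.I * (((r - τ / 2) * Δ : ℝ) : ℂ)) - 1
        - Complex.I * (((r - τ / 2) * Δ : ℝ) : ℂ)) (fun r hr => by
      rw [uIoc_of_le hτ] at hr
      refine (norm_exp_I_sub_le _).trans ?_
      rw [mul_pow]
      have : (r - τ / 2) ^ 2 ≤ τ ^ 2 / 4 := by nlinarith [hr.1, hr.2]
      have := mul_le_mul_of_nonneg_right this (sq_nonneg Δ)
      nlinarith [mul_nonneg (sq_nonneg τ) (sq_nonneg Δ)])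
  rw [sub_zero, abs_of_nonneg hτ] at this
  calc _ ≤ _ := this
    _ = _ := by ring

/-- The geometric mean of the trivial and the cubic bound. It needs only one power of the phase,
hence α/2 derivatives, and serves the crude ℓ¹ estimate. -/
lemma norm_quadErr_le_sq {τ : ℝ} (hτ : 0 ≤ τ) (Δ : ℝ) : ‖quadErr τ Δ‖ ≤ 2 * τ ^ 2 * |Δ| := by
  refine (pow_le_pow_iff_left₀ (norm_nonneg _) (by positivity) two_ne_zero).1 ?_
  calc ‖quadErr τ Δ‖ ^ 2 = ‖quadErr τ Δ‖ * ‖quadErr τ Δ‖ := sq _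
    _ ≤ (2 * τ) * (τ ^ 3 * Δ ^ 2) :=
        mul_le_mul (norm_quadErr_le hτ Δ) (norm_quadErr_le_cube hτ Δ) (norm_nonneg _)
          (by positivity)
    _ ≤ (2 * τ ^ 2 * |Δ|) ^ 2 := by
        rw [mul_pow, mul_pow, sq_abs]
        nlinarith [mul_nonneg (pow_nonneg hτ 4) (sq_nonneg Δ)]

/-- Summation by parts. -/
lemma norm_one_sub_mul_sum_le {z : ℂ} (hz : ‖z‖ = 1) (y : ℕ → ℂ) (n : ℕ) :
    ‖(1 - z) * ∑ k ∈ Finset.range n, z ^ k * y k‖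
      ≤ 2 * (‖y 0‖ + ∑ k ∈ Finset.range n, ‖y (k + 1) - y k‖) := by
  have h1 : ‖(1 - z) * ∑ k ∈ Finset.range n, z ^ k * y k + z ^ n * y n - y 0‖
      ≤ ∑ k ∈ Finset.range n, ‖y (k + 1) - y k‖ := by
    induction n with
    | zero => simp
    | succ n ih =>
      rw [Finset.sum_range_succ, Finset.sum_range_succ]
      have e : (1 - z) * (∑ k ∈ Finset.range n, z ^ k * y k + z ^ n * y n)
          + z ^ (n + 1) * y (n + 1) - y 0
          = ((1 - z) * ∑ k ∈ Finset.range n, z ^ k * y k + z ^ n * y n - y 0)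
            + z ^ (n + 1) * (y (n + 1) - y n) := by ring
      rw [e]
      refine (norm_add_le _ _).trans ?_
      gcongr
      rw [norm_mul, norm_pow, hz, one_pow, one_mul]
  have h2 : ‖y n‖ ≤ ‖y 0‖ + ∑ k ∈ Finset.range n, ‖y (k + 1) - y k‖ := by
    have := Finset.sum_range_sub y n
    calc ‖y n‖ = ‖y 0 + ∑ k ∈ Finset.range n, (y (k + 1) - y k)‖ := by rw [this]; ring_nf
      _ ≤ _ := (norm_add_le _ _).trans (by gcongr; exact norm_sum_le _ _)
  calc _ = ‖((1 - z) * ∑ k ∈ Finset.range n, z ^ k * y k + z ^ n * y n - y 0)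
        - z ^ n * y n + y 0‖ := by ring_nf
    _ ≤ ∑ k ∈ Finset.range n, ‖y (k + 1) - y k‖ + ‖y n‖ + ‖y 0‖ := by
        refine (norm_add_le _ _).trans ?_
        gcongr
        refine (norm_sub_le _ _).trans ?_
        gcongr
        rw [norm_mul, norm_pow, hz, one_pow, one_mul]
    _ ≤ _ := by linarith

/-- Regularity compensation: the oscillating sum of quadrature errors at one frequency. -/
lemma norm_sum_quadErr_le {a b α σ τ : ℝ} (h1 : 1 < α) (hσ : α / 2 ≤ σ) (hτ : 0 < τ)
    (g : Frq) (y : ℕ → ℂ) (n : ℕ) :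
    ‖∑ k ∈ Finset.range n, y k * Complex.exp (Complex.I * ((k * τ * (g.2 - dl a b α g.1) : ℝ) : ℂ))
        * quadErr τ (g.2 - dl a b α g.1)‖
      ≤ wt a b α σ g * (12 * τ ^ 2 * (‖y 0‖ + ∑ k ∈ Finset.range n, ‖y (k + 1) - y k‖)
        + 2 * τ * τ ^ (2 * σ / α) * ∑ k ∈ Finset.range n, ‖y k‖) := by
  set Δ := g.2 - dl a b α g.1 with hΔ
  set X := beta a b g.1 + |g.2| ^ (2 / α) with hX
  have hX1 : 1 ≤ X := by
    have := one_le_beta a b g.1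
    have : 0 ≤ |g.2| ^ (2 / α) := by positivity
    linarith
  have hX0 : 0 < X := by linarith
  have hΔX : |Δ| ≤ 3 * X ^ (α / 2) := abs_phase_le a b h1 g
  have hwt : wt a b α σ g = X ^ σ := rfl
  have hXσ : X ^ (α / 2) ≤ X ^ σ := Real.rpow_le_rpow_of_exponent_le hX1 hσ
  have hXp : 0 < X ^ σ := Real.rpow_pos_of_pos hX0 _
  rw [← Finset.sum_mul, norm_mul]
  set V := ‖y 0‖ + ∑ k ∈ Finset.range n, ‖y (k + 1) - y k‖ with hV
  have hV0 : 0 ≤ V := by positivity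
  set s := ∑ k ∈ Finset.range n, y k * Complex.exp (Complex.I * ((k * τ * Δ : ℝ) : ℂ)) with hs
  have hP : 0 < τ ^ (2 * σ / α) := Real.rpow_pos_of_pos hτ _
  have hY0 : 0 ≤ ∑ k ∈ Finset.range n, ‖y k‖ := by positivity
  rw [hwt]
  -- Up to the phase step π the factor |1 - e^{iτΔ}| is bounded below by a multiple of τ|Δ|. Beyond
  -- it resonances may occur and only the size of the weight helps.
  rcases le_or_gt (τ * |Δ|) Real.pi with hgood | hbad
  · have hmain : ‖s‖ * ‖quadErr τ Δ‖ ≤ X ^ σ * (12 * τ ^ 2 * V) := by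
      rcases eq_or_ne Δ 0 with h0 | h0
      · have : quadErr τ Δ = 0 := by
          have := norm_quadErr_le_cube hτ.le Δ
          rw [h0] at this ⊢
          simpa using this
        rw [this, norm_zero, mul_zero]
        positivity
      · set z := Complex.exp (Complex.I * ((τ * Δ : ℝ) : ℂ)) with hz
        have hzn : ‖z‖ = 1 := norm_exp_I_mul _
        have hsz : s = ∑ k ∈ Finset.range n, z ^ k * y k := by
          refine Finset.sum_congr rfl fun k _ => ?_
          rw [hz, ← Complex.exp_nat_mul, mul_comm]
          congr 2
          push_cast
          ring
        -- Jordan's inequality for |1 - z| = 2|sin(τΔ/2)|.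
        have h1z : 2 / Real.pi * (τ * |Δ|) ≤ ‖1 - z‖ := by
          rw [norm_sub_rev, hz, Complex.norm_exp_I_mul_ofReal_sub_one, norm_mul, Real.norm_eq_abs,
            Real.norm_eq_abs]
          have hab : |τ * Δ / 2| = τ * |Δ| / 2 := by
            rw [abs_div, abs_mul, abs_of_pos hτ]; norm_num
          have := Real.mul_abs_le_abs_sin (x := τ * Δ / 2) (by rw [hab]; linarith)
          rw [hab] at this
          rw [abs_of_pos (by norm_num : (0:ℝ) < 2)]
          linarith
        have hab := norm_one_sub_mul_sum_le hzn y n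
        rw [norm_mul, ← hsz, ← hV] at hab
        have hΔ0 : 0 < |Δ| := abs_pos.2 h0
        have hpi := Real.pi_pos
        have hs2 : 2 / Real.pi * (τ * |Δ|) * ‖s‖ ≤ 2 * V :=
          (mul_le_mul_of_nonneg_right h1z (norm_nonneg _)).trans hab
        have hs3 : τ * |Δ| * ‖s‖ ≤ Real.pi * V := by
          have := mul_le_mul_of_nonneg_left hs2 (by positivity : 0 ≤ Real.pi / 2)
          calc τ * |Δ| * ‖s‖ = Real.pi / 2 * (2 / Real.pi * (τ * |Δ|) * ‖s‖) := by field_simp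
            _ ≤ _ := this
            _ = _ := by ring
        calc ‖s‖ * ‖quadErr τ Δ‖ ≤ ‖s‖ * (τ ^ 3 * Δ ^ 2) := by
              gcongr; exact norm_quadErr_le_cube hτ.le Δ
          _ = τ ^ 2 * |Δ| * (τ * |Δ| * ‖s‖) := by rw [← sq_abs]; ring
          _ ≤ τ ^ 2 * |Δ| * (Real.pi * V) := by gcongr
          _ ≤ τ ^ 2 * (3 * X ^ σ) * (4 * V) := by
              gcongr
              · exact hΔX.trans (by gcongr)
              · exact Real.pi_le_four
          _ = _ := by ring
    refine hmain.trans ?_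
    gcongr
    have : 0 ≤ 2 * τ * τ ^ (2 * σ / α) * ∑ k ∈ Finset.range n, ‖y k‖ := by positivity
    linarith
  -- From π < τ|Δ| ≤ 3τX^{α/2} and π > 3 it follows that τX^{α/2} ≥ 1; the power 2σ/α of this is the
  -- claim.
  · have hone : 1 ≤ X ^ σ * τ ^ (2 * σ / α) := by
      have h3 : 1 ≤ τ * X ^ (α / 2) := by
        have : τ * |Δ| ≤ τ * (3 * X ^ (α / 2)) := by gcongr
        have := Real.pi_gt_three
        nlinarith
      have h4 : X ^ σ * τ ^ (2 * σ / α) = (τ * X ^ (α / 2)) ^ (2 * σ / α) := by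
        rw [Real.mul_rpow hτ.le (by positivity), ← Real.rpow_mul hX0.le]
        have : α / 2 * (2 * σ / α) = σ := by field_simp
        rw [this, mul_comm]
      rw [h4]
      exact Real.one_le_rpow h3 (by have : 0 < σ := by linarith
                                    positivity)
    have hsn : ‖s‖ ≤ ∑ k ∈ Finset.range n, ‖y k‖ := by
      refine (norm_sum_le _ _).trans (le_of_eq (Finset.sum_congr rfl fun k _ => ?_))
      rw [norm_mul, norm_exp_I_mul, mul_one]
    calc ‖s‖ * ‖quadErr τ Δ‖ ≤ (∑ k ∈ Finset.range n, ‖y k‖) * (2 * τ) := by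
          gcongr; exact norm_quadErr_le hτ.le Δ
      _ ≤ (X ^ σ * τ ^ (2 * σ / α)) * ((∑ k ∈ Finset.range n, ‖y k‖) * (2 * τ)) :=
          le_mul_of_one_le_left (by positivity) hone
      _ = X ^ σ * (2 * τ * τ ^ (2 * σ / α) * ∑ k ∈ Finset.range n, ‖y k‖) := by ring
      _ ≤ _ := by
          gcongr
          have : 0 ≤ 12 * τ ^ 2 * V := by positivity
          linarith


/-! ### One time step of the exact solution -/

/-- The integral of `e^{irΔ}` over `[t, s]`. -/
noncomputable def osc (t s Δ : ℝ) : ℂ :=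
  ∫ r in t..s, Complex.exp (Complex.I * ((r * Δ : ℝ) : ℂ))

lemma hasDerivAt_osc (t s Δ : ℝ) :
    HasDerivAt (fun s => osc t s Δ) (Complex.exp (Complex.I * ((s * Δ : ℝ) : ℂ))) s := by
  have hc : Continuous fun r : ℝ => Complex.exp (Complex.I * ((r * Δ : ℝ) : ℂ)) := by fun_prop
  exact (hc.integral_hasStrictDerivAt t s).hasDerivAt

/-- The second term is the midpoint value, which the scheme reproduces; the first is the quadrature
error with the phase e^{itΔ} that makes its sum over the steps oscillate. -/
lemma osc_eq (t τ Δ : ℝ) : osc t (t + τ) Δ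
    = Complex.exp (Complex.I * ((t * Δ : ℝ) : ℂ)) * quadErr τ Δ
      + τ * Complex.exp (Complex.I * (((t + τ / 2) * Δ : ℝ) : ℂ)) := by
  have h1 : osc t (t + τ) Δ = Complex.exp (Complex.I * ((t * Δ : ℝ) : ℂ)) *
      ∫ r in (0 : ℝ)..τ, Complex.exp (Complex.I * ((r * Δ : ℝ) : ℂ)) := by
    unfold osc
    rw [← intervalIntegral.integral_const_mul]
    have := intervalIntegral.integral_comp_add_right (a := 0) (b := τ)
      (fun r : ℝ => Complex.exp (Complex.I * ((r * Δ : ℝ) : ℂ))) t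
    rw [zero_add, add_comm τ t] at this
    rw [← this]
    congr 1
    funext r
    rw [← Complex.exp_add]
    congr 1
    push_cast
    ring
  have h2 : Complex.exp (Complex.I * (((t + τ / 2) * Δ : ℝ) : ℂ))
      = Complex.exp (Complex.I * ((t * Δ : ℝ) : ℂ))
        * Complex.exp (Complex.I * ((τ / 2 * Δ : ℝ) : ℂ)) := by
    rw [← Complex.exp_add]
    congr 1
    push_cast
    ring
  rw [h1, h2, quadErr]
  ring

lemma summable_slice {Y : Frq → ℂ} (hY : Summable fun g => ‖Y g‖) (l : ℤ × ℤ) :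
    Summable fun ω : ℝ => ‖Y (l, ω)‖ :=
  hY.comp_injective (i := fun ω : ℝ => (l, ω)) fun a b h => by simpa using h

lemma tsum_slice_exp (a b α : ℝ) (Y : Frq → ℂ) (s : ℝ) (l : ℤ × ℤ) :
    ∑' ω : ℝ, Y (l, ω) * Complex.exp (Complex.I * ((s * (ω - dl a b α l) : ℝ) : ℂ))
      = Complex.exp (Complex.I * ((-(s * dl a b α l) : ℝ) : ℂ)) * proj s Y l := by
  unfold proj
  rw [← tsum_mul_left]
  refine tsum_congr fun ω => ?_
  rw [mul_left_comm, ← Complex.exp_add]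
  congr 2
  push_cast
  ring

/-- Termwise differentiation, dominated by |Y|. The sum is thus the time integral of the
nonlinearity of a wave whose profile is frozen. -/
lemma hasDerivAt_tsum_osc {a b α : ℝ} {Y : Frq → ℂ} (hY : Summable fun g => ‖Y g‖) (t s : ℝ)
    (l : ℤ × ℤ) : HasDerivAt (fun s => ∑' ω : ℝ, Y (l, ω) * osc t s (ω - dl a b α l))
      (Complex.exp (Complex.I * ((-(s * dl a b α l) : ℝ) : ℂ)) * proj s Y l) s := by
  rw [← tsum_slice_exp]
  refine hasDerivAt_tsum (y₀ := t) (summable_slice hY l)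
    (fun ω y => (hasDerivAt_osc t y (ω - dl a b α l)).const_mul (Y (l, ω))) (fun ω y => ?_) ?_ s
  · rw [norm_mul, norm_exp_I_mul, mul_one]
  · simp [osc, summable_zero]

lemma tsum_osc_eq {a b α : ℝ} {Y : Frq → ℂ} (hY : Summable fun g => ‖Y g‖) (t : ℝ) {τ : ℝ}
    (hτ : 0 ≤ τ) (l : ℤ × ℤ) :
    ∑' ω : ℝ, Y (l, ω) * osc t (t + τ) (ω - dl a b α l)
      = ∑' ω : ℝ, Y (l, ω) * Complex.exp (Complex.I * ((t * (ω - dl a b α l) : ℝ) : ℂ))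
          * quadErr τ (ω - dl a b α l)
        + τ * (Complex.exp (Complex.I * ((-((t + τ / 2) * dl a b α l) : ℝ) : ℂ))
          * proj (t + τ / 2) Y l) := by
  have hs := summable_slice hY l
  rw [← tsum_slice_exp, ← tsum_mul_left, ← Summable.tsum_add]
  · refine tsum_congr fun ω => ?_
    rw [osc_eq]
    ring
  · refine Summable.of_norm_bounded (hs.mul_right (2 * τ)) fun ω => ?_
    rw [norm_mul, norm_mul, norm_exp_I_mul, mul_one]
    gcongr
    exact norm_quadErr_le hτ _
  · refine Summable.of_norm_bounded (hs.mul_left τ) fun ω => ?_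
    rw [norm_mul, norm_mul, norm_exp_I_mul, mul_one, Complex.norm_real, Real.norm_of_nonneg hτ]

/-- The exact solution over one time step, up to a quadrature error. -/
lemma IsProfile.step {a b α σ ε S R : ℝ} {ψ : ℝ → ℤ × ℤ → ℂ} (h : IsProfile a b α σ ε S R ψ)
    (hab : a < b) (h1 : 1 < α) (h2 : α ≤ 2) (hσ : 1 < σ) (hε : 0 < ε) (hε1 : ε ≤ 1) (hR : 0 ≤ R)
    {t τ : ℝ} (ht : 0 ≤ t) (hτ : 0 ≤ τ) (htS : t + τ ≤ S) :
    l2 (fun l => bw a b σ l * ‖(dl a b α l : ℂ) * (ψ (t + τ) l - ψ t l)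
        - Complex.I * ∑' ω : ℝ, fser ε (wave a b α (ψ t)) (l, ω)
          * osc t (t + τ) (ω - dl a b α l)‖ₑ)
      ≤ ENNReal.ofReal (ε ^ 4 * lipC a b σ R ^ 2 * (5 ^ σ * R) * τ ^ 3) := by
  have hL := lipC_pos a b σ R
  have hsub : Icc t (t + τ) ⊆ Icc 0 S := Icc_subset_Icc ht htS
  have htm : t ∈ Icc 0 S := hsub (left_mem_Icc.2 (by linarith))
  have hY := summable_norm_fser (summable_wave (a := a) (b := b) (α := α)
    (h.summable hab hσ htm)) ε
  -- The derivative of the discrepancy is the difference, at the same time r, of the nonlinearities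
  -- of the true and the frozen wave, of size ε⁴(r-t)². Integration over the step adds the third
  -- power of τ.
  have key := l2_weighted_sub_le (K := ε ^ 4 * lipC a b σ R ^ 2 * (5 ^ σ * R) * τ ^ 2)
    (g := fun r l => (dl a b α l : ℂ) * ψ r l - Complex.I *
      ∑' ω : ℝ, fser ε (wave a b α (ψ t)) (l, ω) * osc t r (ω - dl a b α l))
    (g' := fun r l => Complex.I * Complex.exp (Complex.I * ((-(r * dl a b α l) : ℝ) : ℂ))
      * (proj r (fser ε (wave a b α (ψ r))) l - proj r (fser ε (wave a b α (ψ t))) l))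
    (by linarith : t ≤ t + τ) (by positivity) (fun l => beta a b l ^ σ)
    (fun l => by have := beta_pos a b l; positivity) (fun l r hr => ?_) fun r hr => ?_
  · rw [add_sub_cancel_left, mul_assoc _ (τ ^ 2) τ, ← pow_succ] at key
    refine le_trans (le_of_eq ?_) key
    congr 1
    funext l
    simp only [osc, intervalIntegral.integral_same, mul_zero, tsum_zero, sub_zero]
    unfold bw
    congr 2
    ring
  · have d1 := (((h.deriv l r (hsub hr)).mono hsub).const_mul (dl a b α l : ℂ)).sub
      (((hasDerivAt_tsum_osc (a := a) (b := b) (α := α) hY t r l).const_mul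
        Complex.I).hasDerivWithinAt (s := Icc t (t + τ)))
    refine d1.congr_deriv ?_
    have hd := dl_ne_zero a b α l
    field_simp
  · simp only [enorm_mul, enorm_exp_I_mul]
    have hI : ‖Complex.I‖ₑ = 1 := by rw [← ofReal_norm]; simp
    simp only [hI, one_mul]
    refine (h.proj_fser_sub_le hab h1 h2 hσ hε hε1 hR ht hr.1 (hr.2.trans htS)).trans ?_
    apply ENNReal.ofReal_le_ofReal
    have : 0 ≤ r - t := by linarith [hr.1]
    have : r - t ≤ τ := by linarith [hr.2]
    gcongr

/-- The accumulated quadrature errors. -/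
noncomputable def quadSum (a b α τ : ℝ) (Y : ℕ → Frq → ℂ) (n : ℕ) (l : ℤ × ℤ) : ℂ :=
  ∑ k ∈ Finset.range n, ∑' ω : ℝ, Y k (l, ω)
    * Complex.exp (Complex.I * ((k * τ * (ω - dl a b α l) : ℝ) : ℂ)) * quadErr τ (ω - dl a b α l)

/-- Regularity compensation oscillation in `ℓ²`. -/
lemma l2_quadSum_le {a b α σ τ : ℝ} (h1 : 1 < α) (hσ : α / 2 ≤ σ) (hτ : 0 < τ) (Y : ℕ → Frq → ℂ)
    (hY : ∀ k, Summable fun g => ‖Y k g‖) (n : ℕ) :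
    l2 (fun l => ‖quadSum a b α τ Y n l‖ₑ)
      ≤ ENNReal.ofReal (12 * τ ^ 2) * (nw a b α σ (fun g => ‖Y 0 g‖ₑ)
          + ∑ k ∈ Finset.range n, nw a b α σ (fun g => ‖Y (k + 1) g - Y k g‖ₑ))
        + ENNReal.ofReal (2 * τ * τ ^ (2 * σ / α))
          * ∑ k ∈ Finset.range n, nw a b α σ (fun g => ‖Y k g‖ₑ) := by
  set A := ENNReal.ofReal (12 * τ ^ 2)
  set B := ENNReal.ofReal (2 * τ * τ ^ (2 * σ / α))
  have hpt : ∀ g : Frq, ‖∑ k ∈ Finset.range n, Y k g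
      * Complex.exp (Complex.I * ((k * τ * (g.2 - dl a b α g.1) : ℝ) : ℂ))
        * quadErr τ (g.2 - dl a b α g.1)‖ₑ
      ≤ ENNReal.ofReal (wt a b α σ g) * (A * (‖Y 0 g‖ₑ
        + ∑ k ∈ Finset.range n, ‖Y (k + 1) g - Y k g‖ₑ) + B * ∑ k ∈ Finset.range n, ‖Y k g‖ₑ) := by
    intro g
    have := norm_sum_quadErr_le (a := a) (b := b) h1 hσ hτ g (fun k => Y k g) n
    have hP : 0 < τ ^ (2 * σ / α) := Real.rpow_pos_of_pos hτ _
    rw [← ofReal_norm]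
    refine (ENNReal.ofReal_le_ofReal this).trans (le_of_eq ?_)
    rw [ENNReal.ofReal_mul (wt_pos _ _ _ _ _).le, ENNReal.ofReal_add (by positivity)
      (by positivity), ENNReal.ofReal_mul (by positivity), ENNReal.ofReal_mul (p := 2 * τ * _)
      (by positivity), ENNReal.ofReal_add (by positivity) (by positivity),
      ENNReal.ofReal_sum_of_nonneg (fun _ _ => norm_nonneg _),
      ENNReal.ofReal_sum_of_nonneg (fun _ _ => norm_nonneg _)]
    simp only [ofReal_norm]
    rfl
  have hle : ∀ l, ‖quadSum a b α τ Y n l‖ₑ ≤ fiber Prod.fst (fun g : Frq =>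
      ENNReal.ofReal (wt a b α σ g) * (A * (‖Y 0 g‖ₑ
        + ∑ k ∈ Finset.range n, ‖Y (k + 1) g - Y k g‖ₑ)
        + B * ∑ k ∈ Finset.range n, ‖Y k g‖ₑ)) l := by
    intro l
    have hs : ∀ k ∈ Finset.range n, Summable fun ω : ℝ => Y k (l, ω)
        * Complex.exp (Complex.I * ((k * τ * (ω - dl a b α l) : ℝ) : ℂ))
          * quadErr τ (ω - dl a b α l) := by
      intro k _
      refine Summable.of_norm_bounded ((summable_slice (hY k) l).mul_right (2 * τ)) fun ω => ?_
      rw [norm_mul, norm_mul, norm_exp_I_mul, mul_one]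
      gcongr
      exact norm_quadErr_le hτ.le _
    rw [quadSum, ← Summable.tsum_finsetSum hs, fiber_fst]
    refine enorm_tsum_le_tsum_enorm.trans (ENNReal.tsum_le_tsum fun ω => ?_)
    exact hpt (l, ω)
  have hnw : ∀ p r : Frq → ℝ≥0∞, nw a b α σ (fun g => p g + r g)
      ≤ nw a b α σ p + nw a b α σ r := by
    intro p r
    unfold nw
    simp only [mul_add]
    exact mixed_add_le _ _ _
  have hnws : ∀ F : ℕ → Frq → ℝ≥0∞, nw a b α σ (fun g => ∑ k ∈ Finset.range n, F k g)
      ≤ ∑ k ∈ Finset.range n, nw a b α σ (F k) := by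
    intro F
    unfold nw
    simp only [Finset.mul_sum]
    exact mixed_sum_le _ _ _
  have hnwc : ∀ (c : ℝ≥0∞) (p : Frq → ℝ≥0∞), nw a b α σ (fun g => c * p g)
      = c * nw a b α σ p := by
    intro c p
    unfold nw
    rw [← mixed_const_mul]
    congr 1
    funext g
    ring
  refine (l2_mono hle).trans ?_
  change nw a b α σ (fun g => A * (‖Y 0 g‖ₑ + ∑ k ∈ Finset.range n, ‖Y (k + 1) g - Y k g‖ₑ)
        + B * ∑ k ∈ Finset.range n, ‖Y k g‖ₑ) ≤ _
  refine (hnw _ _).trans ?_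
  rw [hnwc, hnwc]
  gcongr
  · exact (hnw _ _).trans (by gcongr; exact hnws _)
  · exact hnws _

/-- The quadrature error of one step in `ℓ¹`. -/
lemma tsum_quadErr_le {a b α m τ : ℝ} (h1 : 1 < α) (hm : 0 ≤ m) (hτ : 0 ≤ τ) (t : ℝ)
    (Y : Frq → ℂ) :
    ∑' l, ‖∑' ω : ℝ, Y (l, ω) * Complex.exp (Complex.I * ((t * (ω - dl a b α l) : ℝ) : ℂ))
        * quadErr τ (ω - dl a b α l)‖ₑ
      ≤ ENNReal.ofReal (6 * τ ^ 2) * (zl a b m * nw a b α (m + α / 2) (fun g => ‖Y g‖ₑ)) := by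
  have hpt : ∀ g : Frq, ‖Y g * Complex.exp (Complex.I * ((t * (g.2 - dl a b α g.1) : ℝ) : ℂ))
        * quadErr τ (g.2 - dl a b α g.1)‖ₑ
      ≤ ENNReal.ofReal (6 * τ ^ 2) * (bw a b (-m) g.1
        * (ENNReal.ofReal (wt a b α (m + α / 2) g) * ‖Y g‖ₑ)) := by
    intro g
    set X := beta a b g.1 + |g.2| ^ (2 / α) with hX
    have hb := beta_pos a b g.1
    have hbX : beta a b g.1 ≤ X := by
      have : 0 ≤ |g.2| ^ (2 / α) := by positivity
      linarith
    have hX0 : 0 < X := hb.trans_le hbX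
    rw [enorm_mul, enorm_mul, enorm_exp_I_mul, mul_one, mul_comm ‖Y g‖ₑ, ← mul_assoc, ← mul_assoc]
    gcongr
    unfold bw
    rw [← ENNReal.ofReal_mul (by positivity), ← ENNReal.ofReal_mul (by positivity), ← ofReal_norm]
    apply ENNReal.ofReal_le_ofReal
    have e : wt a b α (m + α / 2) g = X ^ m * X ^ (α / 2) := Real.rpow_add hX0 _ _
    rw [e]
    have hΔX := abs_phase_le a b h1 g
    rw [← hX] at hΔX
    -- The phase uses α/2 of the weight; the remaining power m dominates β^m, which pays for the
    -- passage from ℓ² to ℓ¹ by Cauchy–Schwarz.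
    have hone : 1 ≤ beta a b g.1 ^ (-m) * X ^ m := by
      rw [Real.rpow_neg hb.le, ← div_eq_inv_mul, one_le_div (Real.rpow_pos_of_pos hb _)]
      exact Real.rpow_le_rpow hb.le hbX hm
    calc ‖quadErr τ (g.2 - dl a b α g.1)‖ ≤ 2 * τ ^ 2 * |g.2 - dl a b α g.1| :=
          norm_quadErr_le_sq hτ _
      _ ≤ 2 * τ ^ 2 * (3 * X ^ (α / 2)) := by gcongr
      _ ≤ (2 * τ ^ 2 * (3 * X ^ (α / 2))) * (beta a b g.1 ^ (-m) * X ^ m) :=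
          le_mul_of_one_le_right (by positivity) hone
      _ = _ := by ring
  calc _ ≤ ∑' l, ∑' ω : ℝ, ENNReal.ofReal (6 * τ ^ 2) * (bw a b (-m) l
        * (ENNReal.ofReal (wt a b α (m + α / 2) (l, ω)) * ‖Y (l, ω)‖ₑ)) := by
        refine ENNReal.tsum_le_tsum fun l => enorm_tsum_le_tsum_enorm.trans ?_
        exact ENNReal.tsum_le_tsum fun ω => hpt (l, ω)
    _ = ENNReal.ofReal (6 * τ ^ 2) * ∑' l, bw a b (-m) l
        * ∑' ω : ℝ, ENNReal.ofReal (wt a b α (m + α / 2) (l, ω)) * ‖Y (l, ω)‖ₑ := by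
        simp only [ENNReal.tsum_mul_left]
    _ ≤ _ := by
        gcongr
        rw [nw_eq]
        exact tsum_mul_le_l2 _ _


/-! ### The discrete Fourier transform and aliasing. -/

/-- The residue class of a frequency modulo `N`. -/
def cls (N : ℕ) : ℤ × ℤ →+ ZMod N × ZMod N :=
  (Int.castAddHom (ZMod N)).prodMap (Int.castAddHom (ZMod N))

lemma cls_apply (N : ℕ) (j : ℤ × ℤ) : cls N j = ((j.1 : ZMod N), (j.2 : ZMod N)) := rfl

/-- A geometric sum of an N-th root of unity, which equals 1 exactly when N divides k. -/
lemma sum_mode1_grid {a b : ℝ} (hab : a < b) {N : ℕ} (hN : 0 < N) (k : ℤ) :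
    ∑ p ∈ Finset.range N, mode1 a b k (a + p * ((b - a) / N))
      = if (k : ZMod N) = 0 then (N : ℂ) else 0 := by
  have hba : (b - a : ℝ) ≠ 0 := (sub_pos.2 hab).ne'
  have hN' : (N : ℝ) ≠ 0 := by positivity
  have hNc : (N : ℂ) ≠ 0 := by exact_mod_cast hN.ne'
  set ζ : ℂ := Complex.exp (2 * Real.pi * Complex.I * (k / N)) with hζ
  have e : ∀ p : ℕ, mode1 a b k (a + p * ((b - a) / N)) = ζ ^ p := by
    intro p
    rw [hζ, ← Complex.exp_nat_mul, mode1]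
    congr 1
    have : freq a b k * (a + p * ((b - a) / N) - a) = p * (2 * Real.pi * (k / N)) := by
      unfold freq; field_simp; ring
    rw [this]; push_cast; ring
  simp_rw [e]
  have hdvd : (k : ZMod N) = 0 ↔ ζ = 1 := by
    rw [ZMod.intCast_zmod_eq_zero_iff_dvd, hζ, Complex.exp_eq_one_iff]
    constructor
    · rintro ⟨n, rfl⟩
      exact ⟨n, by push_cast; field_simp⟩
    · rintro ⟨n, hn⟩
      refine ⟨n, ?_⟩
      have hp : (2 * Real.pi * Complex.I : ℂ) ≠ 0 := Complex.two_pi_I_ne_zero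
      have : (k : ℂ) / N = n := by
        apply mul_left_cancel₀ hp; rw [hn]; ring
      rw [div_eq_iff hNc] at this
      have : (k : ℂ) = ((N * n : ℤ) : ℂ) := by rw [this]; push_cast; ring
      exact_mod_cast this
  split_ifs with h
  · rw [hdvd.1 h]; simp
  · have h1 : ζ ≠ 1 := fun h' => h (hdvd.2 h')
    rw [geom_sum_eq h1, hζ, ← Complex.exp_nat_mul]
    have : (N : ℂ) * (2 * Real.pi * Complex.I * (k / N)) = k * (2 * Real.pi * Complex.I) := by
      field_simp
    rw [this, Complex.exp_int_mul_two_pi_mul_I]; simp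

lemma sum_mode_grid {a b : ℝ} (hab : a < b) {N : ℕ} (hN : 0 < N) (j : ℤ × ℤ) :
    ∑ p ∈ Finset.range N, ∑ q ∈ Finset.range N, mode a b j.1 j.2 (gridPt a b N p q)
      = if cls N j = 0 then (N : ℂ) ^ 2 else 0 := by
  simp_rw [mode_eq, gridPt, ← Finset.mul_sum, ← Finset.sum_mul]
  rw [sum_mode1_grid hab hN, sum_mode1_grid hab hN]
  by_cases h1 : (j.1 : ZMod N) = 0 <;> by_cases h2 : (j.2 : ZMod N) = 0 <;>
    simp [cls_apply, h1, h2, sq]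

lemma dft_eq (a b : ℝ) (N : ℕ) (g : ℕ → ℕ → ℂ) (k l : ℤ) :
    dft a b N g k l = 1 / (N : ℂ) ^ 2 * ∑ p ∈ Finset.range N, ∑ q ∈ Finset.range N,
      g p q * mode a b (-k) (-l) (gridPt a b N p q) := by
  unfold dft
  simp_rw [mode_neg_eq]

lemma dft_congr (a b : ℝ) (N : ℕ) {g g' : ℕ → ℕ → ℂ} (h : ∀ p < N, ∀ q < N, g p q = g' p q)
    (k l : ℤ) : dft a b N g k l = dft a b N g' k l := by
  unfold dft
  congr 1
  refine Finset.sum_congr rfl fun p hp => Finset.sum_congr rfl fun q hq => ?_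
  rw [h p (Finset.mem_range.1 hp) q (Finset.mem_range.1 hq)]

lemma dft_add_mul (a b : ℝ) (N : ℕ) (g g' : ℕ → ℕ → ℂ) (c : ℂ) (k l : ℤ) :
    dft a b N (fun p q => g p q + c * g' p q) k l = dft a b N g k l + c * dft a b N g' k l := by
  unfold dft
  simp_rw [Finset.mul_sum, ← Finset.sum_add_distrib]
  refine Finset.sum_congr rfl fun p _ => Finset.sum_congr rfl fun q _ => ?_
  ring

lemma dft_conj (a b : ℝ) (N : ℕ) (g : ℕ → ℕ → ℂ) (k l : ℤ) :
    dft a b N (fun p q => (starRingEnd ℂ) (g p q)) k l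
      = (starRingEnd ℂ) (dft a b N g (-k) (-l)) := by
  simp_rw [dft_eq, map_mul, map_sum, map_mul, conj_mode]
  simp

open Classical in
/-- The aliasing operator: the sum over a residue class modulo `N`. -/
noncomputable def aliasSum (N : ℕ) (y : ℤ × ℤ → ℂ) (l : ℤ × ℤ) : ℂ :=
  ∑' j, if cls N j = cls N l then y j else 0

lemma enorm_aliasSum_le (N : ℕ) (y : ℤ × ℤ → ℂ) (l : ℤ × ℤ) :
    ‖aliasSum N y l‖ₑ ≤ fiber (cls N) (fun j => ‖y j‖ₑ) (cls N l) := by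
  unfold aliasSum fiber
  refine enorm_tsum_le_tsum_enorm.trans (ENNReal.tsum_le_tsum fun j => ?_)
  split_ifs <;> simp

lemma summable_aliasSum_term {y : ℤ × ℤ → ℂ} (hy : Summable fun j => ‖y j‖)
    (P : ℤ × ℤ → Prop) [DecidablePred P] : Summable fun j => if P j then y j else 0 := by
  refine Summable.of_norm_bounded hy fun j => ?_
  split_ifs <;> simp

/-- The aliasing formula: grid points do not distinguish frequencies congruent mod N, so by discrete
orthogonality a whole residue class is added up. -/
lemma dft_synth {a b : ℝ} (hab : a < b) {N : ℕ} (hN : 0 < N) {y : ℤ × ℤ → ℂ}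
    (hy : Summable fun j => ‖y j‖) (l : ℤ × ℤ) :
    dft a b N (fun p q => synth a b y (gridPt a b N p q)) l.1 l.2 = aliasSum N y l := by
  have hNc : (N : ℂ) ≠ 0 := by exact_mod_cast hN.ne'
  have hs : ∀ p q : ℕ, Summable fun j : ℤ × ℤ =>
      y j * mode a b (j - l).1 (j - l).2 (gridPt a b N p q) := fun p q =>
    summable_ev (χ := fun j : ℤ × ℤ => mode a b (j - l).1 (j - l).2 (gridPt a b N p q))
      (fun j => norm_mode _ _ _ _ _) hy
  rw [dft_eq]
  have e : ∀ p q : ℕ, synth a b y (gridPt a b N p q) * mode a b (-l.1) (-l.2) (gridPt a b N p q)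
      = ∑' j : ℤ × ℤ, y j * mode a b (j - l).1 (j - l).2 (gridPt a b N p q) := by
    intro p q
    rw [synth, ← tsum_mul_right]
    refine tsum_congr fun j => ?_
    rw [mul_assoc, ← mode_add]
    rfl
  simp_rw [e]
  have e2 : ∀ p : ℕ, ∑ q ∈ Finset.range N,
      ∑' j : ℤ × ℤ, y j * mode a b (j - l).1 (j - l).2 (gridPt a b N p q)
      = ∑' j : ℤ × ℤ, ∑ q ∈ Finset.range N,
        y j * mode a b (j - l).1 (j - l).2 (gridPt a b N p q) :=
    fun p => (Summable.tsum_finsetSum fun q _ => hs p q).symm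
  simp_rw [e2]
  rw [← Summable.tsum_finsetSum fun p _ => summable_sum fun q _ => hs p q, ← tsum_mul_left,
    aliasSum]
  refine tsum_congr fun j => ?_
  simp_rw [← Finset.mul_sum]
  rw [sum_mode_grid hab hN, map_sub]
  by_cases h : cls N j = cls N l
  · rw [if_pos (sub_eq_zero.2 h), if_pos h]; field_simp
  · rw [if_neg (fun h' => h (sub_eq_zero.1 h')), if_neg h]; simp

/-- The index set `T_N × T_N`. -/
noncomputable def box (N : ℕ) : Finset (ℤ × ℤ) := TN N ×ˢ TN N

/-- The truncation of a sequence to `T_N × T_N`. -/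
noncomputable def trunc (N : ℕ) (y : ℤ × ℤ → ℂ) (l : ℤ × ℤ) : ℂ := if l ∈ box N then y l else 0

lemma trunc_of_mem {N : ℕ} {l : ℤ × ℤ} (h : l ∈ box N) (y : ℤ × ℤ → ℂ) : trunc N y l = y l :=
  if_pos h

lemma trunc_of_notMem {N : ℕ} {l : ℤ × ℤ} (h : l ∉ box N) (y : ℤ × ℤ → ℂ) : trunc N y l = 0 :=
  if_neg h

lemma summable_norm_trunc (N : ℕ) (y : ℤ × ℤ → ℂ) : Summable fun j => ‖trunc N y j‖ :=
  summable_of_ne_finset_zero (s := box N) fun j hj => by rw [trunc_of_notMem hj, norm_zero]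

lemma synth_trunc (a b : ℝ) (N : ℕ) (y : ℤ × ℤ → ℂ) (z : ℝ × ℝ) :
    synth a b (trunc N y) z = ∑ k ∈ TN N, ∑ l ∈ TN N, y (k, l) * mode a b k l z := by
  rw [synth, tsum_eq_sum (s := box N) fun j hj => by rw [trunc_of_notMem hj, zero_mul], box,
    Finset.sum_product]
  refine Finset.sum_congr rfl fun k hk => Finset.sum_congr rfl fun l hl => ?_
  rw [trunc_of_mem (Finset.mem_product.2 ⟨hk, hl⟩)]

lemma interp_eq_synth (a b : ℝ) (N : ℕ) (g : ℕ → ℕ → ℂ) (z : ℝ × ℝ) :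
    interp a b N g z = synth a b (trunc N fun l => dft a b N g l.1 l.2) z := by
  rw [synth_trunc, interp]

lemma multiplier_eq_synth (a b : ℝ) (N : ℕ) (σ : ℤ → ℤ → ℂ) (g : ℕ → ℕ → ℂ) (p q : ℕ) :
    multiplier a b N σ g p q
      = synth a b (trunc N fun l => σ l.1 l.2 * dft a b N g l.1 l.2) (gridPt a b N p q) := by
  rw [synth_trunc, multiplier]

lemma cast_injOn_TN {N : ℕ} {k l : ℤ} (hk : k ∈ TN N) (hl : l ∈ TN N)
    (h : (k : ZMod N) = l) : k = l := by
  rw [TN, Finset.mem_Ico] at hk hl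
  rw [ZMod.intCast_eq_intCast_iff_dvd_sub] at h
  have hd : |l - k| < (N : ℤ) := by rw [abs_lt]; omega
  have := Int.eq_zero_of_abs_lt_dvd h hd
  omega

/-- Two elements of T_N differ by less than N. Hence each residue class has at most one
representative in the box, and sequences supported there are not altered by aliasing. -/
lemma cls_injOn_box (N : ℕ) : Set.InjOn (cls N) (box N) := by
  rintro ⟨k, l⟩ h ⟨k', l'⟩ h' he
  rw [Finset.mem_coe, box, Finset.mem_product] at h h'
  simp only [cls_apply, Prod.mk.injEq] at he
  exact Prod.ext (cast_injOn_TN h.1 h'.1 he.1) (cast_injOn_TN h.2 h'.2 he.2)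

lemma aliasSum_trunc {N : ℕ} (y : ℤ × ℤ → ℂ) {l : ℤ × ℤ} (hl : l ∈ box N) :
    aliasSum N (trunc N y) l = y l := by
  rw [aliasSum, tsum_eq_single l, if_pos rfl, trunc_of_mem hl]
  intro j hj
  split_ifs with h
  · by_cases hjb : j ∈ box N
    · exact absurd (cls_injOn_box N hjb hl h) hj
    · exact trunc_of_notMem hjb y
  · rfl

lemma dft_multiplier {a b : ℝ} (hab : a < b) {N : ℕ} (hN : 0 < N)
    (σ : ℤ → ℤ → ℂ) (g : ℕ → ℕ → ℂ) {l : ℤ × ℤ} (hl : l ∈ box N) :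
    dft a b N (multiplier a b N σ g) l.1 l.2 = σ l.1 l.2 * dft a b N g l.1 l.2 := by
  have : multiplier a b N σ g = fun p q => synth a b
      (trunc N fun l => σ l.1 l.2 * dft a b N g l.1 l.2) (gridPt a b N p q) := by
    funext p q; exact multiplier_eq_synth a b N σ g p q
  rw [this, dft_synth hab hN (summable_norm_trunc N _), aliasSum_trunc _ hl]

lemma gridPt_mem {a b : ℝ} (hab : a < b) {N p q : ℕ} (hp : p < N) (hq : q < N) :
    gridPt a b N p q ∈ Icc a b ×ˢ Icc a b := by
  have key : ∀ p : ℕ, p < N → a + p * ((b - a) / N) ∈ Icc a b := by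
    intro p hp
    have hN : (0 : ℝ) < N := by exact_mod_cast (Nat.zero_le p).trans_lt hp
    have h1 : (p : ℝ) / N ≤ 1 := by rw [div_le_one hN]; exact_mod_cast hp.le
    have h2 : 0 ≤ (p : ℝ) / N := by positivity
    have h3 : (p : ℝ) * ((b - a) / N) = p / N * (b - a) := by ring
    rw [h3]
    constructor <;> nlinarith
  exact ⟨key p hp, key q hq⟩

/-! ### The scheme in the rotating frame. -/

/-- The discrete Fourier coefficients of the numerical solution in the rotating frame. -/
noncomputable def numProfile (a b α ε τ : ℝ) (N : ℕ) (u₀ u₁ : ℝ × ℝ → ℝ) (n : ℕ) :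
    ℤ × ℤ → ℂ :=
  trunc N fun l => Complex.exp (Complex.I * ((-(n * τ * dl a b α l) : ℝ) : ℂ))
    * dft a b N (phiN a b α ε τ N u₀ u₁ n) l.1 l.2

section scheme
variable {a b α ε τ : ℝ} {N : ℕ} {u₀ u₁ : ℝ × ℝ → ℝ}

lemma summable_numProfile (n : ℕ) :
    Summable fun l => ‖numProfile a b α ε τ N u₀ u₁ n l‖ := summable_norm_trunc N _

lemma exp_mul_numProfile (n : ℕ) {l : ℤ × ℤ} (hl : l ∈ box N) :
    Complex.exp (Complex.I * ((n * τ * dl a b α l : ℝ) : ℂ)) * numProfile a b α ε τ N u₀ u₁ n l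
      = dft a b N (phiN a b α ε τ N u₀ u₁ n) l.1 l.2 := by
  rw [numProfile, trunc_of_mem hl, ← mul_assoc, exp_mul_exp_neg, one_mul]

lemma linStep_phiN (n p q : ℕ) :
    linStep a b α τ N (phiN a b α ε τ N u₀ u₁ n) p q
      = synth a b (fun l => Complex.exp (Complex.I * (((n * τ + τ / 2) * dl a b α l : ℝ) : ℂ))
        * numProfile a b α ε τ N u₀ u₁ n l) (gridPt a b N p q) := by
  rw [linStep, multiplier_eq_synth]
  congr 1
  funext l
  by_cases hl : l ∈ box N
  · rw [trunc_of_mem hl, ← exp_mul_numProfile n hl, ← mul_assoc, ← Complex.exp_add]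
    congr 2
    rw [dl]; push_cast; ring
  · rw [trunc_of_notMem hl, numProfile, trunc_of_notMem hl, mul_zero]

/-- After the half step the real part of the numerical solution is, on the grid, the free wave of
its profile at the midpoint nτ + τ/2. The discrete nonlinearity is thus a sample of the same series
as in the exact equation. -/
lemma nonlin_linStep_phiN (hε : ε ≠ 0) (n p q : ℕ) :
    (nonlin ε (linStep a b α τ N (phiN a b α ε τ N u₀ u₁ n) p q).re : ℂ)
      = synth a b (proj (n * τ + τ / 2) (fser ε (wave a b α (numProfile a b α ε τ N u₀ u₁ n))))
        (gridPt a b N p q) := by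
  have hw := summable_wave (a := a) (b := b) (α := α)
    (summable_numProfile (a := a) (b := b) (α := α) (ε := ε) (τ := τ) (N := N) (u₀ := u₀)
      (u₁ := u₁) n)
  rw [← ev_chr a b _ _ (summable_norm_fser hw ε)]
  rw [ev_fser (norm_chr a b _ _) (chr_add a b _ _) hw hε
    (r := (linStep a b α τ N (phiN a b α ε τ N u₀ u₁ n) p q).re)]
  rw [ev_wave _ _ _ _ _ (summable_numProfile n), linStep_phiN]

/-- Removing the rotation shows Strang splitting to be the midpoint rule for the profile equation,
with the nonlinearity replaced by its aliased version. -/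
lemma numProfile_succ (hab : a < b) (hN : 0 < N) (hε : ε ≠ 0) (n : ℕ)
    {l : ℤ × ℤ} (hl : l ∈ box N) :
    numProfile a b α ε τ N u₀ u₁ (n + 1) l = numProfile a b α ε τ N u₀ u₁ n l
      + τ * (Complex.I / dl a b α l
        * Complex.exp (Complex.I * ((-((n * τ + τ / 2) * dl a b α l) : ℝ) : ℂ))
        * aliasSum N (proj (n * τ + τ / 2)
          (fser ε (wave a b α (numProfile a b α ε τ N u₀ u₁ n)))) l) := by
  have hw := summable_wave (a := a) (b := b) (α := α)
    (summable_numProfile (a := a) (b := b) (α := α) (ε := ε) (τ := τ) (N := N) (u₀ := u₀)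
      (u₁ := u₁) n)
  have e1 : dft a b N (phiN a b α ε τ N u₀ u₁ (n + 1)) l.1 l.2
      = Complex.exp (Complex.I * ((τ * dl a b α l / 2 : ℝ) : ℂ))
        * (Complex.exp (Complex.I * ((τ * dl a b α l / 2 : ℝ) : ℂ))
            * dft a b N (phiN a b α ε τ N u₀ u₁ n) l.1 l.2
          + τ * (Complex.I / dl a b α l * aliasSum N (proj (n * τ + τ / 2)
          (fser ε (wave a b α (numProfile a b α ε τ N u₀ u₁ n)))) l)) := by
    rw [phiN, linStep, dft_multiplier hab hN _ _ hl]
    unfold nonlinStep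
    rw [dft_add_mul, dft_multiplier hab hN _ _ hl]
    simp_rw [nonlin_linStep_phiN hε]
    rw [dft_synth hab hN (summable_norm_proj _ (summable_norm_fser hw ε)), linStep,
      dft_multiplier hab hN _ _ hl]
    rfl
  conv_lhs => rw [numProfile, trunc_of_mem hl, e1, ← exp_mul_numProfile n hl]
  set c := numProfile a b α ε τ N u₀ u₁ n l
  set A := aliasSum N (proj (n * τ + τ / 2)
          (fser ε (wave a b α (numProfile a b α ε τ N u₀ u₁ n)))) l
  set d := dl a b α l
  have h1 : Complex.exp (Complex.I * ((-(((n + 1 : ℕ) : ℝ) * τ * d) : ℝ) : ℂ))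
      * Complex.exp (Complex.I * ((τ * d / 2 : ℝ) : ℂ))
      = Complex.exp (Complex.I * ((-((n * τ + τ / 2) * d) : ℝ) : ℂ)) := by
    rw [← Complex.exp_add]; congr 1; push_cast; ring
  have h2 : Complex.exp (Complex.I * ((-((n * τ + τ / 2) * d) : ℝ) : ℂ))
      * (Complex.exp (Complex.I * ((τ * d / 2 : ℝ) : ℂ))
        * Complex.exp (Complex.I * ((n * τ * d : ℝ) : ℂ))) = 1 := by
    rw [← Complex.exp_add, ← Complex.exp_add, ← Complex.exp_zero]; congr 1; push_cast; ring
  rw [← mul_assoc, h1]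
  linear_combination c * h2

end scheme


/-! ### Mixed norms under aliasing. -/

lemma fiber_comp_fst {Q : Type*} (κ : ℤ × ℤ → Q) (p : Frq → ℝ≥0∞) (q : Q) :
    fiber (fun g : Frq => κ g.1) p q = fiber κ (fun l => ∑' ω : ℝ, p (l, ω)) q := by
  unfold fiber
  rw [ENNReal.tsum_prod']
  refine tsum_congr fun l => ?_
  split_ifs <;> simp

lemma mixed_comp_fst {Q : Type*} (κ : ℤ × ℤ → Q) (p : Frq → ℝ≥0∞) :
    mixed (fun g : Frq => κ g.1) p = mixed κ (fun l => ∑' ω : ℝ, p (l, ω)) := by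
  unfold mixed
  rw [funext (fiber_comp_fst κ p)]

lemma mixed_comp_neg {Q : Type*} [AddCommGroup Q] (κ : ℤ × ℤ →+ Q) (p : ℤ × ℤ → ℝ≥0∞) :
    mixed κ (fun l => p (-l)) = mixed κ p := by
  unfold mixed
  rw [← l2_comp_equiv (Equiv.neg Q)]
  congr 1
  funext q
  unfold fiber
  rw [← (Equiv.neg (ℤ × ℤ)).tsum_eq]
  refine tsum_congr fun l => ?_
  have : κ (-l) = -q ↔ κ l = q := by rw [map_neg, neg_inj]
  rw [Equiv.neg_apply, Equiv.neg_apply]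
  beta_reduce
  rw [neg_neg]
  by_cases h : κ l = q
  · rw [if_pos h, if_pos (this.2 h)]
  · rw [if_neg h, if_neg fun h' => h (this.1 h')]

lemma mixed_wave_le {Q : Type*} [AddCommGroup Q] (κ : ℤ × ℤ →+ Q) (a b α : ℝ)
    (ψ : ℤ × ℤ → ℂ) :
    mixed (fun g : Frq => κ g.1) (fun g => ‖wave a b α ψ g‖ₑ) ≤ mixed κ (fun l => ‖ψ l‖ₑ) := by
  rw [mixed_comp_fst]
  have h : ∀ l, ∑' ω : ℝ, ‖wave a b α ψ (l, ω)‖ₑ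
      ≤ 2⁻¹ * ‖ψ l‖ₑ + 2⁻¹ * ‖ψ (-l)‖ₑ := by
    intro l
    simpa [ENNReal.div_eq_inv_mul] using tsum_wave_le a b α ψ l (fun _ => 1)
  refine (mixed_mono h).trans ((mixed_add_le _ _ _).trans ?_)
  rw [mixed_const_mul, mixed_const_mul, mixed_comp_neg κ (fun l => ‖ψ l‖ₑ), ← add_mul,
    ENNReal.inv_two_add_inv_two, one_mul]

/-- On each fibre the sum of squares is at most the square of the sum. -/
lemma l2_le_mixed {G Q : Type*} (κ : G → Q) (p : G → ℝ≥0∞) : l2 p ≤ mixed κ p := by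
  classical
  unfold mixed
  apply le_of_sq_le_sq
  rw [l2_sq, l2_sq]
  calc ∑' g, p g ^ 2 = ∑' g, ∑' q, (if κ g = q then p g ^ 2 else 0) := by
        refine tsum_congr fun g => ?_
        rw [tsum_eq_single (κ g) (fun q hq => if_neg hq.symm), if_pos rfl]
    _ = ∑' q, ∑' g, (if κ g = q then p g ^ 2 else 0) := ENNReal.tsum_comm
    _ ≤ ∑' q, fiber κ p q ^ 2 := by
        refine ENNReal.tsum_le_tsum fun q => ?_
        have : ∀ g, (if κ g = q then p g ^ 2 else 0)
            ≤ (if κ g = q then p g else 0) * fiber κ p q := by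
          intro g
          split_ifs with h
          · rw [sq]
            gcongr
            have := ENNReal.le_tsum (f := fun g => if κ g = q then p g else 0) g
            simpa [h, fiber] using this
          · simp
        refine (ENNReal.tsum_le_tsum this).trans ?_
        rw [ENNReal.tsum_mul_right, sq]
        gcongr
        exact (tsum_congr fun g => by congr).le

/-- With a trivial base group there is a single fibre. Stating the estimates for ρ ∘ `cls N` covers
both the ℓ¹ bootstrap (ρ = 0) and the energy estimate (ρ the identity). -/
lemma mixed_zero_hom {Q : Type*} [AddCommGroup Q] [Unique Q] (κ : ℤ × ℤ →+ Q)
    (p : ℤ × ℤ → ℝ≥0∞) : mixed κ p = ∑' l, p l := by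
  have h : fiber κ p = fun _ => ∑' l, p l := by
    funext q
    exact tsum_congr fun l => if_pos (Subsingleton.elim _ _)
  rw [mixed, h, l2, tsum_fintype, Fintype.sum_unique, ← ENNReal.rpow_natCast, ← ENNReal.rpow_mul]
  norm_num

open Classical in
/-- Aliasing does not increase the mixed norms. -/
lemma mixed_fiber_cls_le {N : ℕ} {Q : Type*} [AddCommGroup Q] (ρ : ZMod N × ZMod N →+ Q)
    (p : ℤ × ℤ → ℝ≥0∞) :
    mixed (ρ.comp (cls N)) (fun l => if l ∈ box N then fiber (cls N) p (cls N l) else 0)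
      ≤ mixed (ρ.comp (cls N)) p := by
  refine l2_mono fun q => ?_
  unfold fiber
  beta_reduce
  calc _ = ∑' l, ∑' j, (if ρ.comp (cls N) l = q ∧ l ∈ box N ∧ cls N j = cls N l
          then p j else 0) := by
        refine tsum_congr fun l => ?_
        by_cases h1 : ρ.comp (cls N) l = q <;> by_cases h2 : l ∈ box N
        · rw [if_pos h1, if_pos h2]
          refine tsum_congr fun j => ?_
          by_cases h3 : cls N j = cls N l
          · rw [if_pos h3, if_pos ⟨h1, h2, h3⟩]
          · rw [if_neg h3, if_neg fun h => h3 h.2.2]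
        · rw [if_pos h1, if_neg h2]
          exact (ENNReal.tsum_eq_zero.2 fun j => if_neg fun h => h2 h.2.1).symm
        all_goals
          rw [if_neg h1]
          exact (ENNReal.tsum_eq_zero.2 fun j => if_neg fun h => h1 h.1).symm
    _ = ∑' j, ∑' l, (if ρ.comp (cls N) l = q ∧ l ∈ box N ∧ cls N j = cls N l
          then p j else 0) := ENNReal.tsum_comm
    _ ≤ ∑' j, (if ρ.comp (cls N) j = q then p j else 0) := by
        refine ENNReal.tsum_le_tsum fun j => ?_
        -- Each j feeds only the representative of its class in the box, which lies in the same
        -- fibre as j because the map factors through residue classes.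
        by_cases hj : ∃ l, l ∈ box N ∧ cls N j = cls N l
        · obtain ⟨l, hl, hjl⟩ := hj
          rw [tsum_eq_single l]
          · split_ifs with h1 h2 h2
            · exact le_rfl
            · refine absurd ?_ h2
              rw [← h1.1, AddMonoidHom.comp_apply, hjl]; rfl
            · exact zero_le
            · exact le_rfl
          · intro l' hl'
            rw [if_neg]
            rintro ⟨-, h2, h3⟩
            exact hl' (cls_injOn_box N h2 hl (h3.symm.trans hjl))
        · have : ∀ l, (if ρ.comp (cls N) l = q ∧ l ∈ box N ∧ cls N j = cls N l
              then p j else 0) = 0 := fun l => if_neg fun h => hj ⟨l, h.2.1, h.2.2⟩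
          rw [tsum_congr this, tsum_zero]
          exact zero_le

lemma mixed_trunc_aliasSum_le {N : ℕ} {Q : Type*} [AddCommGroup Q] (ρ : ZMod N × ZMod N →+ Q)
    (x : ℤ × ℤ → ℂ) :
    mixed (ρ.comp (cls N)) (fun l => ‖trunc N (aliasSum N x) l‖ₑ)
      ≤ mixed (ρ.comp (cls N)) (fun l => ‖x l‖ₑ) := by
  refine (mixed_mono fun l => ?_).trans (mixed_fiber_cls_le ρ fun l => ‖x l‖ₑ)
  split_ifs with h
  · rw [trunc_of_mem h]; exact enorm_aliasSum_le N x l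
  · rw [trunc_of_notMem h]; simp

/-- The high-frequency part of a sequence. -/
noncomputable def off (N : ℕ) (y : ℤ × ℤ → ℂ) (l : ℤ × ℤ) : ℂ := if l ∈ box N then 0 else y l

lemma off_add_trunc (N : ℕ) (y : ℤ × ℤ → ℂ) (l : ℤ × ℤ) : off N y l + trunc N y l = y l := by
  unfold off trunc; split_ifs <;> simp

lemma enorm_off_le (N : ℕ) (y : ℤ × ℤ → ℂ) (l : ℤ × ℤ) : ‖off N y l‖ₑ ≤ ‖y l‖ₑ := by
  unfold off; split_ifs <;> simp

lemma enorm_trunc_le (N : ℕ) (y : ℤ × ℤ → ℂ) (l : ℤ × ℤ) : ‖trunc N y l‖ₑ ≤ ‖y l‖ₑ := by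
  unfold trunc; split_ifs <;> simp

lemma summable_norm_off (N : ℕ) {y : ℤ × ℤ → ℂ} (hy : Summable fun j => ‖y j‖) :
    Summable fun j => ‖off N y j‖ :=
  Summable.of_nonneg_of_le (fun _ => norm_nonneg _)
    (fun j => by unfold off; split_ifs <;> simp) hy

lemma aliasSum_add {N : ℕ} {x y : ℤ × ℤ → ℂ} (hx : Summable fun j => ‖x j‖)
    (hy : Summable fun j => ‖y j‖) (l : ℤ × ℤ) :
    aliasSum N (fun j => x j + y j) l = aliasSum N x l + aliasSum N y l := by
  classical
  unfold aliasSum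
  rw [← Summable.tsum_add]
  · exact tsum_congr fun j => by split_ifs <;> simp
  · exact (summable_aliasSum_term hx _)
  · exact (summable_aliasSum_term hy _)

lemma aliasSum_sub {N : ℕ} {x y : ℤ × ℤ → ℂ} (hx : Summable fun j => ‖x j‖)
    (hy : Summable fun j => ‖y j‖) (l : ℤ × ℤ) :
    aliasSum N (fun j => x j - y j) l = aliasSum N x l - aliasSum N y l := by
  classical
  unfold aliasSum
  rw [← Summable.tsum_sub]
  · exact tsum_congr fun j => by split_ifs <;> simp
  · exact (summable_aliasSum_term hx _)
  · exact (summable_aliasSum_term hy _)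

/-- The aliasing error comes from the part outside the box alone, so it inherits the decay of the
unresolved frequencies. -/
lemma aliasSum_eq {N : ℕ} {y : ℤ × ℤ → ℂ} (hy : Summable fun j => ‖y j‖) {l : ℤ × ℤ}
    (hl : l ∈ box N) : aliasSum N y l = y l + aliasSum N (off N y) l := by
  have h := aliasSum_add (N := N) (summable_norm_off N hy) (summable_norm_trunc N y) l
  simp_rw [off_add_trunc] at h
  rw [h, aliasSum_trunc y hl, add_comm]

lemma mixed_trunc_sub_aliasSum_le {N : ℕ} {Q : Type*} [AddCommGroup Q]
    (ρ : ZMod N × ZMod N →+ Q) {y : ℤ × ℤ → ℂ} (hy : Summable fun j => ‖y j‖) :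
    mixed (ρ.comp (cls N)) (fun l => ‖trunc N (fun l => y l - aliasSum N y l) l‖ₑ)
      ≤ mixed (ρ.comp (cls N)) (fun l => ‖off N y l‖ₑ) := by
  refine (mixed_mono fun l => ?_).trans (mixed_trunc_aliasSum_le ρ (off N y))
  by_cases hl : l ∈ box N
  · rw [trunc_of_mem hl, trunc_of_mem hl, aliasSum_eq hy hl, sub_add_cancel_left, enorm_neg]
  · rw [trunc_of_notMem hl, trunc_of_notMem hl]

/-- Consistency and stability of the discrete nonlinearity. -/
lemma mixed_trunc_nonlin_sub_le {a b α ε R : ℝ} {N : ℕ} {Q : Type*} [AddCommGroup Q]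
    (ρ : ZMod N × ZMod N →+ Q) (s : ℝ) {ψ c : ℤ × ℤ → ℂ} (hε : 0 ≤ ε) (hε1 : ε ≤ 1)
    (hR : 0 ≤ R) (hψ : Summable fun l => ‖ψ l‖) (hc : Summable fun l => ‖c l‖)
    (hψR : ∑' l, ‖ψ l‖ₑ ≤ ENNReal.ofReal R) (hcR : ∑' l, ‖c l‖ₑ ≤ ENNReal.ofReal R) :
    mixed (ρ.comp (cls N)) (fun l => ‖trunc N (fun l => proj s (fser ε (wave a b α ψ)) l
        - aliasSum N (proj s (fser ε (wave a b α c))) l) l‖ₑ)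
      ≤ mixed (ρ.comp (cls N)) (fun l => ‖off N (proj s (fser ε (wave a b α ψ))) l‖ₑ)
        + ENNReal.ofReal (ε ^ 2 * Real.exp R)
          * mixed (ρ.comp (cls N)) (fun l => ‖ψ l - c l‖ₑ) := by
  have hwψ := summable_wave (a := a) (b := b) (α := α) hψ
  have hwc := summable_wave (a := a) (b := b) (α := α) hc
  have hfψ := summable_norm_fser hwψ ε
  have hfc := summable_norm_fser hwc ε
  have hpψ := summable_norm_proj s hfψ
  have hpc := summable_norm_proj s hfc
  set P := proj s (fser ε (wave a b α ψ))
  set P' := proj s (fser ε (wave a b α c))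
  have h1 : ∀ l, ‖trunc N (fun l => P l - aliasSum N P' l) l‖ₑ
      ≤ ‖trunc N (fun l => P l - aliasSum N P l) l‖ₑ
        + ‖trunc N (aliasSum N fun l => P l - P' l) l‖ₑ := by
    intro l
    by_cases hl : l ∈ box N
    · rw [trunc_of_mem hl, trunc_of_mem hl, trunc_of_mem hl, aliasSum_sub hpψ hpc]
      refine le_trans (le_of_eq ?_) (enorm_add_le _ _)
      congr 1; ring
    · simp [trunc_of_notMem hl]
  refine (mixed_mono h1).trans ((mixed_add_le _ _ _).trans ?_)
  refine add_le_add (mixed_trunc_sub_aliasSum_le ρ hpψ)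
    ((mixed_trunc_aliasSum_le ρ _).trans ?_)
  have h2 : mixed (ρ.comp (cls N)) (fun l => ‖P l - P' l‖ₑ)
      ≤ mixed (fun g : Frq => ρ.comp (cls N) g.1)
        (fun g => ‖fser ε (wave a b α ψ) g - fser ε (wave a b α c) g‖ₑ) := by
    rw [mixed_comp_fst]
    refine mixed_mono fun l => ?_
    rw [← proj_sub s hfψ hfc]
    exact enorm_proj_le s _ l
  refine h2.trans ?_
  -- Only ℓ¹ bounds on the two profiles enter here; no Sobolev bound on the numerical solution is
  -- required.
  have h3 := (convNorm_mixed ((ρ.comp (cls N)).comp (AddMonoidHom.fst (ℤ × ℤ) ℝ))).fser_sub_le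
    (fun h => ENNReal.tsum_le_tsum h) hε hε1 hR hwψ hwc
    ((tsum_enorm_wave_le a b α ψ).trans hψR) ((tsum_enorm_wave_le a b α c).trans hcR)
  refine h3.trans ?_
  gcongr
  simp_rw [wave_sub]
  exact mixed_wave_le (ρ.comp (cls N)) a b α _


/-! ### Decay at unresolved frequencies. -/

lemma mem_box_of_lt {N : ℕ} (hN : Even N) {j : ℤ × ℤ} (h1 : 2 * |j.1| < N) (h2 : 2 * |j.2| < N) :
    j ∈ box N := by
  obtain ⟨k, rfl⟩ := hN
  rw [box, Finset.mem_product, TN, Finset.mem_Ico, Finset.mem_Ico]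
  have e1 := abs_lt.1 (by omega : |j.1| < (k : ℤ))
  have e2 := abs_lt.1 (by omega : |j.2| < (k : ℤ))
  push_cast
  omega

lemma mul_abs_ediv_le {N : ℕ} (hN : 0 < N) (j : ℤ) : N * |j / N| ≤ |j| + N := by
  have h1 := Int.emod_add_mul_ediv j N
  have h2 := Int.emod_nonneg j (b := (N : ℤ)) (by omega)
  have h3 := Int.emod_lt_of_pos j (b := (N : ℤ)) (by omega)
  have h4 : (N : ℤ) * |j / N| = |N * (j / N)| := by rw [abs_mul, Nat.abs_cast]
  rw [h4]
  have h5 : (N : ℤ) * (j / N) = j - j % N := by linarith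
  rw [h5]
  refine (abs_sub _ _).trans ?_
  rw [abs_of_nonneg h2]
  linarith

/-- Frequencies that are not resolved by the grid are large. -/
lemma le_beta_of_not_lt {a b : ℝ} (hab : a < b) {N : ℕ} (hN : 0 < N)
    {j : ℤ × ℤ} (hj : ¬(2 * |j.1| < (N : ℤ) ∧ 2 * |j.2| < (N : ℤ))) :
    2 * Real.pi / (7 * ((b - a) / N)) * (1 + |((j.1 / N : ℤ) : ℝ)| + |((j.2 / N : ℤ) : ℝ)|)
      ≤ beta a b j := by
  have hba : 0 < b - a := sub_pos.2 hab
  have hNr : (0 : ℝ) < N := by exact_mod_cast hN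
  have h0 : (N : ℤ) ≤ 2 * (|j.1| + |j.2|) := by
    by_contra! h
    have := abs_nonneg j.1
    have := abs_nonneg j.2
    exact hj ⟨by omega, by omega⟩
  have h1 := mul_abs_ediv_le hN j.1
  have h2 := mul_abs_ediv_le hN j.2
  -- The left side is at most |j₁| + |j₂| + 3N, and N ≤ 2(|j₁| + |j₂|) gives 7 = 1 + 3·2.
  have h3 : (N : ℤ) * (1 + |j.1 / N| + |j.2 / N|) ≤ 7 * (|j.1| + |j.2|) := by
    linarith
  have h4 : (N : ℝ) * (1 + |((j.1 / N : ℤ) : ℝ)| + |((j.2 / N : ℤ) : ℝ)|)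
      ≤ 7 * (|(j.1 : ℝ)| + |(j.2 : ℝ)|) := by exact_mod_cast h3
  have e : ∀ k : ℤ, |freq a b k| = 2 * Real.pi / (b - a) * |(k : ℝ)| := by
    intro k
    rw [freq, abs_div, abs_mul, abs_of_pos hba, abs_of_pos Real.two_pi_pos]; ring
  rw [beta, e, e]
  have hc : 0 < 2 * Real.pi / (7 * (b - a)) := by positivity
  have h5 := mul_le_mul_of_nonneg_left h4 hc.le
  calc _ = 2 * Real.pi / (7 * (b - a))
        * (N * (1 + |((j.1 / N : ℤ) : ℝ)| + |((j.2 / N : ℤ) : ℝ)|)) := by field_simp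
    _ ≤ _ := h5
    _ = 2 * Real.pi / (b - a) * |(j.1 : ℝ)| + 2 * Real.pi / (b - a) * |(j.2 : ℝ)| := by
      field_simp
    _ ≤ _ := by linarith

/-- For period 2π the frequencies are the integers themselves, so sums over the quotients j/N are
expressed by the constant `zl 0 (2π)`, which is independent of N. -/
lemma beta_two_pi (r : ℤ × ℤ) : beta 0 (2 * Real.pi) r = 1 + |(r.1 : ℝ)| + |(r.2 : ℝ)| := by
  have : ∀ k : ℤ, freq 0 (2 * Real.pi) k = k := fun k => by
    have := Real.pi_ne_zero
    unfold freq; field_simp; ring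
  rw [beta, this, this]

lemma beta_rpow_neg_le {a b : ℝ} (hab : a < b) {N : ℕ} (hN : 0 < N) {s : ℝ}
    (hs : 0 ≤ s) {j : ℤ × ℤ} (hj : ¬(2 * |j.1| < (N : ℤ) ∧ 2 * |j.2| < (N : ℤ))) :
    bw a b (-s) j ≤ ENNReal.ofReal ((7 * ((b - a) / N) / (2 * Real.pi)) ^ s)
      * bw 0 (2 * Real.pi) (-s) (j.1 / N, j.2 / N) := by
  have hba : 0 < b - a := sub_pos.2 hab
  have hNr : (0 : ℝ) < N := by exact_mod_cast hN
  have h := le_beta_of_not_lt hab hN hj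
  have hb := beta_pos 0 (2 * Real.pi) (j.1 / N, j.2 / N)
  rw [← beta_two_pi (j.1 / N, j.2 / N)] at h
  unfold bw
  rw [← ENNReal.ofReal_mul (by positivity)]
  refine ENNReal.ofReal_le_ofReal ?_
  have hc : 0 < 2 * Real.pi / (7 * ((b - a) / N)) := by positivity
  calc beta a b j ^ (-s)
      ≤ (2 * Real.pi / (7 * ((b - a) / N)) * beta 0 (2 * Real.pi) (j.1 / N, j.2 / N)) ^ (-s) :=
        Real.rpow_le_rpow_of_nonpos (by positivity) h (by linarith)
    _ = _ := by
        rw [Real.mul_rpow hc.le hb.le, Real.rpow_neg hc.le, ← Real.inv_rpow hc.le, inv_div]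

lemma eq_of_cls_eq_of_ediv_eq {N : ℕ} {j k : ℤ × ℤ} (h : cls N j = cls N k)
    (h1 : j.1 / N = k.1 / N) (h2 : j.2 / N = k.2 / N) : j = k := by
  rw [cls_apply, cls_apply, Prod.mk.injEq, ZMod.intCast_eq_intCast_iff',
    ZMod.intCast_eq_intCast_iff'] at h
  have e1 := Int.emod_add_mul_ediv j.1 N
  have e2 := Int.emod_add_mul_ediv k.1 N
  have e3 := Int.emod_add_mul_ediv j.2 N
  have e4 := Int.emod_add_mul_ediv k.2 N
  refine Prod.ext ?_ ?_
  · rw [← e1, ← e2, h.1, h1]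
  · rw [← e3, ← e4, h.2, h2]

/-- The constant in the estimate of the high frequencies. -/
noncomputable def offC (s : ℝ) : ℝ :=
  (7 / (2 * Real.pi)) ^ s * (zl 0 (2 * Real.pi) s).toReal

lemma offC_nonneg (s : ℝ) : 0 ≤ offC s := by unfold offC; positivity

/-- The part of a sequence at the frequencies that are not resolved by the grid. -/
noncomputable def high (N : ℕ) (y : ℤ × ℤ → ℂ) (l : ℤ × ℤ) : ℂ :=
  if 2 * |l.1| < (N : ℤ) ∧ 2 * |l.2| < (N : ℤ) then 0 else y l

lemma enorm_high_le (N : ℕ) (y : ℤ × ℤ → ℂ) (l : ℤ × ℤ) : ‖high N y l‖ₑ ≤ ‖y l‖ₑ := by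
  unfold high; split_ifs <;> simp

lemma enorm_off_le_high {N : ℕ} (hN2 : Even N) (y : ℤ × ℤ → ℂ) (l : ℤ × ℤ) :
    ‖off N y l‖ₑ ≤ ‖high N y l‖ₑ := by
  by_cases h : 2 * |l.1| < (N : ℤ) ∧ 2 * |l.2| < (N : ℤ)
  · simp [off, mem_box_of_lt hN2 h.1 h.2]
  · rw [high, if_neg h]; exact enorm_off_le N y l

/-- Cauchy–Schwarz within each residue class. Its members are told apart by their quotients r mod N,
and an unresolved one has β ≳ h⁻¹(1 + |r₁| + |r₂|); so the sum of β^{-2s} over the class is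
O(h^{2s}) uniformly for s > 1. The full power h^s is obtained although the norm is ℓ¹ on classes. -/
lemma mixed_high_le {a b : ℝ} (hab : a < b) {N : ℕ} (hN : 0 < N) {s : ℝ}
    (hs : 1 < s) (x : ℤ × ℤ → ℂ) :
    mixed (cls N) (fun l => ‖high N x l‖ₑ)
      ≤ ENNReal.ofReal (offC s * ((b - a) / N) ^ s) * l2 (fun l => bw a b s l * ‖x l‖ₑ) := by
  classical
  have hba : 0 < b - a := sub_pos.2 hab
  have hNr : (0 : ℝ) < N := by exact_mod_cast hN
  set c : ℝ≥0∞ := ENNReal.ofReal ((7 * ((b - a) / N) / (2 * Real.pi)) ^ s) with hc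
  have hcz : c * zl 0 (2 * Real.pi) s = ENNReal.ofReal (offC s * ((b - a) / N) ^ s) := by
    rw [← ENNReal.ofReal_toReal (zl_ne_top Real.two_pi_pos hs), hc,
      ← ENNReal.ofReal_mul (by positivity)]
    congr 1
    rw [offC, mul_div_right_comm, Real.mul_rpow (by positivity) (by positivity)]
    ring
  have key : ∀ q, fiber (cls N) (fun l => ‖high N x l‖ₑ) q
      ≤ c * zl 0 (2 * Real.pi) s
        * l2 (fun j => if cls N j = q then bw a b s j * ‖x j‖ₑ else 0) := by
    intro q
    have h1 : fiber (cls N) (fun l => ‖high N x l‖ₑ) q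
        ≤ ∑' j, (if cls N j = q ∧ ¬(2 * |j.1| < (N : ℤ) ∧ 2 * |j.2| < (N : ℤ)) then bw a b (-s) j else 0)
          * (if cls N j = q then bw a b s j * ‖x j‖ₑ else 0) := by
      unfold fiber
      refine ENNReal.tsum_le_tsum fun j => ?_
      by_cases h1 : cls N j = q
      · by_cases h2 : 2 * |j.1| < (N : ℤ) ∧ 2 * |j.2| < (N : ℤ)
        · simp [high, h2]
        · rw [if_pos h1, if_pos ⟨h1, h2⟩, if_pos h1, ← mul_assoc, bw_mul_bw, neg_add_cancel,
            bw_zero, one_mul]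
          exact enorm_high_le N x j
      · rw [if_neg h1]; exact zero_le
    refine h1.trans ((tsum_mul_le_l2 _ _).trans ?_)
    gcongr
    rw [zl, ← l2_const_mul]
    apply le_of_sq_le_sq
    rw [l2_sq, l2_sq]
    calc ∑' j, (if cls N j = q ∧ ¬(2 * |j.1| < (N : ℤ) ∧ 2 * |j.2| < (N : ℤ)) then bw a b (-s) j else 0) ^ 2
        ≤ ∑' j, ({j | cls N j = q} : Set (ℤ × ℤ)).indicator
            (fun j => (c * bw 0 (2 * Real.pi) (-s) (j.1 / N, j.2 / N)) ^ 2) j := by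
          refine ENNReal.tsum_le_tsum fun j => ?_
          by_cases h : cls N j = q ∧ ¬(2 * |j.1| < (N : ℤ) ∧ 2 * |j.2| < (N : ℤ))
          · rw [if_pos h, Set.indicator_of_mem (by exact h.1)]
            gcongr
            exact beta_rpow_neg_le hab hN (by linarith) h.2
          · rw [if_neg h]; simp
      _ = ∑' j : {j | cls N j = q},
            (c * bw 0 (2 * Real.pi) (-s) (j.1.1 / N, j.1.2 / N)) ^ 2 :=
          (tsum_subtype _ (fun j : ℤ × ℤ =>
            (c * bw 0 (2 * Real.pi) (-s) (j.1 / N, j.2 / N)) ^ 2)).symm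
      _ ≤ ∑' r : ℤ × ℤ, (c * bw 0 (2 * Real.pi) (-s) r) ^ 2 := by
          refine ENNReal.tsum_comp_le_tsum_of_injective
            (f := fun j : {j : ℤ × ℤ | cls N j = q} => ((j.1.1 / N, j.1.2 / N) : ℤ × ℤ)) ?_
            (fun r => (c * bw 0 (2 * Real.pi) (-s) r) ^ 2)
          rintro ⟨j, hj⟩ ⟨k, hk⟩ h
          rw [Prod.mk.injEq] at h
          exact Subtype.ext (eq_of_cls_eq_of_ediv_eq (Eq.trans hj (Eq.symm hk)) h.1 h.2)
  refine (l2_mono key).trans ?_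
  rw [l2_const_mul, hcz]
  refine mul_le_mul_right ?_ _
  apply le_of_sq_le_sq
  rw [l2_sq, l2_sq]
  simp_rw [l2_sq]
  rw [ENNReal.tsum_comm]
  refine ENNReal.tsum_le_tsum fun j => ?_
  rw [tsum_eq_single (cls N j) (fun q hq => by rw [if_neg hq.symm]; simp), if_pos rfl]

lemma mixed_off_le {a b : ℝ} (hab : a < b) {N : ℕ} (hN : 0 < N) (hN2 : Even N) {s : ℝ}
    (hs : 1 < s) (x : ℤ × ℤ → ℂ) :
    mixed (cls N) (fun l => ‖off N x l‖ₑ)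
      ≤ ENNReal.ofReal (offC s * ((b - a) / N) ^ s) * l2 (fun l => bw a b s l * ‖x l‖ₑ) :=
  (mixed_mono (enorm_off_le_high hN2 x)).trans (mixed_high_le hab hN hs x)

/-- Outside the box θ derivatives are traded for h^θ; the other s > 1 derivatives pay for the
embedding into ℓ¹. -/
lemma tsum_off_le {a b : ℝ} (hab : a < b) {N : ℕ} (hN : 0 < N) (hN2 : Even N) {s θ : ℝ}
    (hs : 1 < s) (hθ : 0 ≤ θ) (x : ℤ × ℤ → ℂ) :
    ∑' l, ‖off N x l‖ₑ ≤ ENNReal.ofReal ((7 / (2 * Real.pi)) ^ θ * (zl a b s).toReal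
        * ((b - a) / N) ^ θ) * l2 (fun l => bw a b (s + θ) l * ‖x l‖ₑ) := by
  have hba : 0 < b - a := sub_pos.2 hab
  have hNr : (0 : ℝ) < N := by exact_mod_cast hN
  set c : ℝ≥0∞ := ENNReal.ofReal ((7 * ((b - a) / N) / (2 * Real.pi)) ^ θ) with hc
  have hcz : zl a b s * c = ENNReal.ofReal ((7 / (2 * Real.pi)) ^ θ * (zl a b s).toReal
      * ((b - a) / N) ^ θ) := by
    rw [← ENNReal.ofReal_toReal (zl_ne_top hab hs), hc, ← ENNReal.ofReal_mul (by positivity),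
      ENNReal.toReal_ofReal (by positivity)]
    congr 1
    rw [mul_div_right_comm, Real.mul_rpow (by positivity) (by positivity)]
    ring
  refine (tsum_le_zl a b s _).trans ?_
  rw [← hcz, mul_assoc]
  refine mul_le_mul_right ?_ _
  rw [← l2_const_mul]
  refine l2_mono fun l => ?_
  by_cases hl : l ∈ box N
  · simp [off, hl]
  · have h1 := beta_rpow_neg_le hab hN hθ fun h => hl (mem_box_of_lt hN2 h.1 h.2)
    have h2 : bw 0 (2 * Real.pi) (-θ) (l.1 / N, l.2 / N) ≤ 1 := by
      rw [← bw_zero 0 (2 * Real.pi)]; exact bw_mono _ _ (by linarith) _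
    have h3 : bw a b (-θ) l ≤ c := h1.trans (mul_le_of_le_one_right' h2)
    calc bw a b s l * ‖off N x l‖ₑ = bw a b (-θ) l * (bw a b (s + θ) l * ‖off N x l‖ₑ) := by
          rw [← mul_assoc, bw_mul_bw]; congr 2; ring
      _ ≤ _ := by gcongr; exact enorm_off_le N x l

/-- The representative in T_N is the smallest of its class, since any other member is at distance at
least N from it. Hence aliasing never moves mass to a larger δ, and the δ-weighted mixed norm is not
increased either. -/
lemma abs_le_abs_of_cast_eq {N : ℕ} {k j : ℤ} (hk : k ∈ TN N) (h : (j : ZMod N) = k) :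
    |k| ≤ |j| := by
  rw [TN, Finset.mem_Ico] at hk
  rw [ZMod.intCast_eq_intCast_iff_dvd_sub] at h
  by_cases hjk : k = j
  · rw [hjk]
  · have hd : (N : ℤ) ≤ |k - j| := by
      refine Int.le_of_dvd (abs_pos.2 (sub_ne_zero.2 hjk)) ((dvd_abs _ _).2 h)
    have h1 := abs_sub k j
    have h2 : |k| ≤ (N : ℤ) / 2 := abs_le.2 ⟨hk.1, hk.2.le⟩
    omega

lemma dl_le_of_cls_eq {a b α : ℝ} (hab : a < b) (hα : 0 ≤ α) {N : ℕ} {l j : ℤ × ℤ}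
    (hl : l ∈ box N) (h : cls N j = cls N l) : dl a b α l ≤ dl a b α j := by
  rw [box, Finset.mem_product] at hl
  rw [cls_apply, cls_apply, Prod.mk.injEq] at h
  exact dl_le_of_abs_le hab hα (abs_le_abs_of_cast_eq hl.1 h.1) (abs_le_abs_of_cast_eq hl.2 h.2)

lemma enorm_dl_mul (a b α : ℝ) (l : ℤ × ℤ) (z : ℂ) :
    ‖(dl a b α l : ℂ) * z‖ₑ = ENNReal.ofReal (dl a b α l) * ‖z‖ₑ := by
  rw [enorm_mul]
  congr 1
  rw [← ofReal_norm, Complex.norm_real, Real.norm_of_nonneg (dl_pos a b α l).le]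

lemma mixed_dl_trunc_aliasSum_le {a b α : ℝ} (hab : a < b) (hα : 0 ≤ α) {N : ℕ} {Q : Type*}
    [AddCommGroup Q] (ρ : ZMod N × ZMod N →+ Q) (x : ℤ × ℤ → ℂ) :
    mixed (ρ.comp (cls N)) (fun l => ‖trunc N (fun l => dl a b α l * aliasSum N x l) l‖ₑ)
      ≤ mixed (ρ.comp (cls N)) (fun l => ‖dl a b α l * x l‖ₑ) := by
  classical
  refine (mixed_mono fun l => ?_).trans
    (mixed_fiber_cls_le ρ (fun l => ‖dl a b α l * x l‖ₑ))
  by_cases h : l ∈ box N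
  · rw [trunc_of_mem h, if_pos h, enorm_dl_mul]
    refine (mul_le_mul_right (enorm_aliasSum_le N x l) _).trans ?_
    unfold fiber
    rw [← ENNReal.tsum_mul_left]
    refine ENNReal.tsum_le_tsum fun j => ?_
    split_ifs with hj
    · beta_reduce
      rw [enorm_dl_mul]
      gcongr
      exact dl_le_of_cls_eq hab hα h hj
    · simp
  · rw [trunc_of_notMem h]; simp


/-- Each class meets the box in at most one point, so on truncated sequences the inner ℓ¹ norm is a
single term. Time errors may therefore be estimated in plain ℓ². -/
lemma mixed_trunc_le_l2 (N : ℕ) (x : ℤ × ℤ → ℂ) :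
    mixed (cls N) (fun l => ‖trunc N x l‖ₑ) ≤ l2 (fun l => ‖x l‖ₑ) := by
  classical
  apply le_of_sq_le_sq
  rw [mixed, l2_sq, l2_sq]
  have key : ∀ q, fiber (cls N) (fun l => ‖trunc N x l‖ₑ) q ^ 2
      ≤ ∑' l, if cls N l = q then ‖x l‖ₑ ^ 2 else 0 := by
    intro q
    by_cases h : ∃ l ∈ box N, cls N l = q
    · obtain ⟨l, hl, hq⟩ := h
      have : fiber (cls N) (fun l => ‖trunc N x l‖ₑ) q = ‖x l‖ₑ := by
        unfold fiber
        rw [tsum_eq_single l, if_pos hq]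
        · beta_reduce; rw [trunc_of_mem hl]
        intro j hj
        split_ifs with hjq
        · by_cases hjb : j ∈ box N
          · exact absurd (cls_injOn_box N hjb hl (hjq.trans hq.symm)) hj
          · beta_reduce; rw [trunc_of_notMem hjb]; simp
        · rfl
      rw [this]
      have := ENNReal.le_tsum (f := fun l => if cls N l = q then ‖x l‖ₑ ^ 2 else 0) l
      simpa [hq] using this
    · have : fiber (cls N) (fun l => ‖trunc N x l‖ₑ) q = 0 := by
        unfold fiber
        refine ENNReal.tsum_eq_zero.2 fun j => ?_
        split_ifs with hjq
        · beta_reduce; rw [trunc_of_notMem fun hjb => h ⟨j, hjb, hjq⟩]; simp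
        · rfl
      rw [this]; simp
  refine (ENNReal.tsum_le_tsum key).trans ?_
  rw [ENNReal.tsum_comm]
  refine ENNReal.tsum_le_tsum fun l => ?_
  rw [tsum_eq_single (cls N l) (fun q hq => if_neg hq.symm), if_pos rfl]

/-! ### The error recursion. -/

/-- The recursion of the splitting scheme in the rotating frame. -/
structure IsScheme (a b α ε τ : ℝ) (N : ℕ) (c : ℕ → ℤ × ℤ → ℂ) : Prop where
  supp : ∀ n, ∀ l ∉ box N, c n l = 0
  step : ∀ n, ∀ l ∈ box N, c (n + 1) l = c n l + τ * (Complex.I / dl a b α l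
    * Complex.exp (Complex.I * ((-((n * τ + τ / 2) * dl a b α l) : ℝ) : ℂ))
    * aliasSum N (proj (n * τ + τ / 2) (fser ε (wave a b α (c n)))) l)

lemma isScheme_numProfile {a b α ε τ : ℝ} {N : ℕ} {u₀ u₁ : ℝ × ℝ → ℝ} (hab : a < b) (hN : 0 < N)
    (hε : ε ≠ 0) : IsScheme a b α ε τ N (numProfile a b α ε τ N u₀ u₁) where
  supp _ _ hl := trunc_of_notMem hl _
  step n _ hl := numProfile_succ hab hN hε n hl

/-- The error of the scheme in the rotating frame, measured in the energy scaling. -/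
noncomputable def errSeq (a b α τ : ℝ) (ψ : ℝ → ℤ × ℤ → ℂ) (c : ℕ → ℤ × ℤ → ℂ) (n : ℕ)
    (l : ℤ × ℤ) : ℂ := dl a b α l * (ψ (n * τ) l - c n l)

/-- The part of the local error caused by freezing the profile. -/
noncomputable def freezeErr (a b α ε τ : ℝ) (ψ : ℝ → ℤ × ℤ → ℂ) (t : ℝ) (l : ℤ × ℤ) : ℂ :=
  dl a b α l * (ψ (t + τ) l - ψ t l)
    - Complex.I * ∑' ω : ℝ, fser ε (wave a b α (ψ t)) (l, ω) * osc t (t + τ) (ω - dl a b α l)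

/-- The difference of the exact and the discrete nonlinearities. -/
noncomputable def nonlinErr (a b α ε τ : ℝ) (N : ℕ) (ψ : ℝ → ℤ × ℤ → ℂ) (c : ℕ → ℤ × ℤ → ℂ)
    (n : ℕ) (l : ℤ × ℤ) : ℂ :=
  proj (n * τ + τ / 2) (fser ε (wave a b α (ψ (n * τ)))) l
    - aliasSum N (proj (n * τ + τ / 2) (fser ε (wave a b α (c n)))) l

section error
variable {a b α σ ε τ S R R₁ : ℝ} {N : ℕ} {ψ : ℝ → ℤ × ℤ → ℂ} {c : ℕ → ℤ × ℤ → ℂ}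

lemma IsScheme.summable (h : IsScheme a b α ε τ N c) (n : ℕ) : Summable fun l => ‖c n l‖ :=
  summable_of_ne_finset_zero (s := box N) fun l hl => by rw [h.supp n l hl, norm_zero]

/-- The exact step and the scheme both contain τ times a midpoint nonlinearity. Subtraction leaves
the freezing error, the oscillating quadrature error, and the difference of the two nonlinearities.
-/
lemma IsScheme.errSeq_succ (hc : IsScheme a b α ε τ N c) (hτ : 0 ≤ τ) (n : ℕ)
    (hψ : Summable fun l => ‖ψ (n * τ) l‖) {l : ℤ × ℤ} (hl : l ∈ box N) :
    errSeq a b α τ ψ c (n + 1) l = errSeq a b α τ ψ c n l + freezeErr a b α ε τ ψ (n * τ) l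
      + Complex.I * ∑' ω : ℝ, fser ε (wave a b α (ψ (n * τ))) (l, ω)
        * Complex.exp (Complex.I * ((n * τ * (ω - dl a b α l) : ℝ) : ℂ))
        * quadErr τ (ω - dl a b α l)
      + τ * (Complex.I * Complex.exp (Complex.I * ((-((n * τ + τ / 2) * dl a b α l) : ℝ) : ℂ))
        * nonlinErr a b α ε τ N ψ c n l) := by
  have hY := summable_norm_fser (summable_wave (a := a) (b := b) (α := α) hψ) ε
  have e1 : ((n + 1 : ℕ) : ℝ) * τ = n * τ + τ := by push_cast; ring
  have hd := dl_ne_zero a b α l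
  have hd' : (dl a b α l : ℂ) * (Complex.I / dl a b α l) = Complex.I := by field_simp
  rw [errSeq, errSeq, freezeErr, nonlinErr, hc.step n l hl, e1, tsum_osc_eq hY _ hτ]
  linear_combination (-(τ : ℂ)
    * Complex.exp (Complex.I * ((-((n * τ + τ / 2) * dl a b α l) : ℝ) : ℂ))
    * aliasSum N (proj (n * τ + τ / 2) (fser ε (wave a b α (c n)))) l) * hd'

lemma IsScheme.errSeq_eq (hc : IsScheme a b α ε τ N c) (hτ : 0 ≤ τ) (n : ℕ)
    (hψ : ∀ k < n, Summable fun l => ‖ψ (k * τ) l‖) {l : ℤ × ℤ} (hl : l ∈ box N) :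
    errSeq a b α τ ψ c n l = errSeq a b α τ ψ c 0 l
      + ∑ k ∈ Finset.range n, freezeErr a b α ε τ ψ (k * τ) l
      + Complex.I * quadSum a b α τ (fun k => fser ε (wave a b α (ψ (k * τ)))) n l
      + ∑ k ∈ Finset.range n, τ * (Complex.I
        * Complex.exp (Complex.I * ((-((k * τ + τ / 2) * dl a b α l) : ℝ) : ℂ))
        * nonlinErr a b α ε τ N ψ c k l) := by
  induction n with
  | zero => simp [quadSum]
  | succ n ih =>
    rw [hc.errSeq_succ hτ n (hψ n n.lt_succ_self) hl,
      ih fun k hk => hψ k (hk.trans n.lt_succ_self), Finset.sum_range_succ,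
      Finset.sum_range_succ, quadSum, quadSum, Finset.sum_range_succ]
    ring

lemma enorm_trunc_mono {x : ℤ × ℤ → ℂ} {p : ℝ≥0∞} {l : ℤ × ℤ}
    (h : l ∈ box N → ‖x l‖ₑ ≤ p) : ‖trunc N x l‖ₑ ≤ p := by
  by_cases hl : l ∈ box N
  · rw [trunc_of_mem hl]; exact h hl
  · rw [trunc_of_notMem hl]; simp

/-- The quadrature errors are kept as one sum inside the norm so that their cancellation over the
steps can be exploited; the other contributions are bounded step by step. The difference of profiles
is controlled by the energy error because δ ≥ 1. -/
lemma IsScheme.mixed_errSeq_le {Q : Type*} [AddCommGroup Q] (ρ : ZMod N × ZMod N →+ Q)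
    (hc : IsScheme a b α ε τ N c) (hτ : 0 ≤ τ) (hε : 0 ≤ ε) (hε1 : ε ≤ 1) (hR : 0 ≤ R₁) (n : ℕ)
    (hψ : ∀ k < n, Summable fun l => ‖ψ (k * τ) l‖)
    (hψR : ∀ k < n, ∑' l, ‖ψ (k * τ) l‖ₑ ≤ ENNReal.ofReal R₁)
    (hcR : ∀ k < n, ∑' l, ‖c k l‖ₑ ≤ ENNReal.ofReal R₁) :
    mixed (ρ.comp (cls N)) (fun l => ‖trunc N (errSeq a b α τ ψ c n) l‖ₑ)
      ≤ mixed (ρ.comp (cls N)) (fun l => ‖trunc N (errSeq a b α τ ψ c 0) l‖ₑ)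
        + ∑ k ∈ Finset.range n,
          mixed (ρ.comp (cls N)) (fun l => ‖trunc N (freezeErr a b α ε τ ψ (k * τ)) l‖ₑ)
        + mixed (ρ.comp (cls N)) (fun l => ‖trunc N
          (quadSum a b α τ (fun k => fser ε (wave a b α (ψ (k * τ)))) n) l‖ₑ)
        + ∑ k ∈ Finset.range n, ENNReal.ofReal τ *
          (mixed (ρ.comp (cls N)) (fun l =>
              ‖off N (proj (k * τ + τ / 2) (fser ε (wave a b α (ψ (k * τ))))) l‖ₑ)
            + ENNReal.ofReal (ε ^ 2 * Real.exp R₁)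
              * (mixed (ρ.comp (cls N)) (fun l => ‖off N (ψ (k * τ)) l‖ₑ)
                + mixed (ρ.comp (cls N)) (fun l => ‖trunc N (errSeq a b α τ ψ c k) l‖ₑ))) := by
  set κ := ρ.comp (cls N)
  have h1 : ∀ l, ‖trunc N (errSeq a b α τ ψ c n) l‖ₑ
      ≤ ‖trunc N (errSeq a b α τ ψ c 0) l‖ₑ
        + ∑ k ∈ Finset.range n, ‖trunc N (freezeErr a b α ε τ ψ (k * τ)) l‖ₑ
        + ‖trunc N (quadSum a b α τ (fun k => fser ε (wave a b α (ψ (k * τ)))) n) l‖ₑ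
        + ∑ k ∈ Finset.range n, ENNReal.ofReal τ * ‖trunc N (nonlinErr a b α ε τ N ψ c k) l‖ₑ := by
    intro l
    refine enorm_trunc_mono fun hl => ?_
    simp_rw [trunc_of_mem hl]
    rw [hc.errSeq_eq hτ n hψ hl]
    refine (enorm_add_le _ _).trans (add_le_add ((enorm_add_le _ _).trans (add_le_add
      ((enorm_add_le _ _).trans (add_le_add le_rfl (enorm_sum_le _ _))) ?_)) ?_)
    · rw [enorm_mul, show ‖Complex.I‖ₑ = 1 by simp [← ofReal_norm], one_mul]
    · refine (enorm_sum_le _ _).trans (Finset.sum_le_sum fun k _ => ?_)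
      rw [enorm_mul, enorm_mul, enorm_mul, enorm_exp_I_mul]
      simp [← ofReal_norm, abs_of_nonneg hτ]
  refine (mixed_mono h1).trans ((mixed_add_le _ _ _).trans (add_le_add
    ((mixed_add_le _ _ _).trans (add_le_add ((mixed_add_le _ _ _).trans
      (add_le_add le_rfl (mixed_sum_le _ _ _))) le_rfl))
    ((mixed_sum_le _ _ _).trans (Finset.sum_le_sum fun k hk => ?_))))
  have hk := Finset.mem_range.1 hk
  rw [mixed_const_mul]
  gcongr
  refine (mixed_trunc_nonlin_sub_le ρ _ hε hε1 hR (hψ k hk) (hc.summable k) (hψR k hk)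
    (hcR k hk)).trans ?_
  gcongr
  refine (mixed_mono fun l => ?_).trans (mixed_add_le _ _ _)
  by_cases hl : l ∈ box N
  · rw [trunc_of_mem hl, errSeq, enorm_dl_mul]
    refine le_trans ?_ le_add_self
    refine le_mul_of_one_le_left' ?_
    rw [← ENNReal.ofReal_one]
    exact ENNReal.ofReal_le_ofReal (one_le_dl a b α l)
  · rw [hc.supp k l hl, sub_zero, off, if_neg hl]
    exact le_self_add

end error

/-! ### Gronwall's lemma and boundedness of the numerical solution. -/

/-- The discrete Gronwall lemma. -/
lemma gronwall_sum {e : ℕ → ℝ≥0∞} {A q : ℝ≥0∞} {K : ℕ}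
    (h : ∀ n ≤ K, e n ≤ A + q * ∑ k ∈ Finset.range n, e k) :
    ∀ n ≤ K, e n ≤ A * (1 + q) ^ n := by
  have hg : ∀ n : ℕ, A + q * ∑ k ∈ Finset.range n, A * (1 + q) ^ k = A * (1 + q) ^ n := by
    intro n
    induction n with
    | zero => simp
    | succ n ih =>
      rw [Finset.sum_range_succ, mul_add, ← add_assoc, ih, pow_succ]; ring
  intro n
  induction n using Nat.strong_induction_on with
  | _ n ih =>
    intro hn
    refine (h n hn).trans ?_
    rw [← hg n]
    gcongr with k hk
    have hk := Finset.mem_range.1 hk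
    exact ih k hk (hk.le.trans hn)

/-- The discrete Gronwall lemma with a smallness condition. -/
lemma gronwall_sum_of_le_one {e : ℕ → ℝ≥0∞} {A q : ℝ≥0∞} {K : ℕ}
    (h : ∀ n ≤ K, (∀ k < n, e k ≤ 1) → e n ≤ A + q * ∑ k ∈ Finset.range n, e k)
    (hA : A * (1 + q) ^ K ≤ 1) : ∀ n ≤ K, e n ≤ 1 := by
  have hone : ∀ n ≤ K, A * (1 + q) ^ n ≤ 1 := fun n hn =>
    le_trans (by gcongr; exact le_self_add) hA
  intro n
  induction n using Nat.strong_induction_on with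
  | _ n ih =>
    intro hn
    have h1 : ∀ k < n, e k ≤ 1 := fun k hk => ih k hk (hk.le.trans hn)
    exact (gronwall_sum (K := n) (fun j hj => h j (hj.trans hn) fun k hk =>
      h1 k (hk.trans_le hj)) n le_rfl).trans (hone n hn)

lemma one_add_ofReal_pow_le {q B : ℝ} (hq : 0 ≤ q) {n : ℕ} (h : n * q ≤ B) :
    (1 + ENNReal.ofReal q) ^ n ≤ ENNReal.ofReal (Real.exp B) := by
  rw [← ENNReal.ofReal_one, ← ENNReal.ofReal_add zero_le_one hq, ← ENNReal.ofReal_pow (by linarith)]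
  refine ENNReal.ofReal_le_ofReal ?_
  calc (1 + q) ^ n ≤ Real.exp q ^ n := by
        gcongr; linarith [Real.add_one_le_exp q]
    _ = Real.exp (n * q) := by rw [← Real.exp_nat_mul]
    _ ≤ _ := Real.exp_le_exp.2 h


lemma ofReal_tsum_le_zl {a b s K : ℝ} (hab : a < b) (hs : 1 < s) {x : ℤ × ℤ → ℂ}
    (h : l2 (fun l => bw a b s l * ‖x l‖ₑ) ≤ ENNReal.ofReal K) :
    ∑' l, ‖x l‖ₑ ≤ ENNReal.ofReal ((zl a b s).toReal * K) := by
  rw [ENNReal.ofReal_mul ENNReal.toReal_nonneg, ENNReal.ofReal_toReal (zl_ne_top hab hs)]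
  exact (tsum_le_zl a b s _).trans (mul_le_mul_right h _)

lemma l2_bw_mono_of_le {a b s s' : ℝ} (h : s ≤ s') (x : ℤ × ℤ → ℂ) :
    l2 (fun l => bw a b s l * ‖x l‖ₑ) ≤ l2 (fun l => bw a b s' l * ‖x l‖ₑ) :=
  l2_mono fun l => by gcongr; exact bw_mono a b h l

section error
variable {a b α σ m ε τ S T B R R₀ R₁ X : ℝ} {N : ℕ} {ψ : ℝ → ℤ × ℤ → ℂ} {c : ℕ → ℤ × ℤ → ℂ}

/-- The bound on the nonlinearity along a profile, without the factor `ε²`. -/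
noncomputable def nonlinC (a b σ R : ℝ) : ℝ := lipC a b σ R * (5 ^ σ * R)

lemma nonlinC_nonneg (hR : 0 ≤ R) : 0 ≤ nonlinC a b σ R :=
  mul_nonneg (lipC_pos a b σ R).le (by positivity)

/-- B stands for the tail estimate and X for the accumulated time errors in the norm selected by ρ,
so both the ℓ¹ and the ℓ² argument can start from here. -/
lemma IsProfile.mixed_errSeq_le {Q : Type*} [AddCommGroup Q] (ρ : ZMod N × ZMod N →+ Q)
    (hP : IsProfile a b α σ ε S R ψ) (hc : IsScheme a b α ε τ N c) (hab : a < b) (h1 : 1 < α)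
    (h2 : α ≤ 2) (hσ : 1 < σ) (hmσ : m ≤ σ) (hτ : 0 ≤ τ) (hε : 0 < ε) (hε1 : ε ≤ 1) (hR : 0 ≤ R)
    (hB : 0 ≤ B) (hX : 0 ≤ X) (hR₀ : 0 ≤ R₀) (hR₁ : (zl a b σ).toReal * R ≤ R₁)
    (htail : ∀ x : ℤ × ℤ → ℂ, mixed (ρ.comp (cls N)) (fun l => ‖off N x l‖ₑ)
      ≤ ENNReal.ofReal B * l2 (fun l => bw a b m l * ‖x l‖ₑ))
    (hinit : mixed (ρ.comp (cls N)) (fun l => ‖trunc N (errSeq a b α τ ψ c 0) l‖ₑ)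
      ≤ ENNReal.ofReal (B * R₀)) (n : ℕ) (hn : n * τ ≤ S) (hnT : n * τ * ε ^ 2 ≤ T)
    (hquad : ∑ k ∈ Finset.range n,
          mixed (ρ.comp (cls N)) (fun l => ‖trunc N (freezeErr a b α ε τ ψ (k * τ)) l‖ₑ)
        + mixed (ρ.comp (cls N)) (fun l => ‖trunc N
          (quadSum a b α τ (fun k => fser ε (wave a b α (ψ (k * τ)))) n) l‖ₑ)
        ≤ ENNReal.ofReal X)
    (hcR : ∀ k < n, ∑' l, ‖c k l‖ₑ ≤ ENNReal.ofReal R₁) :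
    mixed (ρ.comp (cls N)) (fun l => ‖trunc N (errSeq a b α τ ψ c n) l‖ₑ)
      ≤ ENNReal.ofReal (B * (R₀ + T * nonlinC a b σ R + T * Real.exp R₁ * R) + X)
        + ENNReal.ofReal (τ * ε ^ 2 * Real.exp R₁) * ∑ k ∈ Finset.range n,
          mixed (ρ.comp (cls N)) (fun l => ‖trunc N (errSeq a b α τ ψ c k) l‖ₑ) := by
  have hR₁0 : 0 ≤ R₁ := le_trans (by positivity) hR₁
  have hL : 0 ≤ nonlinC a b σ R := nonlinC_nonneg hR
  have hT : 0 ≤ T := le_trans (by positivity) hnT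
  have hmem : ∀ k < n, (k : ℝ) * τ ∈ Icc 0 S := fun k hk =>
    ⟨by positivity, le_trans (by gcongr) hn⟩
  have hoffψ : ∀ k < n, mixed (ρ.comp (cls N)) (fun l => ‖off N (ψ (k * τ)) l‖ₑ)
      ≤ ENNReal.ofReal (B * R) := fun k hk => by
    rw [ENNReal.ofReal_mul hB]
    exact (htail _).trans (mul_le_mul_right
      ((l2_bw_mono_of_le hmσ _).trans (hP.bound _ (hmem k hk))) _)
  have hoffP : ∀ k < n, mixed (ρ.comp (cls N)) (fun l =>
      ‖off N (proj (k * τ + τ / 2) (fser ε (wave a b α (ψ (k * τ))))) l‖ₑ)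
      ≤ ENNReal.ofReal (B * (ε ^ 2 * nonlinC a b σ R)) := fun k hk => by
    rw [ENNReal.ofReal_mul hB]
    refine (htail _).trans (mul_le_mul_right ((l2_bw_mono_of_le hmσ _).trans
      ((l2_bw_enorm_proj_le a b α (by linarith) _ _).trans ?_)) _)
    refine (hP.nw_fser hab h1 h2 hσ hε.le hε1 hR (hmem k hk)).trans (le_of_eq ?_)
    rw [nonlinC, mul_assoc]
  refine (hc.mixed_errSeq_le ρ hτ hε.le hε1 hR₁0 n (fun k hk => hP.summable hab hσ (hmem k hk))
    (fun k hk => (ofReal_tsum_le_zl hab hσ (hP.bound _ (hmem k hk))).trans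
      (ENNReal.ofReal_le_ofReal hR₁)) hcR).trans ?_
  rw [add_assoc (mixed _ _)]
  set e := fun k => mixed (ρ.comp (cls N)) (fun l => ‖trunc N (errSeq a b α τ ψ c k) l‖ₑ)
  have hterm : ∀ k ∈ Finset.range n, ENNReal.ofReal τ *
          (mixed (ρ.comp (cls N)) (fun l =>
              ‖off N (proj (k * τ + τ / 2) (fser ε (wave a b α (ψ (k * τ))))) l‖ₑ)
            + ENNReal.ofReal (ε ^ 2 * Real.exp R₁)
              * (mixed (ρ.comp (cls N)) (fun l => ‖off N (ψ (k * τ)) l‖ₑ) + e k))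
      ≤ ENNReal.ofReal (τ * (B * (ε ^ 2 * nonlinC a b σ R) + ε ^ 2 * Real.exp R₁ * (B * R)))
        + ENNReal.ofReal (τ * ε ^ 2 * Real.exp R₁) * e k := by
    intro k hk
    have hk := Finset.mem_range.1 hk
    have e1 : ENNReal.ofReal (τ * ε ^ 2 * Real.exp R₁)
        = ENNReal.ofReal τ * ENNReal.ofReal (ε ^ 2 * Real.exp R₁) := by
      rw [mul_assoc, ENNReal.ofReal_mul hτ]
    rw [ENNReal.ofReal_mul hτ, ENNReal.ofReal_add (by positivity) (by positivity),
      ENNReal.ofReal_mul (p := ε ^ 2 * Real.exp R₁) (by positivity), e1, mul_assoc, ← mul_add,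
      add_assoc, ← mul_add]
    gcongr
    · exact hoffP k hk
    · exact hoffψ k hk
  refine (add_le_add (add_le_add hinit hquad) (Finset.sum_le_sum hterm)).trans ?_
  rw [Finset.sum_add_distrib, ← Finset.mul_sum, ← add_assoc]
  refine add_le_add ?_ le_rfl
  rw [Finset.sum_const, Finset.card_range, nsmul_eq_mul, ← ENNReal.ofReal_natCast,
    ← ENNReal.ofReal_mul (by positivity), ← ENNReal.ofReal_add (by positivity) hX,
    ← ENNReal.ofReal_add (by positivity) (by positivity)]
  refine ENNReal.ofReal_le_ofReal ?_
  -- Each step contributes a tail error of size τε²B; over times up to T/ε² this adds up to a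
  -- multiple of T B.
  have h3 : n * τ * ε ^ 2 * (B * nonlinC a b σ R + Real.exp R₁ * (B * R))
      ≤ T * (B * nonlinC a b σ R + Real.exp R₁ * (B * R)) := by gcongr
  nlinarith [h3]

/-- The rate constant of the growth of the error. -/
noncomputable def massC (a b σ R : ℝ) : ℝ := (zl a b σ).toReal * R + 1

/-- The constant in the `ℓ¹` bound of the error. -/
noncomputable def firstC (a b m σ T R R₀ : ℝ) : ℝ :=
  (7 / (2 * Real.pi)) ^ ((m - 1) / 2) * (zl a b ((m + 1) / 2)).toReal
      * (R₀ + T * nonlinC a b σ R + T * Real.exp (massC a b σ R) * R)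
    + (T * (zl a b σ).toReal * lipC a b σ R * nonlinC a b σ R
      + 6 * T * (zl a b m).toReal * nonlinC a b σ R)

lemma firstC_nonneg (hT : 0 ≤ T) (hR : 0 ≤ R) (hR₀ : 0 ≤ R₀) : 0 ≤ firstC a b m σ T R R₀ := by
  have := nonlinC_nonneg (a := a) (b := b) (σ := σ) hR
  have := (lipC_pos a b σ R).le
  unfold firstC; positivity

lemma tsum_enorm_le_of_errSeq {K : ℝ} (hc : IsScheme a b α ε τ N c) {n : ℕ}
    (hψ : ∑' l, ‖ψ (n * τ) l‖ₑ ≤ ENNReal.ofReal K) (hK : 0 ≤ K)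
    (h : ∑' l, ‖trunc N (errSeq a b α τ ψ c n) l‖ₑ ≤ 1) :
    ∑' l, ‖c n l‖ₑ ≤ ENNReal.ofReal (K + 1) := by
  rw [ENNReal.ofReal_add hK zero_le_one, ENNReal.ofReal_one]
  refine le_trans ?_ (add_le_add hψ h)
  rw [← ENNReal.tsum_add]
  refine ENNReal.tsum_le_tsum fun l => ?_
  by_cases hl : l ∈ box N
  · have e : c n l = ψ (n * τ) l - (ψ (n * τ) l - c n l) := by ring
    conv_lhs => rw [e]
    refine enorm_sub_le.trans (add_le_add le_rfl ?_)
    rw [trunc_of_mem hl, errSeq, enorm_dl_mul]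
    refine le_mul_of_one_le_left' ?_
    rw [← ENNReal.ofReal_one]
    exact ENNReal.ofReal_le_ofReal (one_le_dl a b α l)
  · rw [hc.supp n l hl]; simp

/-- The numerical solution stays bounded in `ℓ¹`. -/
lemma IsProfile.tsum_enorm_scheme_le (hP : IsProfile a b α (m + α / 2) ε S R ψ)
    (hc : IsScheme a b α ε τ N c) (hab : a < b) (h1 : 1 < α) (h2 : α ≤ 2) (hm : 1 < m)
    (hN : 0 < N) (hN2 : Even N) (hτ : 0 ≤ τ) (hτ1 : τ ≤ 1) (hε : 0 < ε) (hε1 : ε ≤ 1) (hR : 0 ≤ R)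
    (hR₀ : 0 ≤ R₀) (hST : S * ε ^ 2 ≤ T)
    (hinit : ∀ B : ℝ, 0 ≤ B → (∀ x : ℤ × ℤ → ℂ, ∑' l, ‖off N x l‖ₑ
        ≤ ENNReal.ofReal B * l2 (fun l => bw a b m l * ‖x l‖ₑ)) →
      ∑' l, ‖trunc N (errSeq a b α τ ψ c 0) l‖ₑ ≤ ENNReal.ofReal (B * R₀))
    (hsmall : firstC a b m (m + α / 2) T R R₀ * (τ + ((b - a) / N) ^ ((m - 1) / 2))
      * Real.exp (T * Real.exp (massC a b (m + α / 2) R)) ≤ 1)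
    (n : ℕ) (hn : n * τ ≤ S) :
    ∑' l, ‖c n l‖ₑ ≤ ENNReal.ofReal (massC a b (m + α / 2) R) := by
  set σ := m + α / 2 with hσdef
  have hσ : 1 < σ := by linarith
  have hmσ : m ≤ σ := by linarith
  have hba : 0 < b - a := sub_pos.2 hab
  have hNr : (0 : ℝ) < N := by exact_mod_cast hN
  have hL : 0 ≤ nonlinC a b σ R := nonlinC_nonneg hR
  have hlip := (lipC_pos a b σ R).le
  have hS : 0 ≤ S := le_trans (by positivity) hn
  have hT : 0 ≤ T := le_trans (by positivity) hST
  -- The split m = (m+1)/2 + (m-1)/2 leaves a first part above 1 for the ℓ¹ embedding and a positive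
  -- power of h for smallness.
  set θ := (m - 1) / 2 with hθ
  set B := (7 / (2 * Real.pi)) ^ θ * (zl a b ((m + 1) / 2)).toReal * ((b - a) / N) ^ θ with hBdef
  have hB : 0 ≤ B := by positivity
  -- The trivial base group turns the mixed norm into ℓ¹.
  set ρ : ZMod N × ZMod N →+ PUnit.{1} := 0
  have hF : ∀ p : ℤ × ℤ → ℝ≥0∞, mixed (ρ.comp (cls N)) p = ∑' l, p l := mixed_zero_hom _
  have htail : ∀ x : ℤ × ℤ → ℂ, ∑' l, ‖off N x l‖ₑ
      ≤ ENNReal.ofReal B * l2 (fun l => bw a b m l * ‖x l‖ₑ) := fun x => by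
    have := tsum_off_le hab hN hN2 (s := (m + 1) / 2) (θ := θ) (by linarith) (by linarith) x
    rwa [show (m + 1) / 2 + θ = m by rw [hθ]; ring] at this
  set X := τ * (T * (zl a b σ).toReal * lipC a b σ R * nonlinC a b σ R
      + 6 * T * (zl a b m).toReal * nonlinC a b σ R) with hXdef
  have hX : 0 ≤ X := by positivity
  have hψ1 : ∀ n : ℕ, (n : ℝ) * τ ≤ S →
      ∑' l, ‖ψ (n * τ) l‖ₑ ≤ ENNReal.ofReal ((zl a b σ).toReal * R) := fun n hn =>
    ofReal_tsum_le_zl hab hσ (hP.bound _ ⟨by positivity, hn⟩)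
  have hmono : ∀ k n : ℕ, k ≤ n → (n : ℝ) * τ ≤ S → (k : ℝ) * τ ≤ S := fun k n hk hn =>
    le_trans (by gcongr) hn
  have hmono' : ∀ k n : ℕ, k < n → (n : ℝ) * τ ≤ S → (k : ℝ) * τ + τ ≤ S := fun k n hk hn => by
    have := hmono (k + 1) n hk hn
    push_cast at this; linarith
  have hquad : ∀ n : ℕ, (n : ℝ) * τ ≤ S → ∑ k ∈ Finset.range n,
          mixed (ρ.comp (cls N)) (fun l => ‖trunc N (freezeErr a b α ε τ ψ (k * τ)) l‖ₑ)
        + mixed (ρ.comp (cls N)) (fun l => ‖trunc N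
          (quadSum a b α τ (fun k => fser ε (wave a b α (ψ (k * τ)))) n) l‖ₑ)
        ≤ ENNReal.ofReal X := by
    intro n hn
    have hnT : n * τ * ε ^ 2 ≤ T := le_trans (by gcongr) hST
    simp_rw [hF]
    have hfr : ∀ k ∈ Finset.range n, ∑' l, ‖trunc N (freezeErr a b α ε τ ψ (k * τ)) l‖ₑ
        ≤ ENNReal.ofReal ((zl a b σ).toReal * (ε ^ 4 * lipC a b σ R ^ 2 * (5 ^ σ * R) * τ ^ 3)) := by
      intro k hk
      refine (ENNReal.tsum_le_tsum fun l => enorm_trunc_le N _ l).trans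
        (ofReal_tsum_le_zl hab hσ ?_)
      exact hP.step hab h1 h2 hσ hε hε1 hR (by positivity) hτ
        (hmono' k n (Finset.mem_range.1 hk) hn)
    have hqu : ∑' l, ‖trunc N
          (quadSum a b α τ (fun k => fser ε (wave a b α (ψ (k * τ)))) n) l‖ₑ
        ≤ ∑ k ∈ Finset.range n, ENNReal.ofReal (6 * τ ^ 2 * ((zl a b m).toReal
          * (ε ^ 2 * lipC a b σ R * (5 ^ σ * R)))) := by
      refine (ENNReal.tsum_le_tsum fun l => (enorm_trunc_le N _ l).trans
        (enorm_sum_le _ _)).trans ?_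
      rw [Summable.tsum_finsetSum fun _ _ => ENNReal.summable]
      refine Finset.sum_le_sum fun k hk => ?_
      refine (tsum_quadErr_le (m := m) h1 (by linarith) hτ (k * τ) _).trans ?_
      rw [ENNReal.ofReal_mul (p := 6 * τ ^ 2) (by positivity),
        ENNReal.ofReal_mul ENNReal.toReal_nonneg, ENNReal.ofReal_toReal (zl_ne_top hab hm)]
      gcongr
      exact hP.nw_fser hab h1 h2 hσ hε.le hε1 hR ⟨by positivity,
        hmono k n (Finset.mem_range.1 hk).le hn⟩
    refine (add_le_add (Finset.sum_le_sum hfr) hqu).trans ?_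
    rw [← ENNReal.ofReal_sum_of_nonneg (fun _ _ => by positivity),
      ← ENNReal.ofReal_sum_of_nonneg (fun _ _ => by positivity),
      ← ENNReal.ofReal_add (by positivity) (by positivity)]
    refine ENNReal.ofReal_le_ofReal ?_
    simp only [Finset.sum_const, Finset.card_range, nsmul_eq_mul]
    have e1 : (n : ℝ) * ((zl a b σ).toReal * (ε ^ 4 * lipC a b σ R ^ 2 * (5 ^ σ * R) * τ ^ 3))
        = (n * τ * ε ^ 2) * ((zl a b σ).toReal * lipC a b σ R * nonlinC a b σ R)
          * (ε ^ 2 * τ ^ 2) := by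
      unfold nonlinC; ring
    have e2 : (n : ℝ) * (6 * τ ^ 2 * ((zl a b m).toReal
          * (ε ^ 2 * lipC a b σ R * (5 ^ σ * R))))
        = (n * τ * ε ^ 2) * (6 * (zl a b m).toReal * nonlinC a b σ R) * τ := by
      unfold nonlinC; ring
    have e3 : ε ^ 2 * τ ^ 2 ≤ τ := by
      have : ε ^ 2 ≤ 1 := pow_le_one₀ hε.le hε1
      nlinarith
    rw [e1, e2]
    calc _ ≤ T * ((zl a b σ).toReal * lipC a b σ R * nonlinC a b σ R) * τ
          + T * (6 * (zl a b m).toReal * nonlinC a b σ R) * τ := by gcongr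
      _ = X := by rw [hXdef]; ring
  set A := ENNReal.ofReal (B * (R₀ + T * nonlinC a b σ R + T * Real.exp (massC a b σ R) * R) + X)
  set q := τ * ε ^ 2 * Real.exp (massC a b σ R) with hq
  have hstep : ∀ j ≤ n, (∀ k < j, ∑' l, ‖trunc N (errSeq a b α τ ψ c k) l‖ₑ ≤ 1) →
      ∑' l, ‖trunc N (errSeq a b α τ ψ c j) l‖ₑ ≤ A + ENNReal.ofReal q
        * ∑ k ∈ Finset.range j, ∑' l, ‖trunc N (errSeq a b α τ ψ c k) l‖ₑ := by
    intro j hj hle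
    have hjS := hmono j n hj hn
    have := hP.mixed_errSeq_le (m := m) (B := B) (X := X) (R₀ := R₀) (R₁ := massC a b σ R)
      (T := T) ρ hc hab h1 h2 hσ hmσ hτ hε hε1 hR hB hX hR₀
      (by unfold massC; linarith) (fun x => by rw [hF]; exact htail x)
      (by rw [hF]; exact hinit B hB htail) j hjS (le_trans (by gcongr) hST) (hquad j hjS)
      (fun k hk => tsum_enorm_le_of_errSeq hc (hψ1 k (hmono k j hk.le hjS)) (by positivity)
        (hle k hk))
    simp_rw [hF] at this
    exact this
  have hfin : A * (1 + ENNReal.ofReal q) ^ n ≤ 1 := by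
    have hqT : (n : ℝ) * q ≤ T * Real.exp (massC a b σ R) := by
      have : n * τ * ε ^ 2 ≤ T := le_trans (by gcongr) hST
      calc (n : ℝ) * q = n * τ * ε ^ 2 * Real.exp (massC a b σ R) := by rw [hq]; ring
        _ ≤ _ := by gcongr
    refine (mul_le_mul_right (one_add_ofReal_pow_le (by positivity) hqT) _).trans ?_
    rw [← ENNReal.ofReal_mul (by positivity), ← ENNReal.ofReal_one]
    refine ENNReal.ofReal_le_ofReal (le_trans ?_ hsmall)
    gcongr
    rw [firstC, hXdef, hBdef]
    have hh : 0 ≤ ((b - a) / N) ^ θ := by positivity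
    set c1 := (7 / (2 * Real.pi)) ^ θ * (zl a b ((m + 1) / 2)).toReal
    set c2 := R₀ + T * nonlinC a b σ R + T * Real.exp (massC a b σ R) * R
    set c3 := T * (zl a b σ).toReal * lipC a b σ R * nonlinC a b σ R
      + 6 * T * (zl a b m).toReal * nonlinC a b σ R
    have h12 : 0 ≤ c1 * c2 := by positivity
    have h3 : 0 ≤ c3 := by positivity
    nlinarith [mul_nonneg h12 hτ, mul_nonneg h3 hh]
  -- Bootstrap: while earlier errors are at most 1 in ℓ¹, the numerical solution obeys the ℓ¹ bound
  -- under which the recursion holds, and the smallness condition then yields an error at most 1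
  -- again.
  exact tsum_enorm_le_of_errSeq hc (hψ1 n hn) (by positivity)
    (gronwall_sum_of_le_one hstep hfin n le_rfl)

end error


/-! ### The convergence rate in the energy norm. -/

section error
variable {a b α σ m ε τ S T B R R₀ R₁ X : ℝ} {N : ℕ} {ψ : ℝ → ℤ × ℤ → ℂ} {c : ℕ → ℤ × ℤ → ℂ}

/-- The nonlinearity varies slowly along a profile. -/
lemma IsProfile.nw_fser_sub (hP : IsProfile a b α σ ε S R ψ) (hab : a < b) (h1 : 1 < α)
    (h2 : α ≤ 2) (hσ : 1 < σ) (hε : 0 < ε) (hε1 : ε ≤ 1) (hR : 0 ≤ R) {s t : ℝ} (hs : 0 ≤ s)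
    (hst : s ≤ t) (ht : t ≤ S) :
    nw a b α σ (fun g => ‖fser ε (wave a b α (ψ t)) g - fser ε (wave a b α (ψ s)) g‖ₑ)
      ≤ ENNReal.ofReal (ε ^ 4 * lipC a b σ R * 5 ^ σ * nonlinC a b σ R * (t - s)) := by
  have hs' : s ∈ Icc 0 S := ⟨hs, hst.trans ht⟩
  have ht' : t ∈ Icc 0 S := ⟨hs.trans hst, ht⟩
  have hlip := (lipC_pos a b σ R).le
  have hL : 0 ≤ nonlinC a b σ R := nonlinC_nonneg hR
  refine (nw_fser_sub_le hab h1 h2 hσ hε.le hε1 (R := 5 ^ σ * R) (by positivity)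
    (summable_wave (hP.summable hab hσ ht')) (summable_wave (hP.summable hab hσ hs'))
    (hP.nw_wave h1 hσ ht') (hP.nw_wave h1 hσ hs')).trans ?_
  simp_rw [wave_sub]
  refine (mul_le_mul_right ((nw_wave_le a b h1 (by linarith) _).trans (mul_le_mul_right
    (hP.sub_le hab h1 h2 hσ hε.le hε1 hR hs hst ht) _)) _).trans ?_
  rw [← ENNReal.ofReal_mul (by positivity), ← ENNReal.ofReal_mul (by positivity)]
  refine ENNReal.ofReal_le_ofReal (le_of_eq ?_)
  rw [lipC, nonlinC, lipC]; ring

/-- The constants in the `ℓ²` bound of the error. -/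
noncomputable def secondC (a b α m T R R₀ : ℝ) : ℝ :=
  (offC m * (R₀ + T * nonlinC a b (m + α / 2) R
      + T * Real.exp (massC a b (m + α / 2) R) * R)
    + (T * lipC a b (m + α / 2) R * nonlinC a b (m + α / 2) R
      + 12 * (nonlinC a b (m + α / 2) R
        + T * lipC a b (m + α / 2) R * 5 ^ (m + α / 2) * nonlinC a b (m + α / 2) R))
    + 2 * T * nonlinC a b (m + α / 2) R)
    * Real.exp (T * Real.exp (massC a b (m + α / 2) R))

lemma secondC_nonneg (hT : 0 ≤ T) (hR : 0 ≤ R) (hR₀ : 0 ≤ R₀) : 0 ≤ secondC a b α m T R R₀ := by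
  have := nonlinC_nonneg (a := a) (b := b) (σ := m + α / 2) hR
  have := (lipC_pos a b (m + α / 2) R).le
  have := offC_nonneg m
  unfold secondC; positivity

/-- With nτε² ≤ T, the freezing errors nε⁴τ³ and the variation terms τ²·nε⁴τ are both O(ε²τ²), the
initial term of the summation by parts is O(ε²τ²) as well, and the resonant part nτε²·τ^{2σ/α} is
O(τ^{2σ/α}). -/
lemma IsProfile.freeze_add_quad_le (hP : IsProfile a b α σ ε S R ψ) (hab : a < b) (h1 : 1 < α)
    (h2 : α ≤ 2) (hσ : 1 < σ) (hτ : 0 < τ) (hε : 0 < ε) (hε1 : ε ≤ 1) (hR : 0 ≤ R)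
    (n : ℕ) (hn : n * τ ≤ S) (hnT : n * τ * ε ^ 2 ≤ T) :
    ∑ k ∈ Finset.range n,
          mixed (cls N) (fun l => ‖trunc N (freezeErr a b α ε τ ψ (k * τ)) l‖ₑ)
        + mixed (cls N) (fun l => ‖trunc N
          (quadSum a b α τ (fun k => fser ε (wave a b α (ψ (k * τ)))) n) l‖ₑ)
      ≤ ENNReal.ofReal ((T * lipC a b σ R * nonlinC a b σ R
        + 12 * (nonlinC a b σ R + T * lipC a b σ R * 5 ^ σ * nonlinC a b σ R)) * (ε ^ 2 * τ ^ 2)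
        + 2 * T * nonlinC a b σ R * τ ^ (2 * σ / α)) := by
  have hL : 0 ≤ nonlinC a b σ R := nonlinC_nonneg hR
  have hlip := (lipC_pos a b σ R).le
  have hT : 0 ≤ T := le_trans (by positivity) hnT
  have hmono : ∀ k : ℕ, k ≤ n → (k : ℝ) * τ ≤ S := fun k hk => le_trans (by gcongr) hn
  have hmono' : ∀ k : ℕ, k < n → (k : ℝ) * τ + τ ≤ S := fun k hk => by
    have := hmono (k + 1) hk
    push_cast at this; linarith
  have hfr : ∀ k ∈ Finset.range n,
      mixed (cls N) (fun l => ‖trunc N (freezeErr a b α ε τ ψ (k * τ)) l‖ₑ)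
      ≤ ENNReal.ofReal (ε ^ 4 * lipC a b σ R ^ 2 * (5 ^ σ * R) * τ ^ 3) := by
    intro k hk
    refine (mixed_trunc_le_l2 N _).trans (le_trans (l2_mono fun l => ?_)
      (hP.step hab h1 h2 hσ hε hε1 hR (by positivity) hτ.le (hmono' k (Finset.mem_range.1 hk))))
    exact le_mul_of_one_le_left' (one_le_bw a b (by linarith) l)
  have hnw : ∀ k ≤ n, nw a b α σ (fun g => ‖fser ε (wave a b α (ψ (k * τ))) g‖ₑ)
      ≤ ENNReal.ofReal (ε ^ 2 * nonlinC a b σ R) := by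
    intro k hk
    refine (hP.nw_fser hab h1 h2 hσ hε.le hε1 hR ⟨by positivity, hmono k hk⟩).trans (le_of_eq ?_)
    rw [nonlinC, mul_assoc]
  have hdiff : ∀ k ∈ Finset.range n, nw a b α σ (fun g =>
      ‖fser ε (wave a b α (ψ ((k + 1 : ℕ) * τ))) g - fser ε (wave a b α (ψ (k * τ))) g‖ₑ)
      ≤ ENNReal.ofReal (ε ^ 4 * lipC a b σ R * 5 ^ σ * nonlinC a b σ R * τ) := by
    intro k hk
    refine (hP.nw_fser_sub hab h1 h2 hσ hε hε1 hR (s := k * τ) (t := (k + 1 : ℕ) * τ)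
      (by positivity) (by push_cast; nlinarith) (hmono _ (Finset.mem_range.1 hk))).trans
      (le_of_eq ?_)
    congr 2; push_cast; ring
  have hqu : mixed (cls N) (fun l => ‖trunc N
      (quadSum a b α τ (fun k => fser ε (wave a b α (ψ (k * τ)))) n) l‖ₑ)
      ≤ ENNReal.ofReal (12 * τ ^ 2) * (ENNReal.ofReal (ε ^ 2 * nonlinC a b σ R)
          + ∑ k ∈ Finset.range n,
            ENNReal.ofReal (ε ^ 4 * lipC a b σ R * 5 ^ σ * nonlinC a b σ R * τ))
        + ENNReal.ofReal (2 * τ * τ ^ (2 * σ / α))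
          * ∑ k ∈ Finset.range n, ENNReal.ofReal (ε ^ 2 * nonlinC a b σ R) := by
    refine (mixed_trunc_le_l2 N _).trans ?_
    -- The profile is controlled only on [0, S]; stopping the index at n gives summability for every
    -- k without changing the terms that occur.
    set Y : ℕ → Frq → ℂ := fun k => fser ε (wave a b α (ψ ((min k n : ℕ) * τ))) with hYdef
    have hYk : ∀ k ≤ n, Y k = fser ε (wave a b α (ψ (k * τ))) := fun k hk => by
      rw [hYdef]; beta_reduce; rw [min_eq_left hk]
    have hY : ∀ k, Summable fun g => ‖Y k g‖ := fun k => summable_norm_fser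
      (summable_wave (hP.summable hab hσ ⟨by positivity, hmono _ (min_le_right k n)⟩)) ε
    have e : quadSum a b α τ (fun k => fser ε (wave a b α (ψ (k * τ)))) n
        = quadSum a b α τ Y n := by
      funext l
      unfold quadSum
      refine Finset.sum_congr rfl fun k hk => ?_
      rw [hYk k (Finset.mem_range.1 hk).le]
    rw [e]
    refine (l2_quadSum_le (σ := σ) h1 (by linarith) hτ Y hY n).trans ?_
    gcongr with k hk k hk
    · rw [hYk 0 (Nat.zero_le _)]; exact hnw 0 (Nat.zero_le _)
    · rw [hYk k (Finset.mem_range.1 hk).le, hYk (k + 1) (Finset.mem_range.1 hk)]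
      exact hdiff k hk
    · rw [hYk k (Finset.mem_range.1 hk).le]
      exact hnw k (Finset.mem_range.1 hk).le
  refine (add_le_add (Finset.sum_le_sum hfr) hqu).trans ?_
  have hτp : 0 ≤ τ ^ (2 * σ / α) := by positivity
  simp only [Finset.sum_const, Finset.card_range, nsmul_eq_mul]
  simp only [← ENNReal.ofReal_natCast]
  rw [← ENNReal.ofReal_mul (by positivity), ← ENNReal.ofReal_mul (by positivity),
    ← ENNReal.ofReal_mul (p := (n : ℝ)) (by positivity),
    ← ENNReal.ofReal_add (by positivity) (by positivity),
    ← ENNReal.ofReal_mul (p := 12 * τ ^ 2) (by positivity),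
    ← ENNReal.ofReal_mul (p := 2 * τ * τ ^ (2 * σ / α)) (by positivity),
    ← ENNReal.ofReal_add (by positivity) (by positivity),
    ← ENNReal.ofReal_add (by positivity) (by positivity)]
  refine ENNReal.ofReal_le_ofReal ?_
  have hε2 : ε ^ 2 ≤ 1 := pow_le_one₀ hε.le hε1
  calc _ = (n * τ * ε ^ 2) * (lipC a b σ R * nonlinC a b σ R * (ε ^ 2 * τ ^ 2))
        + (12 * (nonlinC a b σ R + (n * τ * ε ^ 2) * (lipC a b σ R * 5 ^ σ * nonlinC a b σ R))
            * (ε ^ 2 * τ ^ 2)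
          + (n * τ * ε ^ 2) * (2 * nonlinC a b σ R * τ ^ (2 * σ / α))) := by
        unfold nonlinC; ring
    _ ≤ T * (lipC a b σ R * nonlinC a b σ R * (ε ^ 2 * τ ^ 2))
        + (12 * (nonlinC a b σ R + T * (lipC a b σ R * 5 ^ σ * nonlinC a b σ R))
            * (ε ^ 2 * τ ^ 2)
          + T * (2 * nonlinC a b σ R * τ ^ (2 * σ / α))) := by gcongr
    _ = _ := by ring

/-- The main convergence estimate in the rotating frame. -/
lemma IsProfile.mixed_errSeq_le_rate (hP : IsProfile a b α (m + α / 2) ε S R ψ)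
    (hc : IsScheme a b α ε τ N c) (hab : a < b) (h1 : 1 < α) (h2 : α ≤ 2) (hm : 1 < m)
    (hN : 0 < N) (hN2 : Even N) (hτ : 0 < τ) (hτ1 : τ ≤ 1) (hε : 0 < ε) (hε1 : ε ≤ 1) (hR : 0 ≤ R)
    (hR₀ : 0 ≤ R₀) (hST : S * ε ^ 2 ≤ T)
    (hinit : ∀ B : ℝ, 0 ≤ B → (∀ x : ℤ × ℤ → ℂ, ∑' l, ‖off N x l‖ₑ
        ≤ ENNReal.ofReal B * l2 (fun l => bw a b m l * ‖x l‖ₑ)) →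
      ∑' l, ‖trunc N (errSeq a b α τ ψ c 0) l‖ₑ ≤ ENNReal.ofReal (B * R₀))
    (hinit2 : ∀ B : ℝ, 0 ≤ B → (∀ x : ℤ × ℤ → ℂ, mixed (cls N) (fun l => ‖off N x l‖ₑ)
        ≤ ENNReal.ofReal B * l2 (fun l => bw a b m l * ‖x l‖ₑ)) →
      mixed (cls N) (fun l => ‖trunc N (errSeq a b α τ ψ c 0) l‖ₑ) ≤ ENNReal.ofReal (B * R₀))
    (hsmall : firstC a b m (m + α / 2) T R R₀ * (τ + ((b - a) / N) ^ ((m - 1) / 2))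
      * Real.exp (T * Real.exp (massC a b (m + α / 2) R)) ≤ 1)
    (n : ℕ) (hn : n * τ ≤ S) :
    mixed (cls N) (fun l => ‖trunc N (errSeq a b α τ ψ c n) l‖ₑ)
      ≤ ENNReal.ofReal (secondC a b α m T R R₀
        * (((b - a) / N) ^ m + ε ^ 2 * τ ^ 2 + τ ^ (2 * (m + α / 2) / α))) := by
  have hσ : 1 < m + α / 2 := by linarith
  have hba : 0 < b - a := sub_pos.2 hab
  have hNr : (0 : ℝ) < N := by exact_mod_cast hN
  have hL : 0 ≤ nonlinC a b (m + α / 2) R := nonlinC_nonneg hR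
  have hlip := (lipC_pos a b (m + α / 2) R).le
  have hoff := offC_nonneg m
  have hS : 0 ≤ S := le_trans (by positivity) hn
  have hT : 0 ≤ T := le_trans (by positivity) hST
  have htail : ∀ x : ℤ × ℤ → ℂ, mixed (cls N) (fun l => ‖off N x l‖ₑ)
      ≤ ENNReal.ofReal (offC m * ((b - a) / N) ^ m) * l2 (fun l => bw a b m l * ‖x l‖ₑ) :=
    mixed_off_le hab hN hN2 hm
  have hB : 0 ≤ offC m * ((b - a) / N) ^ m := by positivity
  have hid : (AddMonoidHom.id (ZMod N × ZMod N)).comp (cls N) = cls N := AddMonoidHom.id_comp _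
  set X := (T * lipC a b (m + α / 2) R * nonlinC a b (m + α / 2) R
        + 12 * (nonlinC a b (m + α / 2) R
          + T * lipC a b (m + α / 2) R * 5 ^ (m + α / 2) * nonlinC a b (m + α / 2) R))
          * (ε ^ 2 * τ ^ 2)
        + 2 * T * nonlinC a b (m + α / 2) R * τ ^ (2 * (m + α / 2) / α) with hX
  have hX0 : 0 ≤ X := by positivity
  have hmono : ∀ k : ℕ, k ≤ n → (k : ℝ) * τ ≤ S := fun k hk => le_trans (by gcongr) hn
  set q := τ * ε ^ 2 * Real.exp (massC a b (m + α / 2) R) with hq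
  set A := offC m * ((b - a) / N) ^ m * (R₀ + T * nonlinC a b (m + α / 2) R
      + T * Real.exp (massC a b (m + α / 2) R) * R) + X with hA
  have hstep : ∀ j ≤ n, mixed (cls N) (fun l => ‖trunc N (errSeq a b α τ ψ c j) l‖ₑ)
      ≤ ENNReal.ofReal A + ENNReal.ofReal q * ∑ k ∈ Finset.range j,
        mixed (cls N) (fun l => ‖trunc N (errSeq a b α τ ψ c k) l‖ₑ) := by
    intro j hj
    have hjS := hmono j hj
    have hjT : j * τ * ε ^ 2 ≤ T := le_trans (by gcongr) hST
    have := hP.mixed_errSeq_le (m := m) (B := offC m * ((b - a) / N) ^ m) (X := X) (R₀ := R₀)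
      (R₁ := massC a b (m + α / 2) R) (T := T) (AddMonoidHom.id (ZMod N × ZMod N)) hc hab h1 h2 hσ
      (by linarith) hτ.le hε hε1 hR hB hX0 hR₀ (by unfold massC; linarith)
      (fun x => by rw [hid]; exact htail x) (by rw [hid]; exact hinit2 _ hB htail) j hjS hjT
      (by simp_rw [hid]; exact hP.freeze_add_quad_le hab h1 h2 hσ hτ hε hε1 hR j hjS hjT)
      (fun k hk => hP.tsum_enorm_scheme_le hc hab h1 h2 hm hN hN2 hτ.le hτ1 hε hε1 hR hR₀ hST
        hinit hsmall k (hmono k (hk.le.trans hj)))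
    simp_rw [hid] at this
    exact this
  refine (gronwall_sum hstep n le_rfl).trans ?_
  have hqT : (n : ℝ) * q ≤ T * Real.exp (massC a b (m + α / 2) R) := by
    have : n * τ * ε ^ 2 ≤ T := le_trans (by gcongr) hST
    calc (n : ℝ) * q = n * τ * ε ^ 2 * Real.exp (massC a b (m + α / 2) R) := by rw [hq]; ring
      _ ≤ _ := by gcongr
  refine (mul_le_mul_right (one_add_ofReal_pow_le (by positivity) hqT) _).trans ?_
  rw [← ENNReal.ofReal_mul (by positivity)]
  refine ENNReal.ofReal_le_ofReal ?_
  rw [secondC, mul_right_comm]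
  gcongr
  have x1 : 0 ≤ ((b - a) / N) ^ m := by positivity
  have x2 : 0 ≤ ε ^ 2 * τ ^ 2 := by positivity
  have x3 : 0 ≤ τ ^ (2 * (m + α / 2) / α) := by positivity
  rw [hA, hX]
  set C1 := offC m * (R₀ + T * nonlinC a b (m + α / 2) R
      + T * Real.exp (massC a b (m + α / 2) R) * R) with hC1
  set C2 := T * lipC a b (m + α / 2) R * nonlinC a b (m + α / 2) R
        + 12 * (nonlinC a b (m + α / 2) R
          + T * lipC a b (m + α / 2) R * 5 ^ (m + α / 2) * nonlinC a b (m + α / 2) R)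
  set C3 := 2 * T * nonlinC a b (m + α / 2) R
  have y1 : 0 ≤ C1 := by positivity
  have y2 : 0 ≤ C2 := by positivity
  have y3 : 0 ≤ C3 := by positivity
  have e1 : offC m * ((b - a) / N) ^ m * (R₀ + T * nonlinC a b (m + α / 2) R
      + T * Real.exp (massC a b (m + α / 2) R) * R) = C1 * ((b - a) / N) ^ m := by
    rw [hC1]; ring
  rw [e1]
  nlinarith [mul_nonneg y1 x2, mul_nonneg y1 x3, mul_nonneg y2 x1, mul_nonneg y2 x3,
    mul_nonneg y3 x1, mul_nonneg y3 x2]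

end error


/-! ### The initial error. -/

section initial
variable {a b α m ε τ S M : ℝ} {N : ℕ} {u₀ u₁ : ℝ × ℝ → ℝ} {u v : ℝ → ℝ × ℝ → ℝ}

/-- The Fourier coefficients of a real function. -/
noncomputable def cf (a b : ℝ) (w : ℝ × ℝ → ℝ) (l : ℤ × ℤ) : ℂ := coeff a b (toC w) l.1 l.2

/-- The Sobolev bound on the Fourier coefficients of `u`. -/
noncomputable def posC (m α M : ℝ) : ℝ := 3 ^ ((m + α / 2) / 2) * max M 0

/-- The Sobolev bound on the Fourier coefficients of `∂_t u`. -/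
noncomputable def velC (m M : ℝ) : ℝ := 3 ^ (m / 2) * max M 0

lemma posC_nonneg (m α M : ℝ) : 0 ≤ posC m α M := by unfold posC; positivity

lemma velC_nonneg (m M : ℝ) : 0 ≤ velC m M := by unfold velC; positivity

lemma l2_bw_dl_mul_le (a b : ℝ) {α : ℝ} (hα : 0 ≤ α) (m : ℝ) (x : ℤ × ℤ → ℂ) :
    l2 (fun l => bw a b m l * ‖dl a b α l * x l‖ₑ)
      ≤ 2 * l2 (fun l => bw a b (m + α / 2) l * ‖x l‖ₑ) := by
  rw [← l2_const_mul]
  refine l2_mono fun l => ?_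
  rw [enorm_dl_mul, ← bw_mul_bw]
  have h : ENNReal.ofReal (dl a b α l) ≤ 2 * bw a b (α / 2) l := by
    have := ENNReal.ofReal_le_ofReal (dl_le_beta a b hα l)
    rwa [ENNReal.ofReal_mul zero_le_two, ENNReal.ofReal_ofNat] at this
  calc _ ≤ bw a b m l * (2 * bw a b (α / 2) l * ‖x l‖ₑ) := by gcongr
    _ = _ := by ring

lemma IsSolution.cf_u_le (hs : IsSolution a b α ε S u₀ u₁ u v) (h1 : 1 < α) (hm : 1 < m)
    (hS : 0 < S) (hA : AssumptionA a b α m S M u v) {t : ℝ} (ht : t ∈ Icc 0 S) :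
    l2 (fun l => bw a b (m + α / 2) l * ‖cf a b (u t) l‖ₑ) ≤ ENNReal.ofReal (posC m α M) :=
  hs.coeff_u_le (by linarith) hS hA ht

lemma IsSolution.cf_v_le (hs : IsSolution a b α ε S u₀ u₁ u v) (hm : 1 < m)
    (hS : 0 < S) (hA : AssumptionA a b α m S M u v) {t : ℝ} (ht : t ∈ Icc 0 S) :
    l2 (fun l => bw a b m l * ‖cf a b (v t) l‖ₑ) ≤ ENNReal.ofReal (velC m M) :=
  hs.coeff_v_le (by linarith) hS hA ht

lemma IsSolution.dft_u (hs : IsSolution a b α ε S u₀ u₁ u v) (hab : a < b) (h1 : 1 < α)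
    (hm : 1 < m) (hS : 0 < S) (hA : AssumptionA a b α m S M u v) (hN : 0 < N) (l : ℤ × ℤ) :
    dft a b N (fun p q => (u₀ (gridPt a b N p q) : ℂ)) l.1 l.2 = aliasSum N (cf a b (u 0)) l := by
  have h0 : (0 : ℝ) ∈ Icc 0 S := ⟨le_rfl, hS.le⟩
  rw [← dft_synth hab hN (summable_of_bw hab (by linarith) (hs.cf_u_le h1 hm hS hA h0))]
  refine dft_congr _ _ _ (fun p hp q hq => ?_) _ _
  rw [← hs.init_u]
  exact hs.u_eq_synth hab (by linarith) hm hS hA h0 (gridPt_mem hab hp hq)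

lemma IsSolution.dft_v (hs : IsSolution a b α ε S u₀ u₁ u v) (hab : a < b)
    (hm : 1 < m) (hS : 0 < S) (hA : AssumptionA a b α m S M u v) (hN : 0 < N) (l : ℤ × ℤ) :
    dft a b N (fun p q => (u₁ (gridPt a b N p q) : ℂ)) l.1 l.2 = aliasSum N (cf a b (v 0)) l := by
  have h0 : (0 : ℝ) ∈ Icc 0 S := ⟨le_rfl, hS.le⟩
  rw [← dft_synth hab hN (summable_of_bw hab hm (hs.cf_v_le hm hS hA h0))]
  refine dft_congr _ _ _ (fun p hp q hq => ?_) _ _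
  rw [← hs.init_v]
  exact hs.v_eq_synth hab hm hS hA h0 (gridPt_mem hab hp hq)

lemma IsSolution.numProfile_zero (hs : IsSolution a b α ε S u₀ u₁ u v) (hab : a < b) (h1 : 1 < α)
    (hm : 1 < m) (hS : 0 < S) (hA : AssumptionA a b α m S M u v) (hN : 0 < N) {l : ℤ × ℤ}
    (hl : l ∈ box N) :
    numProfile a b α ε τ N u₀ u₁ 0 l = aliasSum N (cf a b (u 0)) l
      - Complex.I / dl a b α l * aliasSum N (cf a b (v 0)) l := by
  have e : phiN a b α ε τ N u₀ u₁ 0 = fun p q => (u₀ (gridPt a b N p q) : ℂ) + -Complex.I *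
      multiplier a b N (fun k l => 1 / (delta a b α k l : ℂ))
        (fun p' q' => (u₁ (gridPt a b N p' q') : ℂ)) p q := by
    funext p q; rw [phiN]; ring
  rw [numProfile, trunc_of_mem hl, e, dft_add_mul, dft_multiplier hab hN _ _ hl,
    hs.dft_u hab h1 hm hS hA hN, hs.dft_v hab hm hS hA hN, dl]
  simp
  ring

/-- The scheme starts from the sampled data, whose discrete coefficients are aliased sums of the
exact ones; in the box the difference is purely the aliasing of the part outside it. -/
lemma IsSolution.enorm_errSeq_zero_le (hs : IsSolution a b α ε S u₀ u₁ u v) (hab : a < b)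
    (h1 : 1 < α) (hm : 1 < m) (hS : 0 < S) (hA : AssumptionA a b α m S M u v) (hN : 0 < N)
    (l : ℤ × ℤ) :
    ‖trunc N (errSeq a b α τ (twist a b α u v) (numProfile a b α ε τ N u₀ u₁) 0) l‖ₑ
      ≤ ‖trunc N (fun l => dl a b α l * aliasSum N (off N (cf a b (u 0))) l) l‖ₑ
        + ‖trunc N (aliasSum N (off N (cf a b (v 0)))) l‖ₑ := by
  refine enorm_trunc_mono fun hl => ?_
  have h0 : (0 : ℝ) ∈ Icc 0 S := ⟨le_rfl, hS.le⟩
  have ht := exp_mul_twist a b α u v 0 l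
  have hd := dl_ne_zero a b α l
  have hu := aliasSum_eq (summable_of_bw hab (by linarith) (hs.cf_u_le h1 hm hS hA h0)) hl
  have hv := aliasSum_eq (summable_of_bw hab hm (hs.cf_v_le hm hS hA h0)) hl
  rw [zero_mul, Complex.ofReal_zero, mul_zero, Complex.exp_zero, one_mul] at ht
  have e : errSeq a b α τ (twist a b α u v) (numProfile a b α ε τ N u₀ u₁) 0 l
      = -(dl a b α l * aliasSum N (off N (cf a b (u 0))) l)
        + Complex.I * aliasSum N (off N (cf a b (v 0))) l := by
    rw [errSeq, hs.numProfile_zero hab h1 hm hS hA hN hl, Nat.cast_zero, zero_mul, ht, hu, hv]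
    simp only [cf]
    field_simp
    ring
  rw [trunc_of_mem hl, trunc_of_mem hl, e]
  refine (enorm_add_le _ _).trans (le_of_eq ?_)
  rw [enorm_neg, enorm_mul Complex.I, show ‖Complex.I‖ₑ = 1 by simp [← ofReal_norm], one_mul]

lemma dl_mul_off (a b α : ℝ) (N : ℕ) (x : ℤ × ℤ → ℂ) (l : ℤ × ℤ) :
    dl a b α l * off N x l = off N (fun l => dl a b α l * x l) l := by
  unfold off; split_ifs <;> simp

lemma IsSolution.mixed_errSeq_zero_le {Q : Type*} [AddCommGroup Q] (ρ : ZMod N × ZMod N →+ Q)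
    (hs : IsSolution a b α ε S u₀ u₁ u v) (hab : a < b)
    (h1 : 1 < α) (hm : 1 < m) (hS : 0 < S) (hA : AssumptionA a b α m S M u v) (hN : 0 < N)
    {B : ℝ} (hB : 0 ≤ B)
    (htail : ∀ x : ℤ × ℤ → ℂ, mixed (ρ.comp (cls N)) (fun l => ‖off N x l‖ₑ)
      ≤ ENNReal.ofReal B * l2 (fun l => bw a b m l * ‖x l‖ₑ)) :
    mixed (ρ.comp (cls N)) (fun l =>
      ‖trunc N (errSeq a b α τ (twist a b α u v) (numProfile a b α ε τ N u₀ u₁) 0) l‖ₑ)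
      ≤ ENNReal.ofReal (B * (2 * posC m α M + velC m M)) := by
  have h0 : (0 : ℝ) ∈ Icc 0 S := ⟨le_rfl, hS.le⟩
  have hp := posC_nonneg m α M
  have hv := velC_nonneg m M
  refine (mixed_mono fun l => hs.enorm_errSeq_zero_le hab h1 hm hS hA hN l).trans
    ((mixed_add_le _ _ _).trans ?_)
  rw [mul_add, ENNReal.ofReal_add (by positivity) (by positivity)]
  refine add_le_add ((mixed_dl_trunc_aliasSum_le hab (by linarith) ρ _).trans ?_)
    ((mixed_trunc_aliasSum_le ρ _).trans ?_)
  · simp_rw [dl_mul_off]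
    rw [ENNReal.ofReal_mul hB, ENNReal.ofReal_mul zero_le_two, ENNReal.ofReal_ofNat]
    refine (htail _).trans (mul_le_mul_right ((l2_bw_dl_mul_le a b (by linarith) m _).trans
      (mul_le_mul_right (hs.cf_u_le h1 hm hS hA h0) _)) _)
  · rw [ENNReal.ofReal_mul hB]
    exact (htail _).trans (mul_le_mul_right (hs.cf_v_le hm hS hA h0) _)

end initial

/-! ### Sobolev norms of interpolation errors. -/

section conversion
variable {a b α m ε τ S M : ℝ} {N : ℕ} {u₀ u₁ : ℝ × ℝ → ℝ} {u v : ℝ → ℝ × ℝ → ℝ}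

lemma coeff_sub_interp (hab : a < b) {w : ℝ × ℝ → ℝ} (hw : Continuous w) (g : ℕ → ℕ → ℂ)
    (l : ℤ × ℤ) :
    coeff a b (fun z => (w z : ℂ) - interp a b N g z) l.1 l.2
      = cf a b w l - trunc N (fun l => dft a b N g l.1 l.2) l := by
  simp_rw [interp_eq_synth]
  have hy := summable_norm_trunc N fun l => dft a b N g l.1 l.2
  refine (coeff_sub (continuous_toC hw) (continuous_synth a b hy) a b l.1 l.2).trans ?_
  rw [coeff_synth hab hy]
  rfl

/-- The weight (1+|μ|²)^{α/4} of the H^{α/2} norm is at most δ for α ≤ 2, so the energy scaling of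
the error dominates the required norm. -/
lemma sobolevNorm_sub_interp_le (hab : a < b) (h0 : 0 ≤ α) (h2 : α ≤ 2) {w : ℝ × ℝ → ℝ}
    (hw : Continuous w) (g : ℕ → ℕ → ℂ) :
    sobolevNorm a b (α / 2) (fun z => (w z : ℂ) - interp a b N g z)
      ≤ l2 (fun l => ‖dl a b α l * (cf a b w l
        - trunc N (fun l => dft a b N g l.1 l.2) l)‖ₑ) := by
  rw [sobolevNorm_eq]
  refine l2_mono fun l => ?_
  rw [coeff_sub_interp hab hw, enorm_dl_mul]
  gcongr
  have hp : 0 ≤ 1 + freq a b l.1 ^ 2 + freq a b l.2 ^ 2 := by positivity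
  refine abs_le_of_sq_le_sq' ?_ (dl_pos a b α l).le |>.2
  refine le_trans (le_of_eq ?_) (rpow_le_dl_sq a b h0 h2 l)
  rw [← Real.rpow_natCast, ← Real.rpow_mul hp]
  congr 1; push_cast; ring

lemma sobolevNorm_zero_sub_interp (hab : a < b) {w : ℝ × ℝ → ℝ}
    (hw : Continuous w) (g : ℕ → ℕ → ℂ) :
    sobolevNorm a b 0 (fun z => (w z : ℂ) - interp a b N g z)
      = l2 (fun l => ‖cf a b w l - trunc N (fun l => dft a b N g l.1 l.2) l‖ₑ) := by
  rw [sobolevNorm_eq]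
  congr 1
  funext l
  rw [coeff_sub_interp hab hw]; simp

lemma l2_sub_trunc_aliasSum_le {x : ℤ × ℤ → ℂ} (hx : Summable fun l => ‖x l‖) :
    l2 (fun l => ‖x l - trunc N (aliasSum N x) l‖ₑ)
      ≤ 2 * mixed (cls N) (fun l => ‖off N x l‖ₑ) := by
  have h : ∀ l, ‖x l - trunc N (aliasSum N x) l‖ₑ
      ≤ ‖trunc N (fun l => x l - aliasSum N x l) l‖ₑ + ‖off N x l‖ₑ := by
    intro l
    by_cases hl : l ∈ box N
    · rw [trunc_of_mem hl, trunc_of_mem hl]; exact le_self_add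
    · rw [trunc_of_notMem hl, sub_zero, off, if_neg hl]; exact le_add_self
  refine (l2_mono h).trans ((l2_add_le _ _).trans ?_)
  rw [two_mul]
  refine add_le_add ((l2_le_mixed (cls N) _).trans ?_) (l2_le_mixed _ _)
  have := mixed_trunc_sub_aliasSum_le (AddMonoidHom.id (ZMod N × ZMod N)) hx
  rwa [AddMonoidHom.id_comp] at this

lemma l2_dl_sub_trunc_aliasSum_le (hab : a < b) (hα : 0 ≤ α) {x : ℤ × ℤ → ℂ}
    (hx : Summable fun l => ‖x l‖) :
    l2 (fun l => ‖dl a b α l * (x l - trunc N (aliasSum N x) l)‖ₑ)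
      ≤ 2 * mixed (cls N) (fun l => ‖off N (fun l => dl a b α l * x l) l‖ₑ) := by
  have h : ∀ l, ‖dl a b α l * (x l - trunc N (aliasSum N x) l)‖ₑ
      ≤ ‖trunc N (fun l => dl a b α l * aliasSum N (off N x) l) l‖ₑ
        + ‖off N (fun l => dl a b α l * x l) l‖ₑ := by
    intro l
    by_cases hl : l ∈ box N
    · rw [trunc_of_mem hl, trunc_of_mem hl, aliasSum_eq hx hl, sub_add_cancel_left, mul_neg,
        enorm_neg]; exact le_self_add
    · rw [trunc_of_notMem hl, sub_zero, off, if_neg hl]; exact le_add_self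
  refine (l2_mono h).trans ((l2_add_le _ _).trans ?_)
  rw [two_mul]
  refine add_le_add ((l2_le_mixed (cls N) _).trans ?_) (l2_le_mixed _ _)
  have := mixed_dl_trunc_aliasSum_le hab hα (AddMonoidHom.id (ZMod N × ZMod N)) (off N x)
  simp_rw [dl_mul_off] at this
  rwa [AddMonoidHom.id_comp] at this

/-- The error at the initial time. -/
lemma IsSolution.totalError_zero_le (hs : IsSolution a b α ε S u₀ u₁ u v) (hab : a < b)
    (h1 : 1 < α) (h2 : α ≤ 2) (hm : 1 < m) (hS : 0 < S) (hA : AssumptionA a b α m S M u v)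
    (hN : 0 < N) (hN2 : Even N) :
    totalError a b α ε τ N u₀ u₁ u v 0
      ≤ ENNReal.ofReal (offC m * (4 * posC m α M + 2 * velC m M) * ((b - a) / N) ^ m) := by
  have hba : 0 < b - a := sub_pos.2 hab
  have hNr : (0 : ℝ) < N := by exact_mod_cast hN
  have h0 : (0 : ℝ) ∈ Icc 0 S := ⟨le_rfl, hS.le⟩
  have hp := posC_nonneg m α M
  have hv := velC_nonneg m M
  have ho := offC_nonneg m
  have hcu := hs.cf_u_le h1 hm hS hA h0
  have hcv := hs.cf_v_le hm hS hA h0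
  have hsu := summable_of_bw hab (by linarith) hcu
  have hsv := summable_of_bw hab hm hcv
  have eu : ∀ l, trunc N (fun l => dft a b N (uN a b α ε τ N u₀ u₁ 0) l.1 l.2) l
      = trunc N (aliasSum N (cf a b (u 0))) l := fun l => by
    unfold trunc
    split_ifs
    · exact hs.dft_u hab h1 hm hS hA hN l
    · rfl
  have ev : ∀ l, trunc N (fun l => dft a b N (vN a b α ε τ N u₀ u₁ 0) l.1 l.2) l
      = trunc N (aliasSum N (cf a b (v 0))) l := fun l => by
    unfold trunc
    split_ifs
    · exact hs.dft_v hab hm hS hA hN l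
    · rfl
  set B := offC m * ((b - a) / N) ^ m with hB
  have hB0 : 0 ≤ B := by positivity
  have e : offC m * (4 * posC m α M + 2 * velC m M) * ((b - a) / N) ^ m
      = 2 * (B * (2 * posC m α M)) + 2 * (B * velC m M) := by rw [hB]; ring
  rw [totalError, Nat.cast_zero, zero_mul, e, ENNReal.ofReal_add (by positivity) (by positivity),
    sobolevNorm_zero_sub_interp hab (hs.cper_v 0 h0).1]
  refine add_le_add ((sobolevNorm_sub_interp_le hab (by linarith) h2
    (hs.cper_u 0 h0).1 _).trans ?_) ?_
  · simp_rw [eu]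
    refine (l2_dl_sub_trunc_aliasSum_le hab (by linarith) hsu).trans ?_
    rw [ENNReal.ofReal_mul zero_le_two, ENNReal.ofReal_ofNat, ENNReal.ofReal_mul hB0,
      ENNReal.ofReal_mul zero_le_two, ENNReal.ofReal_ofNat]
    refine mul_le_mul_right ((mixed_off_le hab hN hN2 hm _).trans (mul_le_mul_right
      ((l2_bw_dl_mul_le a b (by linarith) m _).trans (mul_le_mul_right hcu _)) _)) _
  · simp_rw [ev]
    refine (l2_sub_trunc_aliasSum_le hsv).trans ?_
    rw [ENNReal.ofReal_mul zero_le_two, ENNReal.ofReal_ofNat, ENNReal.ofReal_mul hB0]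
    exact mul_le_mul_right ((mixed_off_le hab hN hN2 hm _).trans (mul_le_mul_right hcv _)) _

end conversion


/-! ### The reflected index and the asymmetry of the grid frequencies. -/

section reflection
variable {a b α τ : ℝ} {N : ℕ}

/-- The part of a sequence at the frequencies that are resolved by the grid. -/
noncomputable def low (N : ℕ) (y : ℤ × ℤ → ℂ) (l : ℤ × ℤ) : ℂ :=
  if 2 * |l.1| < (N : ℤ) ∧ 2 * |l.2| < (N : ℤ) then y l else 0

lemma high_add_low (N : ℕ) (y : ℤ × ℤ → ℂ) (l : ℤ × ℤ) : high N y l + low N y l = y l := by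
  unfold high low; split_ifs <;> simp

lemma summable_norm_high (N : ℕ) {y : ℤ × ℤ → ℂ} (hy : Summable fun j => ‖y j‖) :
    Summable fun j => ‖high N y j‖ :=
  Summable.of_nonneg_of_le (fun _ => norm_nonneg _)
    (fun j => by unfold high; split_ifs <;> simp) hy

lemma summable_norm_low (N : ℕ) {y : ℤ × ℤ → ℂ} (hy : Summable fun j => ‖y j‖) :
    Summable fun j => ‖low N y j‖ :=
  Summable.of_nonneg_of_le (fun _ => norm_nonneg _)
    (fun j => by unfold low; split_ifs <;> simp) hy

lemma aliasSum_comp_neg (y : ℤ × ℤ → ℂ) (l : ℤ × ℤ) :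
    aliasSum N (fun j => y (-j)) l = aliasSum N y (-l) := by
  classical
  unfold aliasSum
  rw [← (Equiv.neg (ℤ × ℤ)).tsum_eq]
  refine tsum_congr fun j => ?_
  have : cls N (-j) = cls N l ↔ cls N j = cls N (-l) := by
    rw [map_neg, map_neg, neg_eq_iff_eq_neg]
  by_cases h : cls N j = cls N (-l)
  · rw [if_pos h, Equiv.neg_apply, if_pos (this.2 h)]; beta_reduce; rw [neg_neg]
  · rw [if_neg h, Equiv.neg_apply, if_neg fun h' => h (this.1 h')]

/-- The index -l leaves the box when a component of l is -N/2. The strictly resolved frequencies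
form a symmetric set, so they still do not alias at -l. -/
lemma aliasSum_low_neg (hN2 : Even N) (y : ℤ × ℤ → ℂ) {l : ℤ × ℤ} (hl : l ∈ box N) :
    aliasSum N (low N y) (-l) = low N y (-l) := by
  classical
  rw [aliasSum, tsum_eq_single (-l), if_pos rfl]
  intro j hj
  split_ifs with h
  · unfold low
    rw [if_neg]
    rintro ⟨h1, h2⟩
    have hjb : -j ∈ box N := mem_box_of_lt hN2 (by simpa using h1) (by simpa using h2)
    have := cls_injOn_box N hjb hl (by rw [map_neg, h, map_neg, neg_neg])
    exact hj (by rw [← this, neg_neg])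
  · rfl

lemma sub_aliasSum_neg (hN2 : Even N) {y : ℤ × ℤ → ℂ} (hy : Summable fun j => ‖y j‖)
    {l : ℤ × ℤ} (hl : l ∈ box N) :
    y (-l) - aliasSum N y (-l) = high N y (-l) - aliasSum N (high N y) (-l) := by
  have h := aliasSum_add (N := N) (summable_norm_high N hy) (summable_norm_low N hy) (-l)
  simp_rw [high_add_low] at h
  rw [h, aliasSum_low_neg hN2 y hl, ← high_add_low N y (-l)]
  ring

lemma dl_mul_high (a b α : ℝ) (N : ℕ) (x : ℤ × ℤ → ℂ) (l : ℤ × ℤ) :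
    dl a b α l * high N x l = high N (fun l => dl a b α l * x l) l := by
  unfold high; split_ifs <;> simp

/-- The reflected error is controlled by the error and the high frequencies. -/
lemma mixed_reflect_le (hab : a < b) (hα : 0 ≤ α) (hN2 : Even N) {A x : ℤ × ℤ → ℂ}
    (hA : Summable fun j => ‖A j‖) (hx : Summable fun j => ‖x j‖) (hx0 : ∀ l ∉ box N, x l = 0) :
    mixed (cls N) (fun l => ‖trunc N (fun l => dl a b α l * (A (-l) - aliasSum N x (-l))) l‖ₑ)
      ≤ mixed (cls N) (fun l => ‖trunc N (fun l => dl a b α l * (A l - x l)) l‖ₑ)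
        + 3 * mixed (cls N) (fun l => ‖high N (fun l => dl a b α l * A l) l‖ₑ) := by
  set H := fun l => ‖high N (fun l => dl a b α l * A l) l‖ₑ with hH
  set D := fun l => ‖trunc N (fun l => dl a b α l * (A l - x l)) l‖ₑ with hD
  have hAx : Summable fun j => ‖A j - x j‖ := (hA.add hx).of_nonneg_of_le
    (fun _ => norm_nonneg _) fun j => norm_sub_le _ _
  have hneg : ∀ y : ℤ × ℤ → ℂ, mixed (cls N)
      (fun l => ‖trunc N (fun l => dl a b α l * aliasSum N y (-l)) l‖ₑ)
      ≤ mixed (cls N) (fun l => ‖dl a b α l * y l‖ₑ) := by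
    intro y
    have := mixed_dl_trunc_aliasSum_le hab hα (AddMonoidHom.id (ZMod N × ZMod N))
      (fun j => y (-j))
    rw [AddMonoidHom.id_comp] at this
    simp_rw [aliasSum_comp_neg] at this
    refine this.trans (le_of_eq ?_)
    rw [← mixed_comp_neg (cls N)]
    simp_rw [dl_neg, neg_neg]
  have h : ∀ l, ‖trunc N (fun l => dl a b α l * (A (-l) - aliasSum N x (-l))) l‖ₑ
      ≤ H (-l) + ‖trunc N (fun l => dl a b α l * aliasSum N (high N A) (-l)) l‖ₑ
        + ‖trunc N (fun l => dl a b α l * aliasSum N (fun j => A j - x j) (-l)) l‖ₑ := by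
    intro l
    refine enorm_trunc_mono fun hl => ?_
    rw [trunc_of_mem hl, trunc_of_mem hl, aliasSum_sub hA hx]
    -- The exact coefficient is compared first with its own aliased sum, which leaves only
    -- unresolved frequencies, and then with the numerical one, for which aliasing is harmless. The
    -- unresolved part enters three times in total: directly, aliased, and in A - x outside the box.
    have e : dl a b α l * (A (-l) - aliasSum N x (-l))
        = dl a b α (-l) * high N A (-l) - dl a b α l * aliasSum N (high N A) (-l)
          + dl a b α l * (aliasSum N A (-l) - aliasSum N x (-l)) := by
      have := sub_aliasSum_neg hN2 hA hl
      rw [dl_neg]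
      linear_combination (dl a b α l : ℂ) * this
    rw [e]
    refine (enorm_add_le _ _).trans (add_le_add (enorm_sub_le.trans (add_le_add ?_ le_rfl))
      le_rfl)
    rw [dl_mul_high]
  have hd : ∀ l, ‖dl a b α l * (A l - x l)‖ₑ ≤ D l + H l := by
    intro l
    by_cases hl : l ∈ box N
    · rw [hD]; beta_reduce; rw [trunc_of_mem hl]; exact le_self_add
    · have e : dl a b α l * (A l - x l) = off N (fun l => dl a b α l * A l) l := by
        rw [hx0 l hl, sub_zero, off, if_neg hl]
      rw [e]
      exact (enorm_off_le_high hN2 _ l).trans le_add_self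
  refine (mixed_mono h).trans ((mixed_add_le _ _ _).trans ((add_le_add
    ((mixed_add_le _ _ _).trans (add_le_add (mixed_comp_neg (cls N) H).le (hneg _)))
    ((hneg _).trans ((mixed_mono hd).trans (mixed_add_le _ _ _)))).trans (le_of_eq ?_)))
  simp_rw [dl_mul_high]
  ring

end reflection

/-! ### From the rotating frame to the error of the scheme. -/

section conversion
variable {a b α m ε τ S M : ℝ} {N : ℕ} {u₀ u₁ : ℝ × ℝ → ℝ} {u v : ℝ → ℝ × ℝ → ℝ}

/-- The discrete Fourier coefficients of the numerical solution. -/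
noncomputable def numCoeff (a b α ε τ : ℝ) (N : ℕ) (u₀ u₁ : ℝ × ℝ → ℝ) (n : ℕ) (l : ℤ × ℤ) : ℂ :=
  Complex.exp (Complex.I * ((n * τ * dl a b α l : ℝ) : ℂ)) * numProfile a b α ε τ N u₀ u₁ n l

lemma numCoeff_of_notMem {n : ℕ} {l : ℤ × ℤ} (hl : l ∉ box N) :
    numCoeff a b α ε τ N u₀ u₁ n l = 0 := by
  rw [numCoeff, numProfile, trunc_of_notMem hl, mul_zero]

lemma summable_numCoeff (n : ℕ) : Summable fun l => ‖numCoeff a b α ε τ N u₀ u₁ n l‖ :=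
  summable_of_ne_finset_zero (s := box N) fun l hl => by rw [numCoeff_of_notMem hl, norm_zero]

/-- Valid for every index, including -l outside the box, which the coefficients of the conjugate
grid function require. -/
lemma dft_phiN_succ (hab : a < b) (hN : 0 < N) (n : ℕ) (l : ℤ × ℤ) :
    dft a b N (phiN a b α ε τ N u₀ u₁ (n + 1)) l.1 l.2
      = aliasSum N (numCoeff a b α ε τ N u₀ u₁ (n + 1)) l := by
  obtain ⟨y, hy⟩ : ∃ y, phiN a b α ε τ N u₀ u₁ (n + 1)
      = fun p q => synth a b (trunc N y) (gridPt a b N p q) :=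
    ⟨_, funext fun p => funext fun q => multiplier_eq_synth a b N _ _ p q⟩
  have h : ∀ l, dft a b N (phiN a b α ε τ N u₀ u₁ (n + 1)) l.1 l.2 = aliasSum N (trunc N y) l :=
    fun l => by rw [hy, dft_synth hab hN (summable_norm_trunc N y)]
  rw [h]
  congr 1
  funext j
  by_cases hj : j ∈ box N
  · rw [trunc_of_mem hj, numCoeff, exp_mul_numProfile _ hj, h, aliasSum_trunc y hj]
  · rw [trunc_of_notMem hj, numCoeff_of_notMem hj]

lemma aliasSum_numCoeff (n : ℕ) {l : ℤ × ℤ} (hl : l ∈ box N) :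
    aliasSum N (numCoeff a b α ε τ N u₀ u₁ n) l = numCoeff a b α ε τ N u₀ u₁ n l := by
  have : numCoeff a b α ε τ N u₀ u₁ n = trunc N (numCoeff a b α ε τ N u₀ u₁ n) := by
    funext j
    by_cases hj : j ∈ box N
    · rw [trunc_of_mem hj]
    · rw [trunc_of_notMem hj, numCoeff_of_notMem hj]
  rw [this, aliasSum_trunc _ hl, ← this]

lemma dft_uN_succ (hab : a < b) (hN : 0 < N) (n : ℕ) {l : ℤ × ℤ} (hl : l ∈ box N) :
    dft a b N (uN a b α ε τ N u₀ u₁ (n + 1)) l.1 l.2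
      = (numCoeff a b α ε τ N u₀ u₁ (n + 1) l
        + (starRingEnd ℂ) (aliasSum N (numCoeff a b α ε τ N u₀ u₁ (n + 1)) (-l))) / 2 := by
  have e : uN a b α ε τ N u₀ u₁ (n + 1) = fun p q => (fun _ _ => (0 : ℂ)) p q + 1 / 2 *
      (fun p q => phiN a b α ε τ N u₀ u₁ (n + 1) p q + 1 *
        (fun p q => (starRingEnd ℂ) (phiN a b α ε τ N u₀ u₁ (n + 1) p q)) p q) p q := by
    funext p q; simp [uN]
  have h := dft_phiN_succ (α := α) (ε := ε) (τ := τ) (u₀ := u₀) (u₁ := u₁) hab hN n (-l)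
  have h0 : dft a b N (fun _ _ => (0 : ℂ)) l.1 l.2 = 0 := by simp [dft]
  rw [Prod.fst_neg, Prod.snd_neg] at h
  rw [e, dft_add_mul, dft_add_mul, dft_conj, h, dft_phiN_succ hab hN, aliasSum_numCoeff _ hl, h0]
  ring

lemma dft_vN_succ (hab : a < b) (hN : 0 < N) (n : ℕ) {l : ℤ × ℤ} (hl : l ∈ box N) :
    dft a b N (vN a b α ε τ N u₀ u₁ (n + 1)) l.1 l.2
      = Complex.I / 2 * dl a b α l * (numCoeff a b α ε τ N u₀ u₁ (n + 1) l
        - (starRingEnd ℂ) (aliasSum N (numCoeff a b α ε τ N u₀ u₁ (n + 1)) (-l))) := by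
  have h := dft_phiN_succ (α := α) (ε := ε) (τ := τ) (u₀ := u₀) (u₁ := u₁) hab hN n (-l)
  rw [Prod.fst_neg, Prod.snd_neg] at h
  have e : vN a b α ε τ N u₀ u₁ (n + 1) = fun p q => synth a b (trunc N fun l =>
      Complex.I / 2 * (dl a b α l * (dft a b N (phiN a b α ε τ N u₀ u₁ (n + 1)) l.1 l.2
        - dft a b N (fun p' q' => (starRingEnd ℂ) (phiN a b α ε τ N u₀ u₁ (n + 1) p' q'))
          l.1 l.2))) (gridPt a b N p q) := by
    funext p q
    rw [synth_trunc, vN]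
    beta_reduce
    rw [Finset.mul_sum]
    refine Finset.sum_congr rfl fun k _ => ?_
    rw [Finset.mul_sum]
    refine Finset.sum_congr rfl fun l _ => ?_
    rw [dl]; ring
  rw [e, dft_synth hab hN (summable_norm_trunc N _), aliasSum_trunc _ hl, dft_conj, h,
    dft_phiN_succ hab hN, aliasSum_numCoeff _ hl]
  ring

/-- The Fourier coefficients of `u - i⟨∇⟩⁻¹∂_t u`. -/
noncomputable def waveCoeff (a b α : ℝ) (u v : ℝ → ℝ × ℝ → ℝ) (t : ℝ) (l : ℤ × ℤ) : ℂ :=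
  Complex.exp (Complex.I * ((t * dl a b α l : ℝ) : ℂ)) * twist a b α u v t l

lemma cf_u_eq (t : ℝ) (l : ℤ × ℤ) : cf a b (u t) l
    = (waveCoeff a b α u v t l + (starRingEnd ℂ) (waveCoeff a b α u v t (-l))) / 2 := by
  rw [cf, coeff_u_eq a b α u v t l, proj_wave, waveCoeff, waveCoeff, dl_neg]

lemma cf_v_eq (t : ℝ) (l : ℤ × ℤ) : cf a b (v t) l = Complex.I / 2 * dl a b α l
    * (waveCoeff a b α u v t l - (starRingEnd ℂ) (waveCoeff a b α u v t (-l))) := by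
  rw [cf, coeff_v_eq a b α u v t l, waveCoeff, waveCoeff, dl_neg]

lemma enorm_waveCoeff (t : ℝ) (l : ℤ × ℤ) :
    ‖waveCoeff a b α u v t l‖ₑ = ‖twist a b α u v t l‖ₑ := by
  rw [waveCoeff, enorm_mul, enorm_exp_I_mul, one_mul]

lemma enorm_half_le {x y : ℂ} {p q : ℝ≥0∞} (hx : ‖x‖ₑ ≤ p) (hy : ‖y‖ₑ ≤ q) :
    ‖(x + y) / 2‖ₑ ≤ p + q := by
  refine le_trans ?_ ((enorm_add_le x y).trans (add_le_add hx hy))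
  rw [div_eq_mul_inv, enorm_mul]
  refine mul_le_of_le_one_right' ?_
  rw [← ofReal_norm, ← ENNReal.ofReal_one]
  exact ENNReal.ofReal_le_ofReal (by norm_num)

lemma enorm_conj (z : ℂ) : ‖(starRingEnd ℂ) z‖ₑ = ‖z‖ₑ := by
  rw [← ofReal_norm, ← ofReal_norm, RCLike.norm_conj]

/-- The error at positive times in terms of the error in the rotating frame. -/
lemma IsSolution.totalError_succ_le (hs : IsSolution a b α ε S u₀ u₁ u v) (hab : a < b)
    (h1 : 1 < α) (h2 : α ≤ 2) (hm : 1 < m) (hε : ε ≠ 0) (hS : 0 < S)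
    (hA : AssumptionA a b α m S M u v) (hN : 0 < N) (hN2 : Even N) (hτ : 0 ≤ τ) (n : ℕ)
    (hn : (n + 1 : ℕ) * τ ≤ S) :
    totalError a b α ε τ N u₀ u₁ u v (n + 1)
      ≤ 4 * mixed (cls N) (fun l => ‖trunc N (errSeq a b α τ (twist a b α u v)
          (numProfile a b α ε τ N u₀ u₁) (n + 1)) l‖ₑ)
        + ENNReal.ofReal (20 * offC m * profileBound m α M * ((b - a) / N) ^ m) := by
  have hP := hs.isProfile hab h1 h2 hm hε hS hA
  have hba : 0 < b - a := sub_pos.2 hab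
  have hNr : (0 : ℝ) < N := by exact_mod_cast hN
  have hR := profileBound_nonneg m α M
  have ho := offC_nonneg m
  set t : ℝ := (n + 1 : ℕ) * τ with ht
  have htS : t ∈ Icc 0 S := ⟨by positivity, hn⟩
  set A := waveCoeff a b α u v t with hAdef
  set x := numCoeff a b α ε τ N u₀ u₁ (n + 1) with hx
  have hAs : Summable fun l => ‖A l‖ := by
    have := hP.summable hab (by linarith) htS
    refine this.congr fun l => ?_
    rw [hAdef, waveCoeff, norm_mul, norm_exp_I_mul, one_mul]
  have hxs : Summable fun l => ‖x l‖ := summable_numCoeff _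
  set D := fun l => ‖trunc N (errSeq a b α τ (twist a b α u v)
          (numProfile a b α ε τ N u₀ u₁) (n + 1)) l‖ₑ with hD
  have hDA : ∀ l, ‖trunc N (fun l => dl a b α l * (A l - x l)) l‖ₑ = D l := by
    intro l
    by_cases hl : l ∈ box N
    · rw [hD]; beta_reduce
      rw [trunc_of_mem hl, trunc_of_mem hl, errSeq, ← ht]
      have : dl a b α l * (A l - x l)
          = Complex.exp (Complex.I * ((t * dl a b α l : ℝ) : ℂ))
            * (dl a b α l * (twist a b α u v t l - numProfile a b α ε τ N u₀ u₁ (n + 1) l)) := by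
        rw [hAdef, hx, waveCoeff, numCoeff, ← ht]; ring
      rw [this, enorm_mul, enorm_exp_I_mul, one_mul]
    · rw [hD]; beta_reduce; rw [trunc_of_notMem hl, trunc_of_notMem hl]
  set H := fun l => ‖high N (fun l => dl a b α l * A l) l‖ₑ with hH
  set G := fun l => ‖trunc N (fun l => dl a b α l * (A (-l) - aliasSum N x (-l))) l‖ₑ with hG
  have hHA : ∀ l ∉ box N, ‖dl a b α l * A l‖ₑ ≤ H l := fun l hl => by
    have := enorm_off_le_high hN2 (fun l => dl a b α l * A l) l
    rwa [off, if_neg hl] at this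
  have hHA' : ∀ l ∉ box N, ‖dl a b α l * A (-l)‖ₑ ≤ H (-l) := fun l hl => by
    rw [hH]; beta_reduce
    rw [high, if_neg]
    · rw [dl_neg]
    · rintro ⟨h3, h4⟩
      exact hl (mem_box_of_lt hN2 (by simpa using h3) (by simpa using h4))
  have hu : ∀ l, ‖dl a b α l * (cf a b (u t) l
      - trunc N (fun l => dft a b N (uN a b α ε τ N u₀ u₁ (n + 1)) l.1 l.2) l)‖ₑ
      ≤ (D l + G l) + (H l + H (-l)) := by
    intro l
    rw [cf_u_eq (α := α) (v := v) t l, ← hAdef]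
    by_cases hl : l ∈ box N
    · refine le_trans ?_ le_self_add
      rw [trunc_of_mem hl, dft_uN_succ hab hN n hl, ← hx]
      have e : dl a b α l * ((A l + (starRingEnd ℂ) (A (-l))) / 2
          - (x l + (starRingEnd ℂ) (aliasSum N x (-l))) / 2)
          = (dl a b α l * (A l - x l)
            + (starRingEnd ℂ) (dl a b α l * (A (-l) - aliasSum N x (-l)))) / 2 := by
        rw [map_mul, map_sub, Complex.conj_ofReal]; ring
      rw [e]
      refine enorm_half_le ?_ ?_
      · rw [← hDA, trunc_of_mem hl]
      · rw [enorm_conj, hG]; beta_reduce; rw [trunc_of_mem hl]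
    · refine le_trans ?_ le_add_self
      rw [trunc_of_notMem hl, sub_zero]
      have e : dl a b α l * ((A l + (starRingEnd ℂ) (A (-l))) / 2)
          = (dl a b α l * A l + (starRingEnd ℂ) (dl a b α l * A (-l))) / 2 := by
        rw [map_mul, Complex.conj_ofReal]; ring
      rw [e]
      refine enorm_half_le (hHA l hl) ?_
      rw [enorm_conj]; exact hHA' l hl
  have hI : ∀ z : ℂ, ‖Complex.I * z‖ₑ = ‖z‖ₑ := fun z => by
    rw [enorm_mul, show ‖Complex.I‖ₑ = 1 by simp [← ofReal_norm], one_mul]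
  have hv : ∀ l, ‖cf a b (v t) l
      - trunc N (fun l => dft a b N (vN a b α ε τ N u₀ u₁ (n + 1)) l.1 l.2) l‖ₑ
      ≤ (D l + G l) + (H l + H (-l)) := by
    intro l
    rw [cf_v_eq (α := α) (u := u) t l, ← hAdef]
    by_cases hl : l ∈ box N
    · refine le_trans ?_ le_self_add
      rw [trunc_of_mem hl, dft_vN_succ hab hN n hl, ← hx]
      have e : Complex.I / 2 * dl a b α l * (A l - (starRingEnd ℂ) (A (-l)))
          - Complex.I / 2 * dl a b α l * (x l - (starRingEnd ℂ) (aliasSum N x (-l)))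
          = Complex.I * ((dl a b α l * (A l - x l)
            + -(starRingEnd ℂ) (dl a b α l * (A (-l) - aliasSum N x (-l)))) / 2) := by
        rw [map_mul, map_sub, Complex.conj_ofReal]; ring
      rw [e, hI]
      refine enorm_half_le ?_ ?_
      · rw [← hDA, trunc_of_mem hl]
      · rw [enorm_neg, enorm_conj, hG]; beta_reduce; rw [trunc_of_mem hl]
    · refine le_trans ?_ le_add_self
      rw [trunc_of_notMem hl, sub_zero]
      have e : Complex.I / 2 * dl a b α l * (A l - (starRingEnd ℂ) (A (-l)))
          = Complex.I * ((dl a b α l * A l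
            + -(starRingEnd ℂ) (dl a b α l * A (-l))) / 2) := by
        rw [map_mul, Complex.conj_ofReal]; ring
      rw [e, hI]
      refine enorm_half_le (hHA l hl) ?_
      rw [enorm_neg, enorm_conj]; exact hHA' l hl
  have hGle : mixed (cls N) G ≤ mixed (cls N) D + 3 * mixed (cls N) H := by
    have := mixed_reflect_le hab (by linarith : 0 ≤ α) hN2 hAs hxs
      (fun l hl => numCoeff_of_notMem hl)
    simp_rw [hDA] at this
    exact this
  -- The reflected error G costs D + 3H, and the frequencies outside the box add 2H.
  have hsum : l2 (fun l => (D l + G l) + (H l + H (-l)))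
      ≤ 2 * mixed (cls N) D + 5 * mixed (cls N) H := by
    refine (l2_le_mixed (cls N) _).trans ((mixed_add_le _ _ _).trans ((add_le_add
      ((mixed_add_le _ _ _).trans (add_le_add le_rfl hGle))
      ((mixed_add_le _ _ _).trans (add_le_add le_rfl (mixed_comp_neg (cls N) H).le))).trans
      (le_of_eq ?_)))
    ring
  have hHle : mixed (cls N) H
      ≤ ENNReal.ofReal (2 * offC m * profileBound m α M * ((b - a) / N) ^ m) := by
    have hb : l2 (fun l => bw a b (m + α / 2) l * ‖A l‖ₑ)
        ≤ ENNReal.ofReal (profileBound m α M) := by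
      simp_rw [hAdef, enorm_waveCoeff]
      exact hP.bound t htS
    refine (mixed_high_le hab hN hm _).trans ((mul_le_mul_right
      ((l2_bw_dl_mul_le a b (by linarith) m A).trans (mul_le_mul_right hb _)) _).trans
      (le_of_eq ?_))
    · rw [← ENNReal.ofReal_ofNat, ← ENNReal.ofReal_mul zero_le_two,
        ← ENNReal.ofReal_mul (by positivity)]
      congr 1; ring
  rw [totalError, ← ht]
  refine (add_le_add ((sobolevNorm_sub_interp_le hab (by linarith) h2
    (hs.cper_u t htS).1 _).trans ((l2_mono hu).trans hsum))
    ((sobolevNorm_zero_sub_interp hab (hs.cper_v t htS).1 _).le.trans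
      ((l2_mono hv).trans hsum))).trans ?_
  have e : 2 * mixed (cls N) D + 5 * mixed (cls N) H + (2 * mixed (cls N) D
      + 5 * mixed (cls N) H) = 4 * mixed (cls N) D + 10 * mixed (cls N) H := by ring
  rw [e]
  refine add_le_add le_rfl ((mul_le_mul_right hHle _).trans (le_of_eq ?_))
  rw [← ENNReal.ofReal_ofNat, ← ENNReal.ofReal_mul (by norm_num)]
  congr 1; ring

end conversion


/-! ### Uniform constants and the final estimates. -/

/-- The convergence estimate with the resonant remainder expressed through the time step. -/
lemma exists_totalError_le {a b α m T : ℝ} (hab : a < b) (h1 : 1 < α) (h2 : α ≤ 2) (hm : 1 < m)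
    (hT : 0 < T) (M : ℝ) :
    ∃ η : ℝ, 0 < η ∧ η < 1 ∧ ∃ C : ℝ, 0 < C ∧
      ∀ ε : ℝ, 0 < ε → ε ≤ 1 → ∀ (u₀ u₁ : ℝ × ℝ → ℝ) (u v : ℝ → ℝ × ℝ → ℝ),
        IsSolution a b α ε (T / ε ^ 2) u₀ u₁ u v →
        AssumptionA a b α m (T / ε ^ 2) M u v →
      ∀ N : ℕ, 0 < N → Even N → (b - a) / N ≤ η → ∀ τ : ℝ, 0 < τ → τ ≤ η →
      ∀ n : ℕ, (n : ℝ) ≤ T / ε ^ 2 / τ →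
        totalError a b α ε τ N u₀ u₁ u v n ≤ ENNReal.ofReal
          (C * (((b - a) / N) ^ m + ε ^ 2 * τ ^ 2 + τ ^ (2 * (m + α / 2) / α))) := by
  set R := profileBound m α M with hRdef
  set R₀ := 2 * posC m α M + velC m M with hR₀def
  have hR : 0 ≤ R := profileBound_nonneg m α M
  have hp := posC_nonneg m α M
  have hv := velC_nonneg m M
  have hR₀ : 0 ≤ R₀ := by positivity
  have ho := offC_nonneg m
  have hfirst := firstC_nonneg (a := a) (b := b) (m := m) (σ := m + α / 2) hT.le hR hR₀
  have hsecond := secondC_nonneg (a := a) (b := b) (α := α) (m := m) hT.le hR hR₀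
  set θ := (m - 1) / 2 with hθdef
  have hθ : 0 < θ := by linarith
  set K := firstC a b m (m + α / 2) T R R₀ * Real.exp (T * Real.exp (massC a b (m + α / 2) R)) + 1
    with hK
  have hK1 : 1 ≤ K := by
    have : 0 ≤ firstC a b m (m + α / 2) T R R₀
      * Real.exp (T * Real.exp (massC a b (m + α / 2) R)) := by positivity
    linarith
  have hK0 : 0 < K := by linarith
  -- Requiring τ ≤ r and h ≤ r^{1/θ} bounds τ + h^θ by 1/K, which is the smallness condition of the
  -- bootstrap.
  set r := 1 / (2 * K) with hr
  have hr0 : 0 < r := by positivity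
  have hr1 : r < 1 := by rw [hr, div_lt_one (by positivity)]; linarith
  refine ⟨min r (r ^ (1 / θ)), lt_min hr0 (by positivity), (min_le_left _ _).trans_lt hr1,
    4 * secondC a b α m T R R₀ + 20 * offC m * R + offC m * (4 * posC m α M + 2 * velC m M) + 1,
    by positivity, ?_⟩
  intro ε hε hε1 u₀ u₁ u v hs hA N hN hN2 hh τ hτ hτη n hn
  have hba : 0 < b - a := sub_pos.2 hab
  have hNr : (0 : ℝ) < N := by exact_mod_cast hN
  have hh0 : 0 < (b - a) / N := by positivity
  have hS : 0 < T / ε ^ 2 := by positivity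
  have hnS : n * τ ≤ T / ε ^ 2 := (le_div_iff₀ hτ).1 hn
  have x1 : 0 ≤ ((b - a) / N) ^ m := by positivity
  have x2 : 0 ≤ ε ^ 2 * τ ^ 2 := by positivity
  have x3 : 0 ≤ τ ^ (2 * (m + α / 2) / α) := by positivity
  -- The values u⁰ and v⁰ are sampled from the data rather than recovered from φ⁰, so n = 0 is a
  -- pure interpolation estimate.
  rcases Nat.eq_zero_or_pos n with rfl | hn0
  · refine (hs.totalError_zero_le hab h1 h2 hm hS hA hN hN2).trans (ENNReal.ofReal_le_ofReal ?_)
    gcongr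
    · have : 0 ≤ 4 * secondC a b α m T R R₀ + 20 * offC m * R := by positivity
      linarith
    · linarith
  obtain ⟨k, rfl⟩ : ∃ k, n = k + 1 := ⟨n - 1, by omega⟩
  refine (hs.totalError_succ_le hab h1 h2 hm hε.ne' hS hA hN hN2 hτ.le k hnS).trans ?_
  have hsmall : firstC a b m (m + α / 2) T R R₀ * (τ + ((b - a) / N) ^ θ)
      * Real.exp (T * Real.exp (massC a b (m + α / 2) R)) ≤ 1 := by
    have hhθ : ((b - a) / N) ^ θ ≤ r := by
      calc ((b - a) / N) ^ θ ≤ (r ^ (1 / θ)) ^ θ :=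
            Real.rpow_le_rpow hh0.le (hh.trans (min_le_right _ _)) hθ.le
        _ = r := by rw [← Real.rpow_mul hr0.le, one_div_mul_cancel hθ.ne', Real.rpow_one]
    have hτr : τ ≤ r := hτη.trans (min_le_left _ _)
    calc _ = (K - 1) * (τ + ((b - a) / N) ^ θ) := by rw [hK]; ring
      _ ≤ K * (r + r) := by
          have : 0 ≤ ((b - a) / N) ^ θ := by positivity
          gcongr
          linarith
      _ = 1 := by rw [hr]; field_simp; ring
  have hST : T / ε ^ 2 * ε ^ 2 ≤ T := by
    rw [div_mul_cancel₀ _ (by positivity)]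
  have hmain := (hs.isProfile hab h1 h2 hm hε.ne' hS hA).mixed_errSeq_le_rate
    (isScheme_numProfile (u₀ := u₀) (u₁ := u₁) hab hN hε.ne') hab h1 h2 hm hN hN2 hτ
    (hτη.trans ((min_le_left _ _).trans hr1.le)) hε hε1 hR hR₀ hST
    (fun B hB htail => by
      have hF : ∀ p : ℤ × ℤ → ℝ≥0∞,
          mixed ((0 : ZMod N × ZMod N →+ PUnit.{1}).comp (cls N)) p = ∑' l, p l :=
        mixed_zero_hom _
      have := hs.mixed_errSeq_zero_le (τ := τ) (0 : ZMod N × ZMod N →+ PUnit.{1}) hab h1 hm hS hA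
        hN hB (fun x => by rw [hF]; exact htail x)
      rwa [hF] at this)
    (fun B hB htail => by
      have hid : (AddMonoidHom.id (ZMod N × ZMod N)).comp (cls N) = cls N :=
        AddMonoidHom.id_comp _
      have := hs.mixed_errSeq_zero_le (τ := τ) (AddMonoidHom.id (ZMod N × ZMod N)) hab h1 hm hS hA
        hN hB (fun x => by rw [hid]; exact htail x)
      rwa [hid] at this)
    hsmall (k + 1) hnS
  refine (add_le_add (mul_le_mul_right hmain 4) le_rfl).trans ?_
  rw [← ENNReal.ofReal_ofNat, ← ENNReal.ofReal_mul (by norm_num),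
    ← ENNReal.ofReal_add (by positivity) (by positivity)]
  refine ENNReal.ofReal_le_ofReal ?_
  rw [← mul_assoc]
  have y1 : 0 ≤ 20 * offC m * R := by positivity
  have y2 : 0 ≤ offC m * (4 * posC m α M + 2 * velC m M) := by positivity
  set s := ((b - a) / N) ^ m + ε ^ 2 * τ ^ 2 + τ ^ (2 * (m + α / 2) / α) with hsdef
  have hs1 : ((b - a) / N) ^ m ≤ s := by linarith
  have hs0 : 0 ≤ s := x1.trans hs1
  have z1 := mul_le_mul_of_nonneg_left hs1 y1
  have z2 := mul_nonneg y2 hs0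
  nlinarith

/-- The denominator is at least 1, because all factors of the second term under the root are. What
matters is the scaling τ ≲ τ₀^{α/2}. -/
lemma tauBound_le {a b α γ τ₀ : ℝ} (hab : a < b) (h1 : 1 < α) (hγ0 : 0 < γ) (hγ1 : γ < 1)
    (hτ₀ : 0 < τ₀) : tauBound a b α γ τ₀ ≤ Real.pi * (b - a) ^ (α / 2) * τ₀ ^ (α / 2) := by
  have hba : 0 < b - a := sub_pos.2 hab
  have hpi := Real.pi_pos
  have hden : 1 ≤ 2 * Real.sqrt (τ₀ ^ α * (b - a) ^ α
      + (2 : ℝ) ^ (3 * α / 2) * Real.pi ^ α * (1 + τ₀) ^ α) := by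
    have e1 : (1 : ℝ) ≤ (2 : ℝ) ^ (3 * α / 2) := Real.one_le_rpow (by norm_num) (by linarith)
    have e2 : (1 : ℝ) ≤ Real.pi ^ α :=
      Real.one_le_rpow (by linarith [Real.pi_gt_three]) (by linarith)
    have e3 : (1 : ℝ) ≤ (1 + τ₀) ^ α := Real.one_le_rpow (by linarith) (by linarith)
    have e4 : 0 ≤ τ₀ ^ α * (b - a) ^ α := by positivity
    have e5 : 1 ≤ (2 : ℝ) ^ (3 * α / 2) * Real.pi ^ α * (1 + τ₀) ^ α :=
      one_le_mul_of_one_le_of_one_le (one_le_mul_of_one_le_of_one_le e1 e2) e3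
    have e6 : 1 ≤ Real.sqrt (τ₀ ^ α * (b - a) ^ α
      + (2 : ℝ) ^ (3 * α / 2) * Real.pi ^ α * (1 + τ₀) ^ α) := by
      rw [Real.one_le_sqrt]; linarith
    linarith
  have hnum : 0 ≤ Real.pi * (b - a) ^ (α / 2) * τ₀ ^ (α / 2) := by positivity
  rw [tauBound]
  calc _ ≤ 1 * (Real.pi * (b - a) ^ (α / 2) * τ₀ ^ (α / 2) / 1) := by gcongr
    _ = _ := by ring

/-- For smooth solutions the resonant remainder is smaller than any power of the time step. -/
lemma exists_totalError_le_of_smooth {a b α m T : ℝ} (hab : a < b) (h1 : 1 < α) (h2 : α ≤ 2)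
    (hT : 0 < T) (M : ℕ → ℝ) (p : ℝ) :
    ∃ h₀ : ℝ, 0 < h₀ ∧ ∃ τs : ℝ, 0 < τs ∧ ∃ C : ℝ, 0 < C ∧
      ∀ ε : ℝ, 0 < ε → ε ≤ 1 → ∀ (u₀ u₁ : ℝ × ℝ → ℝ) (u v : ℝ → ℝ × ℝ → ℝ),
        IsSolution a b α ε (T / ε ^ 2) u₀ u₁ u v →
        (∀ j : ℕ, AssumptionA a b α j (T / ε ^ 2) (M j) u v) →
      ∀ N : ℕ, 0 < N → Even N → (b - a) / N ≤ h₀ → ∀ τ : ℝ, 0 < τ → τ < τs →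
      ∀ n : ℕ, (n : ℝ) ≤ T / ε ^ 2 / τ →
        totalError a b α ε τ N u₀ u₁ u v n ≤
          ENNReal.ofReal (C * (((b - a) / N) ^ m + ε ^ 2 * τ ^ 2 + τ ^ p)) := by
  -- The estimate is used with regularity j: j ≥ m gives h^j ≤ h^m for h < 1, j ≥ p gives 2(j +
  -- α/2)/α ≥ j ≥ p since α ≤ 2, and j ≥ 2 meets the requirement of an index above 1.
  obtain ⟨j, hj⟩ := exists_nat_ge (max (max m p) 2)
  have hjm : m ≤ j := (le_max_left _ _).trans ((le_max_left _ _).trans hj)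
  have hjp : p ≤ j := (le_max_right _ _).trans ((le_max_left _ _).trans hj)
  have hj2 : (2 : ℝ) ≤ j := (le_max_right _ _).trans hj
  obtain ⟨η, hη, hη1, C, hC, hmain⟩ := exists_totalError_le (m := (j : ℝ)) hab h1 h2
    (by linarith) hT (M j)
  refine ⟨η, hη, η, hη, C, hC, ?_⟩
  intro ε hε hε1 u₀ u₁ u v hs hA N hN hN2 hh τ hτ hτη n hn
  have hba : 0 < b - a := sub_pos.2 hab
  have hNr : (0 : ℝ) < N := by exact_mod_cast hN
  refine (hmain ε hε hε1 u₀ u₁ u v hs (hA j) N hN hN2 hh τ hτ hτη.le n hn).trans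
    (ENNReal.ofReal_le_ofReal ?_)
  gcongr ?_ * (?_ + _ + ?_)
  · exact Real.rpow_le_rpow_of_exponent_ge (by positivity) (hh.trans hη1.le) hjm
  · refine Real.rpow_le_rpow_of_exponent_ge hτ (hτη.trans hη1).le ?_
    rw [le_div_iff₀ (by linarith)]
    nlinarith

end TSFP

theorem theorem2 (a b : ℝ) (hab : a < b) (α : ℝ) (hα : 1 < α) (hα' : α ≤ 2)
    (m : ℝ) (hm : 1 < m) (T : ℝ) (hT : 0 < T) :
    -- the general bound
    (∀ γ : ℝ, 0 < γ → γ < 1 → ∀ M : ℝ,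
      ∃ h₀ : ℝ, 0 < h₀ ∧ ∃ τs : ℝ, 0 < τs ∧ τs < 1 ∧ ∃ C : ℝ, 0 < C ∧
        ∀ ε : ℝ, 0 < ε → ε ≤ 1 →
        ∀ (u₀ u₁ : ℝ × ℝ → ℝ) (u v : ℝ → ℝ × ℝ → ℝ),
          TSFP.IsSolution a b α ε (T / ε ^ 2) u₀ u₁ u v →
          TSFP.AssumptionA a b α m (T / ε ^ 2) M u v →
        ∀ N : ℕ, 0 < N → Even N → (b - a) / N ≤ h₀ →
        ∀ τ₀ : ℝ, 0 < τ₀ → τ₀ ≤ τs →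
        ∀ τ : ℝ, 0 < τ → τ < TSFP.tauBound a b α γ τ₀ →
        ∀ n : ℕ, (n : ℝ) ≤ T / ε ^ 2 / τ →
          TSFP.totalError a b α ε τ N u₀ u₁ u v n ≤
            ENNReal.ofReal
              (C * (((b - a) / N) ^ m + ε ^ 2 * τ ^ 2 + τ₀ ^ (m + α / 2)))) ∧
    -- smooth solutions: the last term is smaller than any power of the time step
    (∀ M : ℕ → ℝ, ∀ p : ℝ, 0 < p →
      ∃ h₀ : ℝ, 0 < h₀ ∧ ∃ τs : ℝ, 0 < τs ∧ ∃ C : ℝ, 0 < C ∧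
        ∀ ε : ℝ, 0 < ε → ε ≤ 1 →
        ∀ (u₀ u₁ : ℝ × ℝ → ℝ) (u v : ℝ → ℝ × ℝ → ℝ),
          TSFP.IsSolution a b α ε (T / ε ^ 2) u₀ u₁ u v →
          (∀ j : ℕ, TSFP.AssumptionA a b α j (T / ε ^ 2) (M j) u v) →
        ∀ N : ℕ, 0 < N → Even N → (b - a) / N ≤ h₀ →
        ∀ τ : ℝ, 0 < τ → τ < τs →
        ∀ n : ℕ, (n : ℝ) ≤ T / ε ^ 2 / τ →
          TSFP.totalError a b α ε τ N u₀ u₁ u v n ≤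
            ENNReal.ofReal (C * (((b - a) / N) ^ m + ε ^ 2 * τ ^ 2 + τ ^ p))) ∧
    -- smooth solutions: the last term disappears for small time steps
    (∀ M : ℕ → ℝ, ∀ κ : ℝ, 0 < κ →
      ∃ h₀ : ℝ, 0 < h₀ ∧ ∃ τs : ℝ, 0 < τs ∧ ∃ C : ℝ, 0 < C ∧
        ∀ ε : ℝ, 0 < ε → ε ≤ 1 →
        ∀ (u₀ u₁ : ℝ × ℝ → ℝ) (u v : ℝ → ℝ × ℝ → ℝ),
          TSFP.IsSolution a b α ε (T / ε ^ 2) u₀ u₁ u v →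
          (∀ j : ℕ, TSFP.AssumptionA a b α j (T / ε ^ 2) (M j) u v) →
        ∀ N : ℕ, 0 < N → Even N → (b - a) / N ≤ h₀ →
        ∀ τ : ℝ, 0 < τ → τ < τs → τ ≤ ε ^ κ →
        ∀ n : ℕ, (n : ℝ) ≤ T / ε ^ 2 / τ →
          TSFP.totalError a b α ε τ N u₀ u₁ u v n ≤
            ENNReal.ofReal (C * (((b - a) / N) ^ m + ε ^ 2 * τ ^ 2))) := by
  refine ⟨fun γ hγ0 hγ1 M => ?_,
    fun M p _ => TSFP.exists_totalError_le_of_smooth hab hα hα' hT M p, fun M κ hκ => ?_⟩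
  · obtain ⟨η, hη, -, C, hC, hmain⟩ := TSFP.exists_totalError_le hab hα hα' hm hT M
    have hba : 0 < b - a := sub_pos.2 hab
    have hpi := Real.pi_pos
    set c := Real.pi * (b - a) ^ (α / 2) with hc
    have hc0 : 0 < c := by positivity
    have hc2 : 0 ≤ c ^ (2 * (m + α / 2) / α) := by positivity
    -- The second entry makes cτ₀^{α/2} ≤ η, so that the step size restriction implies τ ≤ η; the
    -- first keeps the threshold below 1.
    refine ⟨η, hη, min (1 / 2) ((η / c) ^ (2 / α)), lt_min (by norm_num) (by positivity),
      (min_le_left _ _).trans_lt (by norm_num), C * (1 + c ^ (2 * (m + α / 2) / α)),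
      by positivity, ?_⟩
    intro ε hε hε1 u₀ u₁ u v hs hA N hN hN2 hh τ₀ hτ₀ hτ₀s τ hτ hτb n hn
    have hτc : τ ≤ c * τ₀ ^ (α / 2) := (hτb.trans_le (TSFP.tauBound_le hab hα hγ0 hγ1 hτ₀)).le
    have hτη : τ ≤ η := by
      refine hτc.trans ?_
      have h := Real.rpow_le_rpow hτ₀.le (hτ₀s.trans (min_le_right _ _))
        (by linarith : 0 ≤ α / 2)
      rw [← Real.rpow_mul (by positivity), div_mul_div_cancel₀ (by positivity),
        div_self (by norm_num), Real.rpow_one, le_div_iff₀ hc0] at h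
      linarith
    refine (hmain ε hε hε1 u₀ u₁ u v hs hA N hN hN2 hh τ hτ hτη n hn).trans
      (ENNReal.ofReal_le_ofReal ?_)
    -- The exponents multiply to (α/2)·2(m + α/2)/α = m + α/2, which turns the resonant remainder
    -- into the stated power of τ₀.
    have hτσ : τ ^ (2 * (m + α / 2) / α)
        ≤ c ^ (2 * (m + α / 2) / α) * τ₀ ^ (m + α / 2) := by
      refine (Real.rpow_le_rpow hτ.le hτc (by positivity)).trans (le_of_eq ?_)
      rw [Real.mul_rpow hc0.le (by positivity), ← Real.rpow_mul hτ₀.le]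
      congr 2
      field_simp
    rw [mul_assoc]
    refine mul_le_mul_of_nonneg_left ?_ hC.le
    have x1 : 0 ≤ ((b - a) / N) ^ m := by positivity
    have x2 : 0 ≤ ε ^ 2 * τ ^ 2 := by positivity
    have x3 : 0 ≤ τ₀ ^ (m + α / 2) := by positivity
    nlinarith [mul_nonneg hc2 x1, mul_nonneg hc2 x2]
  -- With p = 2 + 2/κ the condition τ ≤ ε^κ gives τ^{2/κ} ≤ ε², so the remainder τ^p is absorbed by
  -- ε²τ².
  · obtain ⟨h₀, hh₀, τs, hτs, C, hC, hmain⟩ :=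
      TSFP.exists_totalError_le_of_smooth (m := m) hab hα hα' hT M (2 + 2 / κ)
    refine ⟨h₀, hh₀, τs, hτs, 2 * C, by positivity, ?_⟩
    intro ε hε hε1 u₀ u₁ u v hs hA N hN hN2 hh τ hτ hττs hτε n hn
    have hba : 0 < b - a := sub_pos.2 hab
    refine (hmain ε hε hε1 u₀ u₁ u v hs hA N hN hN2 hh τ hτ hττs n hn).trans
      (ENNReal.ofReal_le_ofReal ?_)
    have hp : τ ^ (2 + 2 / κ) ≤ ε ^ 2 * τ ^ 2 := by
      have h := Real.rpow_le_rpow hτ.le hτε (by positivity : 0 ≤ 2 / κ)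
      rw [← Real.rpow_mul hε.le, mul_div_cancel₀ _ hκ.ne', Real.rpow_two] at h
      rw [Real.rpow_add hτ, Real.rpow_two]
      nlinarith [sq_nonneg τ]
    have x1 : 0 ≤ ((b - a) / N) ^ m := by positivity
    have : C * (((b - a) / N) ^ m + ε ^ 2 * τ ^ 2 + τ ^ (2 + 2 / κ))
        ≤ C * (2 * (((b - a) / N) ^ m + ε ^ 2 * τ ^ 2)) := by
      gcongr
      linarith
    linarith
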